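/- \textbf{Setting.} Let $d,l\ge 0$ be integers, let $E$ be a set on which $\mathbb Z^d$ acts by shifts, partitioned as $E=\biguplus_{x\in\mathbb Z^d,\,t\in\mathbb Z^l}E_{x,t}$ with $E_{x,t}+a=E_{x+a,t}$ for $a\in\mathbb Z^d$, and let $M$ be a measurable space. Let $\mathcal X:E\to M$ be a random field (with the product $\sigma$-algebra on $M^E$) that is completely independent, that is, the restrictions $\mathcal X|_{E_{x,t}}$ are independent, and whose law is invariant under the shifts of $\mathbb Z^d$. Let $\mathcal X'$ be an i.i.d. copy of $\mathcal X$, the pair $(\mathcal X,\mathcal X')$ being realized on the canonical product space $M^E\times M^E$. For $B\subset\mathbb Z^d\times\mathbb Z^l$ let $\mathcal X^B$ be equal to $\mathcal X'$ on $\bigcup_{(x,t)\in B}E_{x,t}$ and to $\mathcal X$ elsewhere, and write $\mathcal X^{z}=\mathcal X^{\{z\}}$, $\mathcal X^{z;z'}=\mathcal X^{\{z,z'\}}$ for $z=(x,t)$, $z'=(x',t')$. Let $A=A(\mathcal X)$ be a $\sigma(\mathcal X)$-measurable real random field on $\mathbb R^d$ such that, for every $a\in\mathbb Z^d$, almost surely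 $A(\mathcal X(\cdot+a,\cdot))=A(\mathcal X)(\cdot+a)$. Let $Q(x)=x+[-\frac12,\frac12)^d$, $Q_r(x)=x+[-\frac r2,\frac r2)^d$, and let $B_r$ be the closed Euclidean ball of radius $r$ centered at $0$. An \emph{action radius for $A(\mathcal X^B)$ with respect to $\mathcal X^B$ on $E_{x,t}$} is a $[0,\infty)$-valued $\sigma(\mathcal X,\mathcal X')$-measurable random variable $\rho$ such that almost surely $A(\mathcal X^{B\cup\{(x,t)\}})=A(\mathcal X^B)$ on $\mathbb R^d\setminus(Q(x)+B_\rho)$. For $z=(x,t)$, $z'=(x',t')$, integers $\ell,\ell'\ge1$ and a random variable $Z=Z(A)$, put $$\partial_{\ell,z}Z=\big(Z(A)-Z(A(\mathcal X^{z}))\big)\mathbf 1_{A(\mathcal X^{z})=A\text{ on }\mathbb R^d\setminus Q_{2\ell+1}(x)},$$ $$\begin{aligned}\partial_{\ell,z}\partial_{\ell',z'}Z=\ &\big(Z(A)-Z(A(\mathcal X^{z}))-Z(A(\mathcal X^{z'}))+Z(A(\mathcal X^{z;z'}))\big)\\ &\times\mathbf 1_{A(\mathcal X^{z})=A,\ A(\mathcal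 X^{z;z'})=A(\mathcal X^{z'})\text{ on }\mathbb R^d\setminus Q_{2\ell+1}(x)}\,\mathbf 1_{A(\mathcal X^{z'})=A,\ A(\mathcal X^{z;z'})=A(\mathcal X^{z})\text{ on }\mathbb R^d\setminus Q_{2\ell'+1}(x')}.\end{aligned}$$ Write $\|Y\|_p=\mathbb E[|Y|^p]^{1/p}$. For a weight $\pi(t,\ell)$, exponents $a_3,a_2>0$ and $\sigma^2=\operatorname{Var}Z$, set, with $p=\frac4{1-\lambda}$ and with sums over $z=(x,t)$, $z'=(x',t')$, $z''=(x'',t'')$ in $\mathbb Z^d\times\mathbb Z^l$ and $\ell,\ell',\ell''\ge1$, $$\begin{aligned}R_{a_3,a_2}(Z)=\ &\sigma^{-2}\inf_{0<\lambda<1}\Big(\sum_{z,z',z''}\sum_{\ell,\ell',\ell''}\big(\pi(t,\ell)\pi(t',\ell')\pi(t'',\ell'')\big)^{a_3\lambda}\|\partial_{\ell,z}\partial_{\ell',z'}Z\|_{p}\|\partial_{\ell,z}\partial_{\ell'',z''}Z\|_{p}\|\partial_{\ell',z'}Z\|_{p}\|\partial_{\ell'',z''}Z\|_{p}\Big)^{\frac12}\\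 &+\sigma^{-2}\inf_{0<\lambda<1}\Big(\sum_{z,z'}\sum_{\ell,\ell'}\big(\pi(t,\ell)\pi(t',\ell')\big)^{a_2\lambda}\|\partial_{\ell,z}\partial_{\ell',z'}Z\|_{p}^2\|\partial_{\ell',z'}Z\|_{p}^2\Big)^{\frac12}\\ &+\sigma^{-2}\inf_{0<\lambda<1}\Big(\sum_{z}\sum_\ell\pi(t,\ell)^\lambda\|\partial_{\ell,z}Z\|_{p}^4\Big)^{\frac12} +\sigma^{-3}\inf_{0<\lambda<1}\sum_z\sum_\ell\pi(t,\ell)^\lambda\,\mathbb E\big[|\partial_{\ell,z}Z|^{\frac3{1-\lambda}}\big]^{1-\lambda},\end{aligned}$$ $$G_1(Z)=\sigma^{-3}\inf_{0<\lambda<1}\sum_z\Big(\sum_\ell\pi(t,\ell)^\lambda\,\mathbb E\big[|\partial_{\ell,z}Z|^{\frac6{1-\lambda}}\big]^{1-\lambda}\Big)^{\frac12},\qquad G_2(Z)=\sigma^{-3}\inf_{0<\lambda<1}\sum_z\sum_\ell\pi(t,\ell)^\lambda\,\mathbb E\big[|\partial_{\ell,z}Z|^{\frac6{1-\lambda}}\big]^{\frac{1-\lambda}2},$$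 with values in $[0,\infty]$ and the convention $0\cdot\infty=0$. Let $\operatorname d_W$ and $\operatorname d_K$ be the $1$-Wasserstein and Kolmogorov distances, $\mathcal N$ a standard Gaussian, and $\widehat Z=\sigma^{-1}(Z-\mathbb E Z)$. \textbf{Theorem.} There is a constant $C<\infty$ depending only on $d$ such that the following holds in every such setting. (1) Assume that for all $(x,t)$ and $B$ there is an action radius $\rho_{x,t}(\mathcal X^B)$ for $A(\mathcal X^B)$ with respect to $\mathcal X^B$ on $E_{x,t}$, and that $\tilde\rho_{x,t}:=\sup_{B}\rho_{x,t}(\mathcal X^B)$ satisfies $\tilde\rho_{0,t}<\infty$ almost surely for all $t$. Let $\pi(t,\ell)=\mathbb P[\ell-1\le\tilde\rho_{0,t}<\ell,\ \mathcal X\neq\mathcal X^{0,t}]$. Then for every $\sigma(A)$-measurable square-integrable $Z=Z(A)$ with $\sigma^2>0$, $$\text{(i) }\ \operatorname d_W(\widehat Z,\mathcal N)\le C\,R_{\frac13,\frac12}(Z),\qquad\text{(ii) }\ \operatorname d_K(\widehat Z,\mathcal N)\le C\big(R_{\frac13,\frac12}(Z)+G_1(Z)\big).$$ (2) Assume instead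 that for all $(x,t)$ there is a $\sigma(\mathcal X|_{E_{x,t}},\mathcal X'|_{E_{x,t}})$-measurable action radius $\rho_{x,t}$ for $A(\mathcal X)$ with respect to $\mathcal X$ on $E_{x,t}$. Then $\rho_{x,t}$ is an action radius for $A(\mathcal X^B)$ with respect to $\mathcal X^B$ on $E_{x,t}$ for every $B$, so that with the choice $\rho_{x,t}(\mathcal X^B):=\rho_{x,t}$ one has $\tilde\rho_{x,t}=\rho_{x,t}$; and with $\pi(t,\ell)=\mathbb P[\ell-1\le\rho_{0,t}<\ell,\ \mathcal X\neq\mathcal X^{0,t}]$, for every $Z$ as in (1), $$\operatorname d_W(\widehat Z,\mathcal N)\le C\,R_{1,1}(Z),\qquad \operatorname d_K(\widehat Z,\mathcal N)\le C\big(R_{1,1}(Z)+G_2(Z)\big).$$ -/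

import Mathlib

open MeasureTheory ProbabilityTheory
open scoped NNReal ENNReal Pointwise

noncomputable section

/-! ### Distances between laws on the real line -/

/-- The `1`-Wasserstein distance: supremum over all `1`-Lipschitz test functions. -/
def wassersteinDist (P Q : Measure ℝ) : ℝ≥0∞ :=
  ⨆ h : {h : ℝ → ℝ // LipschitzWith 1 h}, ENNReal.ofReal |(∫ x, h.1 x ∂P) - ∫ x, h.1 x ∂Q|

/-- The Kolmogorov distance: uniform distance of the distribution functions. -/
def kolmogorovDist (P Q : Measure ℝ) : ℝ≥0∞ :=
  ⨆ s : ℝ, ENNReal.ofReal |P.real (Set.Iic s) - Q.real (Set.Iic s)|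

namespace Multiscale

/-! ### Geometry -/

/-- The index set `ℤ^d × ℤ^l` of the partition. -/
abbrev Site (d l : ℕ) : Type := (Fin d → ℤ) × (Fin l → ℤ)

/-- An integer vector seen as a point of `ℝ^d`. -/
def intVec {d : ℕ} (a : Fin d → ℤ) : EuclideanSpace ℝ (Fin d) :=
  WithLp.toLp 2 fun i => (a i : ℝ)

/-- The cube `Q_r(x) = x + [-r/2, r/2)^d`. -/
def cube {d : ℕ} (r : ℝ) (x : EuclideanSpace ℝ (Fin d)) : Set (EuclideanSpace ℝ (Fin d)) :=
  {y | ∀ i, y i - x i ∈ Set.Ico (-(r / 2)) (r / 2)}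

/-! ### The field, its independent copy and the resampled fields

A random field `X` on `E` with values in `M` is given by its law `μ` on `E → M`
(with the product σ-algebra). The pair `(X, X')` of `X` and an i.i.d. copy is realized as
`ω = (ω.1, ω.2)` under `μ.prod μ`. The partition of `E` is given by `cell : E → ℤ^d × ℤ^l`,
so that `E_{x,t} = cell ⁻¹' {(x, t)}`. -/

section Field

variable {d l : ℕ} {E M : Type*} [MeasurableSpace M]

/-- Complete independence: the restrictions of the field to the cells are independent. -/
def CompletelyIndependent (cell : E → Site d l) (μ : Measure (E → M)) : Prop :=
  iIndepFun (fun (z : Site d l) (x : E → M) => (cell ⁻¹' {z}).domRestrict x) μ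

/-- The shifted field `X(· + a, ·)`. -/
def shiftField [AddAction (Fin d → ℤ) E] (a : Fin d → ℤ) (x : E → M) : E → M :=
  fun e => x (a +ᵥ e)

/-- The law of the field is invariant under all integer shifts. -/
def StationaryLaw (d : ℕ) [AddAction (Fin d → ℤ) E] (μ : Measure (E → M)) : Prop :=
  ∀ a : Fin d → ℤ, μ.map (shiftField a) = μ

/-- Stationarity of the transformation `A`: almost surely `A(X(· + a, ·)) = A(X)(· + a)`. -/
def StationaryTransformation [AddAction (Fin d → ℤ) E]
    (A : (E → M) → EuclideanSpace ℝ (Fin d) → ℝ) (μ : Measure (E → M)) : Prop :=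
  ∀ a : Fin d → ℤ, ∀ᵐ x ∂μ, ∀ y, A (shiftField a x) y = A x (y + intVec a)

open Classical in
/-- The field `X^B`, equal to `X'` on the cells indexed by `B` and to `X` on the others. -/
def resample (cell : E → Site d l) (B : Set (Site d l)) (ω : (E → M) × (E → M)) : E → M :=
  fun e => if cell e ∈ B then ω.2 e else ω.1 e

/-- `ρ` is an action radius for `A(X^B)` with respect to `X^B` on the cell `z = (x, t)`, with
reference perturbation `X'`: it is `σ(X, X')`-measurable, and almost surely `A(X^{B ∪ {z}})` and
`A(X^B)` coincide outside `Q(x) + B_ρ`. -/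
def IsActionRadius (A : (E → M) → EuclideanSpace ℝ (Fin d) → ℝ) (cell : E → Site d l)
    (μ : Measure (E → M)) (B : Set (Site d l)) (z : Site d l)
    (ρ : (E → M) × (E → M) → ℝ≥0) : Prop :=
  Measurable ρ ∧ ∀ᵐ ω ∂(μ.prod μ),
    Set.EqOn (A (resample cell (insert z B) ω)) (A (resample cell B ω))
      (cube 1 (intVec z.1) + Metric.closedBall 0 (ρ ω : ℝ))ᶜ

/-- The strengthened radius `ρ̃_z = sup_B ρ_z(X^B)`, with values in `[0, ∞]`. -/
def supRadius (ρ : Site d l → Set (Site d l) → (E → M) × (E → M) → ℝ≥0) (z : Site d l)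
    (ω : (E → M) × (E → M)) : ℝ≥0∞ :=
  ⨆ B : Set (Site d l), (ρ z B ω : ℝ≥0∞)

/-- `ρ` is measurable with respect to `σ(X|_{E_z}, X'|_{E_z})`. -/
def IsLocallyMeasurable (cell : E → Site d l) (z : Site d l)
    (ρ : (E → M) × (E → M) → ℝ≥0) : Prop :=
  Measurable[MeasurableSpace.comap (fun ω : (E → M) × (E → M) =>
    ((cell ⁻¹' {z}).domRestrict ω.1, (cell ⁻¹' {z}).domRestrict ω.2)) inferInstance] ρ

/-- The weight `π(t, ℓ) = P(ℓ - 1 ≤ R_{0,t} < ℓ, X ≠ X^{0,t})` of a family `R` of radii. -/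
def weight (cell : E → Site d l) (μ : Measure (E → M))
    (R : Site d l → (E → M) × (E → M) → ℝ≥0∞) (t : Fin l → ℤ) (ℓ : ℕ+) : ℝ≥0∞ :=
  (μ.prod μ) {ω | (ℓ : ℝ≥0∞) - 1 ≤ R (0, t) ω ∧ R (0, t) ω < (ℓ : ℝ≥0∞) ∧
    resample cell ∅ ω ≠ resample cell {(0, t)} ω}

/-! ### Discrete derivatives -/

/-- `A(X^{B'})` and `A(X^B)` coincide outside `Q_{2ℓ+1}(x)`. -/
def AgreeOutside (A : (E → M) → EuclideanSpace ℝ (Fin d) → ℝ) (cell : E → Site d l)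
    (ℓ : ℕ+) (x : Fin d → ℤ) (B' B : Set (Site d l)) (ω : (E → M) × (E → M)) : Prop :=
  Set.EqOn (A (resample cell B' ω)) (A (resample cell B ω)) (cube (2 * (ℓ : ℝ) + 1) (intVec x))ᶜ

open Classical in
/-- The localized discrete derivative `∂_{ℓ,z} Z`. -/
def discDeriv (A : (E → M) → EuclideanSpace ℝ (Fin d) → ℝ) (cell : E → Site d l)
    (Z : (EuclideanSpace ℝ (Fin d) → ℝ) → ℝ) (ℓ : ℕ+) (z : Site d l)
    (ω : (E → M) × (E → M)) : ℝ :=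
  if AgreeOutside A cell ℓ z.1 {z} ∅ ω then
    Z (A (resample cell ∅ ω)) - Z (A (resample cell {z} ω))
  else 0

open Classical in
/-- The localized discrete second derivative `∂_{ℓ,z} ∂_{ℓ',z'} Z`. -/
def discDeriv₂ (A : (E → M) → EuclideanSpace ℝ (Fin d) → ℝ) (cell : E → Site d l)
    (Z : (EuclideanSpace ℝ (Fin d) → ℝ) → ℝ) (ℓ : ℕ+) (z : Site d l) (ℓ' : ℕ+) (z' : Site d l)
    (ω : (E → M) × (E → M)) : ℝ :=
  if AgreeOutside A cell ℓ z.1 {z} ∅ ω ∧ AgreeOutside A cell ℓ z.1 {z, z'} {z'} ω ∧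
      AgreeOutside A cell ℓ' z'.1 {z'} ∅ ω ∧ AgreeOutside A cell ℓ' z'.1 {z, z'} {z} ω then
    Z (A (resample cell ∅ ω)) - Z (A (resample cell {z} ω)) - Z (A (resample cell {z'} ω))
      + Z (A (resample cell {z, z'} ω))
  else 0

/-- `E[|∂_{ℓ,z} Z|^p]`. -/
def moment₁ (A : (E → M) → EuclideanSpace ℝ (Fin d) → ℝ) (cell : E → Site d l)
    (μ : Measure (E → M)) (Z : (EuclideanSpace ℝ (Fin d) → ℝ) → ℝ) (p : ℝ)
    (ℓ : ℕ+) (z : Site d l) : ℝ≥0∞ :=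
  ∫⁻ ω, ‖discDeriv A cell Z ℓ z ω‖ₑ ^ p ∂(μ.prod μ)

/-- `E[|∂_{ℓ,z} ∂_{ℓ',z'} Z|^p]`. -/
def moment₂ (A : (E → M) → EuclideanSpace ℝ (Fin d) → ℝ) (cell : E → Site d l)
    (μ : Measure (E → M)) (Z : (EuclideanSpace ℝ (Fin d) → ℝ) → ℝ) (p : ℝ)
    (ℓ : ℕ+) (z : Site d l) (ℓ' : ℕ+) (z' : Site d l) : ℝ≥0∞ :=
  ∫⁻ ω, ‖discDeriv₂ A cell Z ℓ z ℓ' z' ω‖ₑ ^ p ∂(μ.prod μ)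

/-! ### The normalized variable and the bounds -/

/-- The standard deviation `σ` of `Z(A)`. -/
def stdDev (A : (E → M) → EuclideanSpace ℝ (Fin d) → ℝ) (μ : Measure (E → M))
    (Z : (EuclideanSpace ℝ (Fin d) → ℝ) → ℝ) : ℝ :=
  √(variance (fun x => Z (A x)) μ)

/-- The law of `σ⁻¹ (Z(A) - E[Z(A)])`. -/
def normalizedLaw (A : (E → M) → EuclideanSpace ℝ (Fin d) → ℝ) (μ : Measure (E → M))
    (Z : (EuclideanSpace ℝ (Fin d) → ℝ) → ℝ) : Measure ℝ :=
  μ.map fun x => (stdDev A μ Z)⁻¹ * (Z (A x) - ∫ x', Z (A x') ∂μ)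

/-- The bound on the Wasserstein distance, with weights `π^{a₃}` in the triple sum and `π^{a₂}`
in the double sum. The infima are over exponents `0 < θ < 1`. -/
def wassersteinBound (A : (E → M) → EuclideanSpace ℝ (Fin d) → ℝ) (cell : E → Site d l)
    (μ : Measure (E → M)) (Z : (EuclideanSpace ℝ (Fin d) → ℝ) → ℝ)
    (π : (Fin l → ℤ) → ℕ+ → ℝ≥0∞) (a₃ a₂ : ℝ) : ℝ≥0∞ :=
  ENNReal.ofReal ((stdDev A μ Z)⁻¹ ^ 2) *
    (⨅ θ : Set.Ioo (0 : ℝ) 1,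
      (∑' (z : Site d l) (z' : Site d l) (z'' : Site d l) (ℓ : ℕ+) (ℓ' : ℕ+) (ℓ'' : ℕ+),
        (π z.2 ℓ ^ a₃ * π z'.2 ℓ' ^ a₃ * π z''.2 ℓ'' ^ a₃) ^ (θ : ℝ)
          * moment₂ A cell μ Z (4 / (1 - (θ : ℝ))) ℓ z ℓ' z' ^ ((1 - (θ : ℝ)) / 4)
          * moment₂ A cell μ Z (4 / (1 - (θ : ℝ))) ℓ z ℓ'' z'' ^ ((1 - (θ : ℝ)) / 4)
          * moment₁ A cell μ Z (4 / (1 - (θ : ℝ))) ℓ' z' ^ ((1 - (θ : ℝ)) / 4)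
          * moment₁ A cell μ Z (4 / (1 - (θ : ℝ))) ℓ'' z'' ^ ((1 - (θ : ℝ)) / 4))
        ^ (1 / 2 : ℝ))
  + ENNReal.ofReal ((stdDev A μ Z)⁻¹ ^ 2) *
    (⨅ θ : Set.Ioo (0 : ℝ) 1,
      (∑' (z : Site d l) (z' : Site d l) (ℓ : ℕ+) (ℓ' : ℕ+),
        (π z.2 ℓ ^ a₂ * π z'.2 ℓ' ^ a₂) ^ (θ : ℝ)
          * moment₂ A cell μ Z (4 / (1 - (θ : ℝ))) ℓ z ℓ' z' ^ ((1 - (θ : ℝ)) / 2)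
          * moment₁ A cell μ Z (4 / (1 - (θ : ℝ))) ℓ' z' ^ ((1 - (θ : ℝ)) / 2))
        ^ (1 / 2 : ℝ))
  + ENNReal.ofReal ((stdDev A μ Z)⁻¹ ^ 2) *
    (⨅ θ : Set.Ioo (0 : ℝ) 1,
      (∑' (z : Site d l) (ℓ : ℕ+),
        π z.2 ℓ ^ (θ : ℝ) * moment₁ A cell μ Z (4 / (1 - (θ : ℝ))) ℓ z ^ (1 - (θ : ℝ)))
        ^ (1 / 2 : ℝ))
  + ENNReal.ofReal ((stdDev A μ Z)⁻¹ ^ 3) *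
    (⨅ θ : Set.Ioo (0 : ℝ) 1,
      ∑' (z : Site d l) (ℓ : ℕ+),
        π z.2 ℓ ^ (θ : ℝ) * moment₁ A cell μ Z (3 / (1 - (θ : ℝ))) ℓ z ^ (1 - (θ : ℝ)))

/-- The additional term `G₁(Z)`. -/
def extraTerm₁ (A : (E → M) → EuclideanSpace ℝ (Fin d) → ℝ) (cell : E → Site d l)
    (μ : Measure (E → M)) (Z : (EuclideanSpace ℝ (Fin d) → ℝ) → ℝ)
    (π : (Fin l → ℤ) → ℕ+ → ℝ≥0∞) : ℝ≥0∞ :=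
  ENNReal.ofReal ((stdDev A μ Z)⁻¹ ^ 3) *
    ⨅ θ : Set.Ioo (0 : ℝ) 1, ∑' z : Site d l,
      (∑' ℓ : ℕ+, π z.2 ℓ ^ (θ : ℝ)
        * moment₁ A cell μ Z (6 / (1 - (θ : ℝ))) ℓ z ^ (1 - (θ : ℝ))) ^ (1 / 2 : ℝ)

/-- The additional term `G₂(Z)`. -/
def extraTerm₂ (A : (E → M) → EuclideanSpace ℝ (Fin d) → ℝ) (cell : E → Site d l)
    (μ : Measure (E → M)) (Z : (EuclideanSpace ℝ (Fin d) → ℝ) → ℝ)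
    (π : (Fin l → ℤ) → ℕ+ → ℝ≥0∞) : ℝ≥0∞ :=
  ENNReal.ofReal ((stdDev A μ Z)⁻¹ ^ 3) *
    ⨅ θ : Set.Ioo (0 : ℝ) 1, ∑' (z : Site d l) (ℓ : ℕ+), π z.2 ℓ ^ (θ : ℝ)
        * moment₁ A cell μ Z (6 / (1 - (θ : ℝ))) ℓ z ^ ((1 - (θ : ℝ)) / 2)

end Field

end Multiscale

end

/-!
The distances to the Gaussian are bounded by Stein's method, with perturbations that exchange the
cells of the field `X` and of its copy `X'`. Exchanging any set of cells preserves the law of the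
pair (`Resampling.measurePreserving_swap`), and after an enumeration of the cells one may resample
them one after the other. Each step is odd under the exchange of its own cell, so that telescoping
gives a covariance identity (`Resampling.integral_mul_sub_mix`) and an approximate Stein coefficient
(`Resampling.steinCoeff`). Its mean tends to the variance, because the field with its first `n`
cells resampled becomes independent of the original field as `n` grows
(`Exchangeable.tendsto_integral_mul_mix`). With the regularity of the solutions of the Stein
equation (`Stein.exists_sol_of_lipschitz`, `Stein.exists_sol_of_indicator`), the distance is bounded
by third moments of the differences and by the fluctuation of the Stein coefficient. For the
Kolmogorov distance, the jump of the indicator contributes a monotone Taylor remainder; this is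
the covariance of the indicator with a second Stein coefficient, which involves an absolute value
and has mean zero (`Exchangeable.indicator_bound`).

The fluctuation is estimated by the Efron–Stein inequality
(`Exchangeable.sq_lintegral_enorm_sub_le`). Perturbing the field in a cell changes the terms of the
Stein coefficient by second differences, which are read on three fields: the field, the copy of the
Stein coefficient and the perturbing copy (`Exchangeable.fluctuation_le`). Expanding the square
produces products of two first and two second differences, in at most three cells.

These products are localized as follows. Each cell carries a layer, the scale at which its
resampling is felt (`Resampling.LayerBounds`). On the event that the layer is at most `ℓ`, the
difference is a localized derivative of scale `ℓ`; Hölder's inequality on each layer then produces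
the weights to the power `θ` (`Resampling.lintegral_prod_le_tsum`). The joint law of the layers in
several cells is bounded by the geometric mean of the marginal laws in general, whence the exponents
`1 / 3` and `1 / 2`, and by their product if each layer depends on its own cell only, whence the
exponent `1` (`measure_layer₃_le`, `measure_layer₃_le_of_isLocal`). The Kolmogorov distance requires
in addition third moments weighted by the normalized variable itself: in general they are bounded by
the Cauchy–Schwarz inequality (`mixedMoment_le`), and for local layers one uses that the layer of a
cell is independent of the field in which this cell is resampled (`mixedMoment_le_of_isLocal`).

The layers are deduced from the action radii: the layer takes the value `ℓ` when the radius lies in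
`[ℓ - 1, ℓ)` and the resampling changes the field. These events and the localized derivatives need
not be measurable, since `E` may be uncountable, the space `M` arbitrary and the supremum is over
all sets of cells. The events are therefore replaced by measurable hulls, which in the local case
can be chosen to depend on the cell only (`Multiscale.exists_local_hull`). By stationarity the
layers of the cells `(0, t)` are transported to the other cells
(`Multiscale.IsScale.comp_shiftPair`).
-/

/-! ### The Stein equation on the real line -/

namespace Stein

open Real Filter Topology

lemma integrable_exp_neg_sq_half : Integrable fun x : ℝ => exp (-(x ^ 2 / 2)) := by
  have := integrable_exp_neg_mul_sq (b := 1 / 2) (by norm_num)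
  refine this.congr (Eventually.of_forall fun x => ?_)
  simp only
  congr 1; ring

lemma integrable_mul_exp_neg_sq_half : Integrable fun x : ℝ => x * exp (-(x ^ 2 / 2)) := by
  have := integrable_mul_exp_neg_mul_sq (b := 1 / 2) (by norm_num)
  refine this.congr (Eventually.of_forall fun x => ?_)
  simp only
  congr 2; ring

lemma integrable_growth_mul_exp {h : ℝ → ℝ} (hm : Measurable h) (hb : ∀ x, |h x| ≤ |x| + 1) :
    Integrable fun x : ℝ => h x * exp (-(x ^ 2 / 2)) := by
  refine (integrable_mul_exp_neg_sq_half.norm.add integrable_exp_neg_sq_half).mono'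
    (by fun_prop) (Eventually.of_forall fun x => ?_)
  simp only [norm_mul, norm_eq_abs, Pi.add_apply, abs_exp]
  have := mul_le_mul_of_nonneg_right (hb x) (exp_pos (-(x ^ 2 / 2))).le
  linarith

lemma hasDerivAt_exp_neg_sq_half (x : ℝ) :
    HasDerivAt (fun x : ℝ => exp (-(x ^ 2 / 2))) (-x * exp (-(x ^ 2 / 2))) x := by
  have h1 : HasDerivAt (fun x : ℝ => -(x ^ 2 / 2)) (-x) x := by
    exact (((hasDerivAt_pow 2 x).div_const 2).neg).congr_deriv (by simp)
  convert h1.exp using 1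
  ring

lemma tendsto_exp_neg_sq_half : Tendsto (fun x : ℝ => exp (-(x ^ 2 / 2))) atTop (𝓝 0) := by
  refine tendsto_exp_neg_atTop_nhds_zero.comp ?_
  exact (tendsto_pow_atTop (by norm_num)).atTop_div_const (by norm_num)

lemma tendsto_mul_exp_neg_sq_half : Tendsto (fun x : ℝ => x * exp (-(x ^ 2 / 2))) atTop (𝓝 0) := by
  have h := (tendsto_pow_mul_exp_neg_atTop_nhds_zero 1)
  refine squeeze_zero' ?_ ?_ h
  · filter_upwards [eventually_ge_atTop 0] with x hx using by positivity
  · filter_upwards [eventually_ge_atTop 2] with x hx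
    rw [pow_one]
    gcongr
    nlinarith

/-- First moment of the Gaussian tail. -/
lemma integral_Ioi_mul_exp (w : ℝ) :
    ∫ x in Set.Ioi w, x * exp (-(x ^ 2 / 2)) = exp (-(w ^ 2 / 2)) := by
  have := integral_Ioi_of_hasDerivAt_of_tendsto' (a := w) (m := 0)
    (f := fun x => -exp (-(x ^ 2 / 2))) (f' := fun x => x * exp (-(x ^ 2 / 2)))
    (fun x _ => (hasDerivAt_exp_neg_sq_half x).neg.congr_deriv (by ring))
    integrable_mul_exp_neg_sq_half.integrableOn
    (by simpa using tendsto_exp_neg_sq_half.neg)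
  simpa using this

/-- A form of the upper bound `1 - w M(w) ≤ 1 / (1 + w ^ 2)`, with `M` the Mills ratio. -/
lemma one_add_sq_mul_integral_le {w : ℝ} (hw : 0 ≤ w) :
    (1 + w ^ 2) * ∫ x in Set.Ioi w, (x - w) * exp (-(x ^ 2 / 2)) ≤ exp (-(w ^ 2 / 2)) := by
  have hd : ∀ x ∈ Set.Ici w, HasDerivAt (fun x => -(w * (x - w) + 1) * exp (-(x ^ 2 / 2)))
      (((x - w) + w * x * (x - w)) * exp (-(x ^ 2 / 2))) x := by
    intro x _
    have h1 : HasDerivAt (fun x => -(w * (x - w) + 1)) (-w) x := by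
      exact ((((hasDerivAt_id x).sub_const w).const_mul w).add_const 1).neg.congr_deriv (by ring)
    exact (h1.mul (hasDerivAt_exp_neg_sq_half x)).congr_deriv (by ring)
  have hpos : ∀ x ∈ Set.Ioi w, 0 ≤ ((x - w) + w * x * (x - w)) * exp (-(x ^ 2 / 2)) := by
    intro x hx
    have hx : w < x := hx
    have : 0 ≤ x - w := by linarith
    have : 0 ≤ x := by linarith
    positivity
  have ht : Tendsto (fun x => -(w * (x - w) + 1) * exp (-(x ^ 2 / 2))) atTop (𝓝 0) := by
    have h1 := tendsto_mul_exp_neg_sq_half.const_mul (-w)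
    have h2 := tendsto_exp_neg_sq_half.const_mul (w ^ 2 - 1)
    have := h1.add h2
    simp only [mul_zero, add_zero] at this
    refine this.congr fun x => ?_
    ring
  have hI := integral_Ioi_of_hasDerivAt_of_nonneg' hd hpos ht
  have hint := integrableOn_Ioi_deriv_of_nonneg' hd hpos ht
  have h2 : ∫ x in Set.Ioi w, (1 + w ^ 2) * ((x - w) * exp (-(x ^ 2 / 2)))
      ≤ ∫ x in Set.Ioi w, ((x - w) + w * x * (x - w)) * exp (-(x ^ 2 / 2)) := by
    refine setIntegral_mono_on ?_ hint measurableSet_Ioi ?_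
    · refine (Integrable.const_mul ?_ _).integrableOn
      have := integrable_mul_exp_neg_sq_half.sub (integrable_exp_neg_sq_half.const_mul w)
      refine this.congr (Eventually.of_forall fun x => ?_)
      simp only [Pi.sub_apply]; ring
    · intro x hx
      have hx : w < x := hx
      rw [← mul_assoc]
      refine mul_le_mul_of_nonneg_right ?_ (exp_pos _).le
      nlinarith [mul_nonneg hw (sq_nonneg (x - w))]
  rw [integral_const_mul, hI] at h2
  simpa using h2

lemma integral_Ioi_exp_le {w : ℝ} (hw : 0 ≤ w) :
    ∫ x in Set.Ioi w, exp (-(x ^ 2 / 2)) ≤ 2 * exp (-(w ^ 2 / 2)) := by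
  -- the integrand is at most `exp (-(w ^ 2 / 2))` on `(w, w + 1]`, and at most
  -- `x * exp (-(x ^ 2 / 2))` beyond `w + 1`, where `x ≥ 1`
  have h1 : ∫ x in Set.Ioi w, exp (-(x ^ 2 / 2))
      ≤ ∫ x in Set.Ioi w, (x * exp (-(x ^ 2 / 2))
        + (Set.Ioc w (w + 1)).indicator (fun _ => exp (-(w ^ 2 / 2))) x) := by
    refine setIntegral_mono_on integrable_exp_neg_sq_half.integrableOn
      (integrable_mul_exp_neg_sq_half.add ?_).integrableOn measurableSet_Ioi ?_
    · exact (integrable_indicator_iff measurableSet_Ioc).2 (by simp)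
    · intro x hx
      have hx : w < x := hx
      have hx0 : 0 < x := by linarith
      by_cases hxw : x ≤ w + 1
      · rw [Set.indicator_of_mem (show x ∈ Set.Ioc w (w + 1) from ⟨hx, hxw⟩)]
        have : exp (-(x ^ 2 / 2)) ≤ exp (-(w ^ 2 / 2)) := by
          gcongr
        have : 0 ≤ x * exp (-(x ^ 2 / 2)) := by positivity
        linarith
      · rw [Set.indicator_of_notMem (fun h => hxw h.2), add_zero]
        have : 1 ≤ x := by linarith
        nlinarith [exp_pos (-(x ^ 2 / 2))]
  refine h1.trans ?_
  rw [integral_add integrable_mul_exp_neg_sq_half.integrableOn, integral_Ioi_mul_exp,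
    integral_indicator measurableSet_Ioc, Measure.restrict_restrict measurableSet_Ioc,
    Set.inter_eq_left.2 Set.Ioc_subset_Ioi_self]
  · simp; linarith
  · exact ((integrable_indicator_iff measurableSet_Ioc).2 (by simp)).integrableOn

/-- The bounded solution of the Stein equation `φ' w - w φ w = h w`, for `h` of mean zero under
the standard Gaussian. -/
noncomputable def sol (h : ℝ → ℝ) (w : ℝ) : ℝ :=
  exp (w ^ 2 / 2) * ∫ x in Set.Iic w, h x * exp (-(x ^ 2 / 2))

/-- The derivative of the Stein solution, as prescribed by the Stein equation. -/
noncomputable def solDeriv (h : ℝ → ℝ) (w : ℝ) : ℝ := w * sol h w + h w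

lemma integral_reflect_eq_zero {h : ℝ → ℝ} (h0 : ∫ x, h x * exp (-(x ^ 2 / 2)) = 0) :
    ∫ x, h (-x) * exp (-(x ^ 2 / 2)) = 0 := by
  have := integral_neg_eq_self (fun x => h x * exp (-(x ^ 2 / 2))) volume
  simpa [h0] using this

section

variable {h : ℝ → ℝ} (hm : Measurable h) (hb : ∀ x, |h x| ≤ |x| + 1)
  (h0 : ∫ x, h x * exp (-(x ^ 2 / 2)) = 0)

include hm hb

lemma hasDerivAt_sol {w : ℝ} (hc : ContinuousAt h w) : HasDerivAt (sol h) (solDeriv h w) w := by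
  have hi := integrable_growth_mul_exp hm hb
  have h1 : HasDerivAt (fun w => exp (w ^ 2 / 2)) (w * exp (w ^ 2 / 2)) w := by
    have h1 : HasDerivAt (fun x : ℝ => x ^ 2 / 2) w w := by
      exact ((hasDerivAt_pow 2 w).div_const 2).congr_deriv (by simp)
    exact h1.exp.congr_deriv (by ring)
  have h2 : HasDerivAt (fun w => ∫ x in Set.Iic w, h x * exp (-(x ^ 2 / 2)))
      (h w * exp (-(w ^ 2 / 2))) w := by
    have h3 : HasDerivAt (fun w => ∫ x in (0 : ℝ)..w, h x * exp (-(x ^ 2 / 2)))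
        (h w * exp (-(w ^ 2 / 2))) w := by
      refine intervalIntegral.integral_hasDerivAt_right hi.intervalIntegrable
        (Measurable.stronglyMeasurable (by fun_prop)).stronglyMeasurableAtFilter ?_
      exact hc.mul (by fun_prop)
    have h4 := h3.add_const (∫ x in Set.Iic 0, h x * exp (-(x ^ 2 / 2)))
    refine h4.congr_of_eventuallyEq (Eventually.of_forall fun v => ?_)
    simp only
    rw [← intervalIntegral.integral_Iic_sub_Iic hi.integrableOn hi.integrableOn]
    ring
  refine (h1.mul h2).congr_deriv ?_
  rw [solDeriv, sol]
  have : exp (w ^ 2 / 2) * exp (-(w ^ 2 / 2)) = 1 := by rw [← exp_add]; simp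
  linear_combination (h w) * this

lemma continuous_sol : Continuous (sol h) := by
  have hi := integrable_growth_mul_exp hm hb
  have : Continuous (fun w => ∫ x in Set.Iic w, h x * exp (-(x ^ 2 / 2))) := by
    have h3 := (intervalIntegral.continuous_primitive
      (fun a b => hi.intervalIntegrable (a := a) (b := b)) 0).add
        (continuous_const (y := ∫ x in Set.Iic 0, h x * exp (-(x ^ 2 / 2))))
    refine h3.congr fun v => ?_
    simp only [Pi.add_apply]
    rw [← intervalIntegral.integral_Iic_sub_Iic hi.integrableOn hi.integrableOn]
    ring
  unfold sol
  fun_prop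

lemma measurable_solDeriv : Measurable (solDeriv h) := by
  have := (continuous_sol hm hb).measurable
  unfold solDeriv
  fun_prop

include h0

lemma sol_eq_Ioi (w : ℝ) :
    sol h w = -(exp (w ^ 2 / 2) * ∫ x in Set.Ioi w, h x * exp (-(x ^ 2 / 2))) := by
  have := integral_add_compl (measurableSet_Iic (a := w)) (integrable_growth_mul_exp hm hb)
  rw [h0, Set.compl_Iic] at this
  rw [sol, ← mul_neg]
  congr 1
  linarith

lemma sol_reflect (w : ℝ) : sol (fun x => h (-x)) w = -sol h (-w) := by
  rw [sol_eq_Ioi hm hb h0, sol, ← integral_comp_neg_Iic (c := w)]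
  simp

lemma solDeriv_reflect (w : ℝ) : solDeriv (fun x => h (-x)) w = solDeriv h (-w) := by
  simp [solDeriv, sol_reflect hm hb h0]

lemma abs_sol_le_of_nonneg {w : ℝ} (hw : 0 ≤ w) : |sol h w| ≤ 3 := by
  rw [sol_eq_Ioi hm hb h0, abs_neg, abs_mul, abs_exp]
  have h1 : |∫ x in Set.Ioi w, h x * exp (-(x ^ 2 / 2))|
      ≤ ∫ x in Set.Ioi w, (x * exp (-(x ^ 2 / 2)) + exp (-(x ^ 2 / 2))) := by
    refine norm_integral_le_of_norm_le (f := fun x => h x * exp (-(x ^ 2 / 2)))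
      (integrable_mul_exp_neg_sq_half.add integrable_exp_neg_sq_half).integrableOn ?_
    refine (ae_restrict_iff' measurableSet_Ioi).2 (Eventually.of_forall fun x hx => ?_)
    have hx : w < x := hx
    have := hb x
    rw [abs_of_nonneg (show 0 ≤ x by linarith)] at this
    rw [norm_mul, norm_eq_abs, norm_eq_abs, abs_exp]
    nlinarith [exp_pos (-(x ^ 2 / 2))]
  rw [integral_add integrable_mul_exp_neg_sq_half.integrableOn
    integrable_exp_neg_sq_half.integrableOn, integral_Ioi_mul_exp] at h1
  have h2 := integral_Ioi_exp_le hw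
  calc exp (w ^ 2 / 2) * _ ≤ exp (w ^ 2 / 2) * (3 * exp (-(w ^ 2 / 2))) := by
        gcongr; linarith
    _ = 3 := by
        rw [mul_left_comm, ← exp_add]; simp

lemma abs_sol_le (w : ℝ) : |sol h w| ≤ 3 := by
  rcases le_total 0 w with hw | hw
  · exact abs_sol_le_of_nonneg hm hb h0 hw
  · have := abs_sol_le_of_nonneg (h := fun x => h (-x)) (by fun_prop)
      (fun x => by simpa using hb (-x))
      (integral_reflect_eq_zero h0)
      (w := -w) (by linarith)
    rw [sol_reflect hm hb h0] at this
    simpa using this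

end

lemma exp_sq_half_mul (w : ℝ) : exp (w ^ 2 / 2) * exp (-(w ^ 2 / 2)) = 1 := by
  rw [← exp_add]; simp

section

variable {h : ℝ → ℝ} (hm : Measurable h) (hb : ∀ x, |h x| ≤ |x| + 1)
  (h0 : ∫ x, h x * exp (-(x ^ 2 / 2)) = 0)

include hm hb h0

/-- If `h` is Lipschitz, the leading terms of `w φ w` and `h w` cancel in `φ' w` for large `w`. -/
lemma one_add_mul_abs_solDeriv_le_of_nonneg (hL : LipschitzWith 1 h) {w : ℝ} (hw : 0 ≤ w) :
    (1 + w) * |solDeriv h w| ≤ 4 := by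
  have i0 := integrable_exp_neg_sq_half.integrableOn (s := Set.Ioi w)
  have i1 := integrable_mul_exp_neg_sq_half.integrableOn (s := Set.Ioi w)
  have ih := (integrable_growth_mul_exp hm hb).integrableOn (s := Set.Ioi w)
  have hJ : ∫ x in Set.Ioi w, (x - w) * exp (-(x ^ 2 / 2))
      = exp (-(w ^ 2 / 2)) - w * ∫ x in Set.Ioi w, exp (-(x ^ 2 / 2)) := by
    simp_rw [sub_mul]
    rw [integral_sub i1 (i0.const_mul w), integral_const_mul, integral_Ioi_mul_exp]
  have hD : ∫ x in Set.Ioi w, (h x - h w) * exp (-(x ^ 2 / 2))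
      = (∫ x in Set.Ioi w, h x * exp (-(x ^ 2 / 2)))
        - h w * ∫ x in Set.Ioi w, exp (-(x ^ 2 / 2)) := by
    simp_rw [sub_mul]
    rw [integral_sub ih (i0.const_mul _), integral_const_mul]
  have hDb : |∫ x in Set.Ioi w, (h x - h w) * exp (-(x ^ 2 / 2))|
      ≤ ∫ x in Set.Ioi w, (x - w) * exp (-(x ^ 2 / 2)) := by
    refine norm_integral_le_of_norm_le (f := fun x => (h x - h w) * exp (-(x ^ 2 / 2))) ?_ ?_
    · simp_rw [sub_mul]
      exact i1.sub (i0.const_mul w)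
    · refine (ae_restrict_iff' measurableSet_Ioi).2 (Eventually.of_forall fun x hx => ?_)
      have hx : w < x := hx
      have := hL.dist_le_mul x w
      rw [NNReal.coe_one, one_mul, dist_eq, dist_eq, abs_of_pos (sub_pos.2 hx)] at this
      rw [norm_mul, norm_eq_abs, norm_eq_abs, abs_exp]
      exact mul_le_mul_of_nonneg_right this (exp_pos _).le
  have hK := one_add_sq_mul_integral_le hw
  set J := ∫ x in Set.Ioi w, (x - w) * exp (-(x ^ 2 / 2)) with hJdef
  set D := ∫ x in Set.Ioi w, (h x - h w) * exp (-(x ^ 2 / 2))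
  have hJ0 : 0 ≤ J := (abs_nonneg _).trans hDb
  have hE := exp_sq_half_mul w
  have key : solDeriv h w = exp (w ^ 2 / 2) * (h w * J - w * D) := by
    rw [solDeriv, sol_eq_Ioi hm hb h0, hJ, hD]
    linear_combination (-(h w)) * hE
  have hhw := hb w
  rw [abs_of_nonneg hw] at hhw
  have h1 : |h w * J - w * D| ≤ (2 * w + 1) * J := by
    calc |h w * J - w * D| ≤ |h w * J| + |w * D| := abs_sub _ _
      _ = |h w| * J + w * |D| := by rw [abs_mul, abs_mul, abs_of_nonneg hJ0, abs_of_nonneg hw]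
      _ ≤ (w + 1) * J + w * J := by gcongr
      _ = _ := by ring
  rw [key, abs_mul, abs_exp]
  calc (1 + w) * (exp (w ^ 2 / 2) * |h w * J - w * D|)
      ≤ (1 + w) * (exp (w ^ 2 / 2) * ((2 * w + 1) * J)) := by gcongr
    _ = exp (w ^ 2 / 2) * (((1 + w) * (2 * w + 1)) * J) := by ring
    _ ≤ exp (w ^ 2 / 2) * ((4 * (1 + w ^ 2)) * J) := by
        refine mul_le_mul_of_nonneg_left (mul_le_mul_of_nonneg_right ?_ hJ0) (exp_pos _).le
        nlinarith [sq_nonneg (w - 1)]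
    _ ≤ exp (w ^ 2 / 2) * (4 * exp (-(w ^ 2 / 2))) := by
        refine mul_le_mul_of_nonneg_left ?_ (exp_pos _).le
        linarith
    _ = 4 := by linear_combination 4 * hE

lemma one_add_abs_mul_abs_solDeriv_le (hL : LipschitzWith 1 h) (w : ℝ) :
    (1 + |w|) * |solDeriv h w| ≤ 4 := by
  rcases le_total 0 w with hw | hw
  · rw [abs_of_nonneg hw]
    exact one_add_mul_abs_solDeriv_le_of_nonneg hm hb h0 hL hw
  · have := one_add_mul_abs_solDeriv_le_of_nonneg (h := fun x => h (-x)) (by fun_prop)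
      (fun x => by simpa using hb (-x)) (integral_reflect_eq_zero h0)
      (by
        refine LipschitzWith.of_dist_le_mul fun x y => ?_
        simpa using hL.dist_le_mul (-x) (-y)) (w := -w) (by linarith)
    rw [solDeriv_reflect hm hb h0, neg_neg] at this
    rwa [abs_of_nonpos hw]

/-- For a bounded `h` the function `w φ w` is bounded, hence so is `φ'`. -/
lemma abs_mul_sol_le (hb1 : ∀ x, |h x| ≤ 1) (w : ℝ) : |w * sol h w| ≤ 1 := by
  have key : ∀ h : ℝ → ℝ, Measurable h → (∀ x, |h x| ≤ |x| + 1) →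
      (∫ x, h x * exp (-(x ^ 2 / 2)) = 0) → (∀ x, |h x| ≤ 1) → ∀ w, 0 ≤ w →
      |w * sol h w| ≤ 1 := by
    intro h hm hb h0 hb1 w hw
    have h1 : |∫ x in Set.Ioi w, h x * exp (-(x ^ 2 / 2))|
        ≤ ∫ x in Set.Ioi w, exp (-(x ^ 2 / 2)) := by
      refine norm_integral_le_of_norm_le (f := fun x => h x * exp (-(x ^ 2 / 2)))
        integrable_exp_neg_sq_half.integrableOn (Eventually.of_forall fun x => ?_)
      rw [norm_mul, norm_eq_abs, norm_eq_abs, abs_exp]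
      nlinarith [exp_pos (-(x ^ 2 / 2)), hb1 x]
    have h2 : w * ∫ x in Set.Ioi w, exp (-(x ^ 2 / 2)) ≤ exp (-(w ^ 2 / 2)) := by
      rw [← integral_Ioi_mul_exp, ← integral_const_mul]
      refine setIntegral_mono_on (integrable_exp_neg_sq_half.const_mul w).integrableOn
        integrable_mul_exp_neg_sq_half.integrableOn measurableSet_Ioi fun x hx => ?_
      have hx : w < x := hx
      gcongr
    rw [sol_eq_Ioi hm hb h0, abs_mul, abs_neg, abs_mul, abs_exp, abs_of_nonneg hw]
    calc w * (exp (w ^ 2 / 2) * |∫ x in Set.Ioi w, h x * exp (-(x ^ 2 / 2))|)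
        ≤ w * (exp (w ^ 2 / 2) * ∫ x in Set.Ioi w, exp (-(x ^ 2 / 2))) := by gcongr
      _ = exp (w ^ 2 / 2) * (w * ∫ x in Set.Ioi w, exp (-(x ^ 2 / 2))) := by ring
      _ ≤ exp (w ^ 2 / 2) * exp (-(w ^ 2 / 2)) := by gcongr
      _ = 1 := exp_sq_half_mul w
  rcases le_total 0 w with hw | hw
  · exact key h hm hb h0 hb1 w hw
  · have := key (fun x => h (-x)) (by fun_prop) (fun x => by simpa using hb (-x))
      (integral_reflect_eq_zero h0) (fun x => hb1 (-x)) (-w) (by linarith)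
    rw [sol_reflect hm hb h0, neg_neg] at this
    rwa [neg_mul_neg] at this

end

lemma integral_gaussian_eq (h : ℝ → ℝ) :
    ∫ x, h x ∂(gaussianReal 0 1)
      = (√(2 * π))⁻¹ * ∫ x, h x * exp (-(x ^ 2 / 2)) := by
  rw [integral_gaussianReal_eq_integral_smul (by norm_num), ← integral_const_mul]
  congr 1
  ext x
  simp only [gaussianPDFReal, smul_eq_mul, NNReal.coe_one, sub_zero, mul_one]
  rw [neg_div]
  ring

lemma integral_centered_eq_zero {h : ℝ → ℝ} (hi : Integrable h (gaussianReal 0 1)) :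
    ∫ x, (h x - ∫ y, h y ∂(gaussianReal 0 1)) * exp (-(x ^ 2 / 2)) = 0 := by
  have := integral_gaussian_eq (fun x => h x - ∫ y, h y ∂(gaussianReal 0 1))
  rw [integral_sub hi (integrable_const _), integral_const] at this
  simp only [probReal_univ, smul_eq_mul, one_mul, sub_self] at this
  rcases mul_eq_zero.1 this.symm with h | h
  · have : (0 : ℝ) < (√(2 * π))⁻¹ := by positivity
    linarith
  · exact h

lemma memLp_id_gaussian : MemLp (fun x : ℝ => x) 2 (gaussianReal 0 1) :=
  memLp_id_gaussianReal 2

lemma integral_abs_gaussian_le : ∫ x, |x| ∂(gaussianReal 0 1) ≤ 1 := by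
  have h2 : ∫ x, x ^ 2 ∂(gaussianReal 0 1) = 1 := by
    have := variance_eq_sub memLp_id_gaussian
    simp only [variance_fun_id_gaussianReal, integral_id_gaussianReal] at this
    simpa using this.symm
  calc ∫ x, |x| ∂(gaussianReal 0 1) ≤ ∫ x, (1 / 2 * x ^ 2 + 1 / 2) ∂(gaussianReal 0 1) := by
        refine integral_mono (memLp_id_gaussian.integrable (by norm_num)).norm
          ((memLp_id_gaussian.integrable_sq.const_mul _).add (integrable_const _)) fun x => ?_
        simp only
        nlinarith [sq_nonneg (|x| - 1), sq_abs x]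
    _ = 1 := by
        rw [integral_add (memLp_id_gaussian.integrable_sq.const_mul _) (integrable_const _),
          integral_const_mul, h2]
        norm_num

lemma LipschitzWith.abs_le_add {h : ℝ → ℝ} (hL : LipschitzWith 1 h) (x y : ℝ) :
    |h x - h y| ≤ |x| + |y| := by
  have := hL.dist_le_mul x y
  rw [NNReal.coe_one, one_mul, dist_eq, dist_eq] at this
  exact this.trans (abs_sub _ _)

lemma integrable_of_lipschitz {h : ℝ → ℝ} (hL : LipschitzWith 1 h) {P : Measure ℝ}
    [IsFiniteMeasure P] (hP : Integrable (fun x => x) P) : Integrable h P := by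
  refine (hP.norm.add (integrable_const |h 0|)).mono' hL.continuous.aestronglyMeasurable
    (Eventually.of_forall fun x => ?_)
  have h1 := LipschitzWith.abs_le_add hL x 0
  have h2 := abs_sub_abs_le_abs_sub (h x) (h 0)
  simp only [abs_zero, add_zero] at h1
  simp only [norm_eq_abs, Pi.add_apply]
  linarith

/-- Regularity of the Stein solution for a Lipschitz test function. -/
theorem exists_sol_of_lipschitz {h : ℝ → ℝ} (hL : LipschitzWith 1 h) :
    ∃ φ g : ℝ → ℝ, Measurable φ ∧ Measurable g ∧ (∀ w, |φ w| ≤ 3) ∧ (∀ w, |g w| ≤ 4) ∧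
      (∀ w, g w - w * φ w = h w - ∫ x, h x ∂(gaussianReal 0 1)) ∧
      ∀ w u, |φ w - φ u - g w * (w - u)| ≤ 8 * (w - u) ^ 2 := by
  have hid : Integrable (fun x : ℝ => x) (gaussianReal 0 1) :=
    memLp_id_gaussian.integrable (by norm_num)
  have hi := integrable_of_lipschitz hL hid
  set k : ℝ → ℝ := fun x => h x - ∫ x, h x ∂(gaussianReal 0 1) with hk
  have hkL : LipschitzWith 1 k := by
    refine LipschitzWith.of_dist_le_mul fun x y => ?_
    simpa [hk] using hL.dist_le_mul x y
  have hkm : Measurable k := hkL.continuous.measurable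
  have hkb : ∀ x, |k x| ≤ |x| + 1 := by
    intro x
    have : k x = ∫ y, (h x - h y) ∂(gaussianReal 0 1) := by
      rw [integral_sub (integrable_const _) hi]; simp [hk]
    rw [this]
    calc |∫ y, (h x - h y) ∂(gaussianReal 0 1)|
        ≤ ∫ y, (|x| + |y|) ∂(gaussianReal 0 1) :=
          norm_integral_le_of_norm_le (f := fun y => h x - h y) (g := fun y => |x| + |y|)
            ((integrable_const _).add hid.abs)
              (Eventually.of_forall fun y => LipschitzWith.abs_le_add hL x y)
      _ = |x| + ∫ y, |y| ∂(gaussianReal 0 1) := by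
          rw [integral_add (integrable_const _) hid.abs]; simp
      _ ≤ _ := by gcongr; exact integral_abs_gaussian_le
  have hk0 := integral_centered_eq_zero hi
  have hg := one_add_abs_mul_abs_solDeriv_le hkm hkb hk0 hkL
  have hφ := abs_sol_le hkm hkb hk0
  have hd := fun w => hasDerivAt_sol hkm hkb (w := w) hkL.continuous.continuousAt
  have hg1 : ∀ w, |solDeriv k w| ≤ 4 := fun w => by
    nlinarith [hg w, mul_nonneg (abs_nonneg w) (abs_nonneg (solDeriv k w))]
  have hg2 : ∀ w, |w * solDeriv k w| ≤ 4 := fun w => by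
    rw [abs_mul]
    nlinarith [hg w, abs_nonneg (solDeriv k w)]
  refine ⟨sol k, solDeriv k, (continuous_sol hkm hkb).measurable, measurable_solDeriv hkm hkb,
    hφ, hg1, fun w => by simp [solDeriv, hk], ?_⟩
  have hLip : ∀ v w, |solDeriv k v - solDeriv k w| ≤ 8 * |v - w| := by
    intro v w
    have h1 : ‖v * sol k v - w * sol k w‖ ≤ 7 * ‖v - w‖ := by
      refine Convex.norm_image_sub_le_of_norm_hasDerivWithin_le (f := fun v => v * sol k v)
        (f' := fun v => 1 * sol k v + v * solDeriv k v) (s := Set.univ)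
        (fun x _ => ((hasDerivAt_id x).mul (hd x)).hasDerivWithinAt) (fun x _ => ?_)
        convex_univ (Set.mem_univ w) (Set.mem_univ v)
      rw [one_mul, norm_eq_abs]
      exact (abs_add_le _ _).trans (by linarith [hφ x, hg2 x])
    have h2 := hkL.dist_le_mul v w
    rw [NNReal.coe_one, one_mul, dist_eq, dist_eq] at h2
    rw [norm_eq_abs, norm_eq_abs] at h1
    calc |solDeriv k v - solDeriv k w|
        = |(v * sol k v - w * sol k w) + (k v - k w)| := by
          rw [solDeriv, solDeriv]; congr 1; ring
      _ ≤ _ := (abs_add_le _ _).trans (by linarith)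
  intro w u
  have h1 := Convex.norm_image_sub_le_of_norm_hasDerivWithin_le
    (f := fun v => sol k v - solDeriv k w * v) (f' := fun v => solDeriv k v - solDeriv k w * 1)
    (s := Set.uIcc u w) (C := 8 * |w - u|)
    (fun x _ => ((hd x).sub ((hasDerivAt_id x).const_mul _)).hasDerivWithinAt)
    (fun x hx => by
      rw [mul_one, norm_eq_abs]
      refine (hLip x w).trans ?_
      gcongr 8 * ?_
      rw [abs_sub_comm x w]
      exact Set.abs_sub_right_of_mem_uIcc hx)
    (convex_uIcc u w) Set.left_mem_uIcc Set.right_mem_uIcc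
  rw [norm_eq_abs, norm_eq_abs, mul_assoc, ← pow_two, sq_abs] at h1
  refine le_trans (le_of_eq ?_) h1
  congr 1; ring

/-- Regularity of the Stein solution for the indicator of a half-line. The jump of the indicator
produces the second, monotone term in the Taylor remainder. -/
theorem exists_sol_of_indicator (s : ℝ) :
    ∃ φ g : ℝ → ℝ, Measurable φ ∧ Measurable g ∧ (∀ w, |φ w| ≤ 3) ∧ (∀ w, |g w| ≤ 2) ∧
      (∀ w, g w - w * φ w
        = (Set.Iic s).indicator 1 w - (gaussianReal 0 1).real (Set.Iic s)) ∧
      ∀ w u, |φ w - φ u - g w * (w - u)| ≤ (3 + 2 * |w|) * (w - u) ^ 2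
        + (w - u) * ((Set.Iic s).indicator 1 u - (Set.Iic s).indicator 1 w) := by
  set p := (gaussianReal 0 1).real (Set.Iic s) with hp
  have hp0 : 0 ≤ p := measureReal_nonneg
  have hp1 : p ≤ 1 := measureReal_le_one
  set i : ℝ → ℝ := (Set.Iic s).indicator 1 with hi
  have him : Measurable i := measurable_one.indicator measurableSet_Iic
  have hi0 : ∀ x, 0 ≤ i x := fun x => Set.indicator_nonneg (fun _ _ => zero_le_one) x
  have hi1 : ∀ x, i x ≤ 1 := fun x => Set.indicator_le_self' (fun _ _ => zero_le_one) x
  have hanti : Antitone i := by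
    intro x y hxy
    by_cases hy : y ∈ Set.Iic s
    · have hx : x ∈ Set.Iic s := hxy.trans hy
      simp [hi, hx, hy]
    · simp only [hi, Set.indicator_of_notMem hy]
      exact hi0 x
  have hint : Integrable i (gaussianReal 0 1) :=
    (integrable_const (1 : ℝ)).mono' him.aestronglyMeasurable
      (Eventually.of_forall fun x => by rw [norm_eq_abs, abs_of_nonneg (hi0 x)]; exact hi1 x)
  have hpi : ∫ x, i x ∂(gaussianReal 0 1) = p := integral_indicator_one measurableSet_Iic
  set k : ℝ → ℝ := fun x => i x - p with hk
  have hkm : Measurable k := by fun_prop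
  have hkb1 : ∀ x, |k x| ≤ 1 := fun x => abs_le.2 ⟨by simp only [hk]; linarith [hi0 x],
    by simp only [hk]; linarith [hi1 x]⟩
  have hkb : ∀ x, |k x| ≤ |x| + 1 := fun x => (hkb1 x).trans (by linarith [abs_nonneg x])
  have hk0 : ∫ x, k x * exp (-(x ^ 2 / 2)) = 0 := by
    have := integral_centered_eq_zero hint
    rwa [hpi] at this
  have hφ := abs_sol_le hkm hkb hk0
  have hwφ := abs_mul_sol_le hkm hkb hk0 hkb1
  have hg : ∀ w, |solDeriv k w| ≤ 2 := fun w =>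
    (abs_add_le _ _).trans (by linarith [hwφ w, hkb1 w])
  have hgm := measurable_solDeriv hkm hkb
  have hgint : ∀ a b, IntervalIntegrable (solDeriv k) volume a b := fun a b =>
    (intervalIntegrable_const (c := (2 : ℝ))).mono_fun hgm.aestronglyMeasurable
      (Eventually.of_forall fun x => by simpa using hg x)
  have hFTC : ∀ u w, ∫ v in u..w, solDeriv k v = sol k w - sol k u := by
    intro u w
    -- the solution is differentiable except at the jump `s`
    refine integral_eq_of_hasDerivAt_off_countable (sol k) (solDeriv k)
      (Set.countable_singleton s) (continuous_sol hkm hkb).continuousOn (fun x hx => ?_)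
      (hgint u w)
    refine hasDerivAt_sol hkm hkb ?_
    have hxs : x ≠ s := fun h => hx.2 h
    refine ContinuousAt.sub ?_ continuousAt_const
    rcases lt_or_gt_of_ne hxs with h | h
    · refine (continuousAt_const (y := (1 : ℝ))).congr ?_
      filter_upwards [Iio_mem_nhds h] with y hy
      rw [hi, Set.indicator_of_mem (Set.mem_Iic.2 (Set.mem_Iio.1 hy).le), Pi.one_apply]
    · refine (continuousAt_const (y := (0 : ℝ))).congr ?_
      filter_upwards [Ioi_mem_nhds h] with y hy
      rw [hi, Set.indicator_of_notMem (fun h' => not_le.2 (Set.mem_Ioi.1 hy) (Set.mem_Iic.1 h'))]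
  have hLip : ∀ u w, |sol k w - sol k u| ≤ 2 * |w - u| := by
    intro u w
    rw [← hFTC]
    exact intervalIntegral.norm_integral_le_of_norm_le_const (f := solDeriv k) fun x _ => hg x
  refine ⟨sol k, solDeriv k, (continuous_sol hkm hkb).measurable, hgm, hφ, hg,
    fun w => by simp [solDeriv, hk], fun w u => ?_⟩
  have hcm : Continuous fun v => v * sol k v - w * sol k w := by
    have := continuous_sol hkm hkb
    fun_prop
  -- by the Stein equation, `φ' v - φ' w` splits into the difference of `v φ v`, which is Lipschitz
  -- in `v`, and the difference of the indicator, which is monotone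
  have e1 : sol k w - sol k u - solDeriv k w * (w - u)
      = (∫ v in u..w, (v * sol k v - w * sol k w)) + ∫ v in u..w, (i v - i w) := by
    rw [← hFTC, ← intervalIntegral.integral_add (hcm.intervalIntegrable _ _)]
    · have : ∫ v in u..w, solDeriv k w = solDeriv k w * (w - u) := by
        rw [intervalIntegral.integral_const, smul_eq_mul, mul_comm]
      rw [← this, ← intervalIntegral.integral_sub (hgint u w) intervalIntegrable_const]
      refine intervalIntegral.integral_congr fun v _ => ?_
      simp only [solDeriv, hk]; ring
    · refine IntervalIntegrable.sub ?_ intervalIntegrable_const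
      exact (intervalIntegrable_const (c := (1 : ℝ))).mono_fun him.aestronglyMeasurable
        (Eventually.of_forall fun x => by
          simpa [abs_of_nonneg (hi0 x)] using hi1 x)
  have b1 : |∫ v in u..w, (v * sol k v - w * sol k w)| ≤ (3 + 2 * |w|) * |w - u| * |w - u| := by
    refine intervalIntegral.norm_integral_le_of_norm_le_const
      (f := fun v => v * sol k v - w * sol k w) fun v hv => ?_
    have hvw : |v - w| ≤ |w - u| := by
      rw [abs_sub_comm v w]
      exact Set.abs_sub_right_of_mem_uIcc (Set.uIoc_subset_uIcc hv)
    calc ‖v * sol k v - w * sol k w‖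
        = |(v - w) * sol k v + w * (sol k v - sol k w)| := by rw [norm_eq_abs]; congr 1; ring
      _ ≤ |v - w| * |sol k v| + |w| * |sol k v - sol k w| := by
          rw [← abs_mul, ← abs_mul]; exact abs_add_le _ _
      _ ≤ |v - w| * 3 + |w| * (2 * |v - w|) := by
          gcongr
          exacts [hφ v, hLip w v]
      _ = (3 + 2 * |w|) * |v - w| := by ring
      _ ≤ _ := by gcongr
  have b2 : |∫ v in u..w, (i v - i w)| ≤ |i u - i w| * |w - u| := by
    refine intervalIntegral.norm_integral_le_of_norm_le_const (f := fun v => i v - i w)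
      fun v hv => ?_
    rw [norm_eq_abs]
    rcases le_total u w with h | h
    · rw [Set.uIoc_of_le h] at hv
      rw [abs_of_nonneg (sub_nonneg.2 (hanti hv.2)), abs_of_nonneg (sub_nonneg.2 (hanti h))]
      linarith [hanti hv.1.le]
    · rw [Set.uIoc_of_ge h] at hv
      rw [abs_of_nonpos (sub_nonpos.2 (hanti hv.1.le)), abs_of_nonpos (sub_nonpos.2 (hanti h))]
      linarith [hanti hv.2]
  have b3 : |i u - i w| * |w - u| = (w - u) * (i u - i w) := by
    rcases le_total u w with h | h
    · rw [abs_of_nonneg (sub_nonneg.2 (hanti h)), abs_of_nonneg (sub_nonneg.2 h)]; ring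
    · rw [abs_of_nonpos (sub_nonpos.2 (hanti h)), abs_of_nonpos (sub_nonpos.2 h)]; ring
  rw [e1]
  refine (abs_add_le _ _).trans ?_
  rw [b3] at b2
  rw [mul_assoc, ← pow_two, sq_abs] at b1
  linarith

end Stein

/-! ### Resampling cells of a field with independent cells -/

namespace Resampling

variable {ι E M : Type*}

open Classical in
/-- The field equal to `y` on the cells indexed by `B` and to `x` on the other cells. -/
noncomputable def mix (c : E → ι) (B : Set ι) (x y : E → M) : E → M :=
  fun e => if c e ∈ B then y e else x e

/-- Exchange of the two fields on the cells indexed by `B`. -/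
noncomputable def swap (c : E → ι) (B : Set ι) (p : (E → M) × (E → M)) : (E → M) × (E → M) :=
  (mix c B p.1 p.2, mix c B p.2 p.1)

lemma mix_of_mem {c : E → ι} {B : Set ι} {x y : E → M} {e : E} (h : c e ∈ B) :
    mix c B x y e = y e := if_pos h

lemma mix_of_notMem {c : E → ι} {B : Set ι} {x y : E → M} {e : E} (h : c e ∉ B) :
    mix c B x y e = x e := if_neg h

@[simp] lemma mix_empty (c : E → ι) (x y : E → M) : mix c ∅ x y = x := by
  ext e; simp [mix]

@[simp] lemma swap_swap (c : E → ι) (B : Set ι) (p : (E → M) × (E → M)) :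
    swap c B (swap c B p) = p := by
  ext e <;> simp only [swap, mix] <;> split_ifs <;> rfl

lemma mix_insert_eq (c : E → ι) {B : Set ι} {j : ι} (hj : j ∉ B) (p : (E → M) × (E → M)) :
    mix c {j} (swap c B p).1 (swap c B p).2 = mix c (insert j B) p.1 p.2 := by
  ext e
  simp only [swap, mix]
  by_cases h1 : c e = j
  · have : c e ∉ B := h1 ▸ hj
    simp [h1, hj]
  · by_cases h2 : c e ∈ B <;> simp [h1, h2]

lemma mix_pair_swap_eq (c : E → ι) {B : Set ι} {i j : ι} (hi : i ∉ B) (hj : j ∉ B)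
    (p : (E → M) × (E → M)) :
    mix c {i, j} (swap c B p).1 (swap c B p).2 = mix c (insert i (insert j B)) p.1 p.2 := by
  ext e
  simp only [swap, mix]
  by_cases h1 : c e = i
  · have : c e ∉ B := h1 ▸ hi
    simp [h1, hi]
  · by_cases h2 : c e = j
    · have : c e ∉ B := h2 ▸ hj
      simp [h2, hj]
    · by_cases h3 : c e ∈ B <;> simp [h1, h2, h3]

lemma integral_comp_measurePreserving {α β : Type*} [MeasurableSpace α] [MeasurableSpace β]
    {μ : Measure α} {ν : Measure β} {T : α → β} (hT : MeasurePreserving T μ ν) {g : β → ℝ}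
    (hg : AEStronglyMeasurable g ν) : ∫ x, g (T x) ∂μ = ∫ y, g y ∂ν := by
  rw [← hT.map_eq] at hg ⊢
  exact (integral_map hT.measurable.aemeasurable hg).symm

lemma integrable_fun_mul {α : Type*} [MeasurableSpace α] {μ : Measure α} {f g : α → ℝ}
    (hf : MemLp f 2 μ) (hg : MemLp g 2 μ) : Integrable (fun x => f x * g x) μ :=
  hf.integrable_mul hg

section Measure

variable [MeasurableSpace M] {c : E → ι} {B : Set ι} {μ : Measure (E → M)}

@[fun_prop]
lemma measurable_mix : Measurable fun p : (E → M) × (E → M) => mix c B p.1 p.2 := by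
  refine measurable_pi_lambda _ fun e => ?_
  by_cases h : c e ∈ B
  · simp only [mix, h, if_true]; fun_prop
  · simp only [mix, h, if_false]; fun_prop

@[fun_prop]
lemma Measurable.mix {α : Type*} [MeasurableSpace α] {f g : α → E → M} (hf : Measurable f)
    (hg : Measurable g) : Measurable fun a => mix c B (f a) (g a) :=
  measurable_mix.comp (hf.prodMk hg)

@[fun_prop]
lemma measurable_swap : Measurable (swap c B (M := M)) := by
  unfold swap; fun_prop

lemma measurePreserving_prodProdProdComm {α β γ δ : Type*} [MeasurableSpace α]
    [MeasurableSpace β] [MeasurableSpace γ] [MeasurableSpace δ] (μa : Measure α) (μb : Measure β)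
    (μc : Measure γ) (μd : Measure δ) [SFinite μa] [SFinite μb] [SFinite μc] [SFinite μd] :
    MeasurePreserving (fun p : (α × β) × (γ × δ) => ((p.1.1, p.2.1), (p.1.2, p.2.2)))
      ((μa.prod μb).prod (μc.prod μd)) ((μa.prod μc).prod (μb.prod μd)) := by
  have h1 := measurePreserving_prodAssoc μa μb (μc.prod μd)
  have h2 := (MeasurePreserving.id μa).prod (measurePreserving_prodAssoc μb μc μd).symm
  have h3 := (MeasurePreserving.id μa).prod
    ((Measure.measurePreserving_swap (μ := μb) (ν := μc)).prod (MeasurePreserving.id μd))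
  have h4 := (MeasurePreserving.id μa).prod (measurePreserving_prodAssoc μc μb μd)
  have h5 := (measurePreserving_prodAssoc μa μc (μb.prod μd)).symm
  exact h5.comp (h4.comp (h3.comp (h2.comp h1)))

lemma indepFun_restrict [IsProbabilityMeasure μ]
    (hind : iIndepFun (fun (z : ι) (x : E → M) => (c ⁻¹' {z}).domRestrict x) μ) (B : Set ι) :
    IndepFun (fun x : E → M => (c ⁻¹' B).domRestrict x)
      (fun x : E → M => (c ⁻¹' B)ᶜ.domRestrict x) μ := by
  have h := indep_iSup_of_disjoint (fun z => (Set.measurable_restrict _).comap_le)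
    ((iIndepFun_iff_iIndep _ _ _).1 hind) (disjoint_compl_right (a := B))
  have key : ∀ S : Set ι, MeasurableSpace.comap (fun x : E → M => (c ⁻¹' S).domRestrict x)
      MeasurableSpace.pi ≤ ⨆ z ∈ S, MeasurableSpace.comap
        (fun x : E → M => (c ⁻¹' {z}).domRestrict x) MeasurableSpace.pi := by
    intro S
    rw [MeasurableSpace.pi, MeasurableSpace.comap_iSup]
    refine iSup_le fun e => ?_
    refine le_trans ?_ (le_iSup₂_of_le (c e) e.2 le_rfl)
    rw [MeasurableSpace.comap_comp]
    rw [MeasurableSpace.pi, MeasurableSpace.comap_iSup]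
    refine le_trans ?_ (le_iSup _ ⟨(e : E), rfl⟩)
    rw [MeasurableSpace.comap_comp]
    exact le_rfl
  rw [IndepFun_iff_Indep]
  exact indep_of_indep_of_le_left (indep_of_indep_of_le_right h (key Bᶜ)) (key B)

/-- Exchanging a field and its independent copy on some of the cells preserves their joint law. -/
theorem measurePreserving_swap [IsProbabilityMeasure μ]
    (hind : iIndepFun (fun (z : ι) (x : E → M) => (c ⁻¹' {z}).domRestrict x) μ) (B : Set ι) :
    MeasurePreserving (swap c B) (μ.prod μ) (μ.prod μ) := by
  classical
  set S : Set E := c ⁻¹' B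
  set r : (E → M) → (S → M) × ((Sᶜ : Set E) → M) := fun x => (S.domRestrict x, Sᶜ.domRestrict x)
    with hr
  have hrm : Measurable r :=
    (Set.measurable_restrict S).prodMk (Set.measurable_restrict Sᶜ)
  set g : (S → M) × ((Sᶜ : Set E) → M) → (E → M) :=
    fun q e => if h : e ∈ S then q.1 ⟨e, h⟩ else q.2 ⟨e, h⟩ with hg
  have hgm : Measurable g := by
    refine measurable_pi_lambda _ fun e => ?_
    by_cases h : e ∈ S
    · simp only [hg, h, dif_pos]; fun_prop
    · simp only [hg, h, dif_neg, not_false_eq_true]; fun_prop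
  have hgr : ∀ x, g (r x) = x := by
    intro x; ext e
    by_cases h : e ∈ S <;> simp [hg, hr, h]
  have hmap := (indepFun_iff_map_prod_eq_prod_map_map
    (Set.measurable_restrict S).aemeasurable (Set.measurable_restrict Sᶜ).aemeasurable).1
    (indepFun_restrict hind B)
  set μ₁ := μ.map (fun x : E → M => S.domRestrict x)
  set μ₂ := μ.map (fun x : E → M => Sᶜ.domRestrict x)
  have : IsProbabilityMeasure μ₁ :=
    Measure.isProbabilityMeasure_map (Set.measurable_restrict S).aemeasurable
  have : IsProbabilityMeasure μ₂ :=
    Measure.isProbabilityMeasure_map (Set.measurable_restrict Sᶜ).aemeasurable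
  have mr : MeasurePreserving r μ (μ₁.prod μ₂) := ⟨hrm, hmap⟩
  have mg : MeasurePreserving g (μ₁.prod μ₂) μ := by
    refine ⟨hgm, ?_⟩
    rw [← mr.map_eq, Measure.map_map hgm hrm]
    have : g ∘ r = id := funext hgr
    rw [this, Measure.map_id]
  have h1 := measurePreserving_prodProdProdComm μ₁ μ₂ μ₁ μ₂
  have h2 := (Measure.measurePreserving_swap (μ := μ₁) (ν := μ₁)).prod
    (MeasurePreserving.id (μ₂.prod μ₂))
  have h3 := measurePreserving_prodProdProdComm μ₁ μ₁ μ₂ μ₂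
  have h := (mg.prod mg).comp (h3.comp (h2.comp (h1.comp (mr.prod mr))))
  convert h using 1
  ext p e
  · by_cases h : c e ∈ B
    · have h' : e ∈ S := h
      simp [hg, hr, swap, mix, h, h']
    · have h' : e ∉ S := h
      simp [hg, hr, swap, mix, h, h']
  · by_cases h : c e ∈ B
    · have h' : e ∈ S := h
      simp [hg, hr, swap, mix, h, h']
    · have h' : e ∉ S := h
      simp [hg, hr, swap, mix, h, h']

/-- The law of the field and of its independent copy is invariant under exchange of cells. -/
def Exchangeable (c : E → ι) (μ : Measure (E → M)) : Prop :=
  ∀ B, MeasurePreserving (swap c B) (μ.prod μ) (μ.prod μ)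

lemma Exchangeable.measurePreserving_mix [IsProbabilityMeasure μ] (hex : Exchangeable c μ)
    (B : Set ι) :
    MeasurePreserving (fun p : (E → M) × (E → M) => mix c B p.1 p.2) (μ.prod μ) μ :=
  measurePreserving_fst.comp (hex B)

end Measure

/-! ### Discrete differences and telescoping -/

/-- The difference of `F` between a field and the field resampled in one cell. -/
noncomputable def diff (c : E → ι) (F : (E → M) → ℝ) (j : ι) (p : (E → M) × (E → M)) : ℝ :=
  F p.1 - F (mix c {j} p.1 p.2)

/-- The second difference of `F` upon resampling two cells. -/
noncomputable def diff₂ (c : E → ι) (F : (E → M) → ℝ) (i j : ι) (p : (E → M) × (E → M)) : ℝ :=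
  F p.1 - F (mix c {i} p.1 p.2) - F (mix c {j} p.1 p.2) + F (mix c {i, j} p.1 p.2)

lemma mix_swap_singleton (c : E → ι) (j : ι) (p : (E → M) × (E → M)) :
    mix c {j} (swap c {j} p).1 (swap c {j} p).2 = p.1 := by
  ext e; simp only [swap, mix]; split_ifs <;> rfl

lemma diff_swap_self (c : E → ι) (F : (E → M) → ℝ) (j : ι) (p : (E → M) × (E → M)) :
    diff c F j (swap c {j} p) = -diff c F j p := by
  rw [diff, mix_swap_singleton, diff]
  simp only [swap]; ring

lemma swap_comm (c : E → ι) (B B' : Set ι) (p : (E → M) × (E → M)) :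
    swap c B (swap c B' p) = swap c B' (swap c B p) := by
  ext e <;> simp only [swap, mix] <;> split_ifs <;> rfl

lemma diff_swap_swap_self (c : E → ι) (F : (E → M) → ℝ) (B : Set ι) (j : ι)
    (p : (E → M) × (E → M)) :
    diff c F j (swap c B (swap c {j} p)) = -diff c F j (swap c B p) := by
  rw [swap_comm, diff_swap_self]

lemma diff_swap_of_notMem (c : E → ι) (F : (E → M) → ℝ) {B : Set ι} {j : ι} (hj : j ∉ B)
    (p : (E → M) × (E → M)) :
    diff c F j (swap c B p) = F (mix c B p.1 p.2) - F (mix c (insert j B) p.1 p.2) := by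
  rw [diff, mix_insert_eq c hj, swap]

/-- Resampling the cells one after the other. -/
lemma sub_mix_eq_sum (c : E → ℕ) (F : (E → M) → ℝ) (n : ℕ) (p : (E → M) × (E → M)) :
    F p.1 - F (mix c (Set.Iio n) p.1 p.2)
      = ∑ j ∈ Finset.range n, diff c F j (swap c (Set.Iio j) p) := by
  induction n with
  | zero => simp
  | succ n ih =>
    rw [Finset.sum_range_succ, ← ih, diff_swap_of_notMem c F (by simp)]
    have : insert n (Set.Iio n) = Set.Iio (n + 1) := by
      ext k; simp
    rw [this]; ring

section Measure

variable [MeasurableSpace M] {c : E → ι} {μ : Measure (E → M)}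

/-- Since the exchange is an involution, `f` need not be measurable. -/
lemma Exchangeable.integral_swap (hex : Exchangeable c μ) (B : Set ι)
    (f : (E → M) × (E → M) → ℝ) :
    ∫ p, f (swap c B p) ∂(μ.prod μ) = ∫ p, f p ∂(μ.prod μ) := by
  have hinv : Function.Involutive (swap c B (M := M)) := swap_swap c B
  let e : (E → M) × (E → M) ≃ᵐ (E → M) × (E → M) :=
    { toEquiv := hinv.toPerm, measurable_toFun := measurable_swap,
      measurable_invFun := measurable_swap }
  have : MeasurePreserving e (μ.prod μ) (μ.prod μ) := hex B
  exact this.integral_comp e.measurableEmbedding f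

/-- Since the exchange is an involution, `f` need not be measurable; this applies in particular to
the localized derivatives, which need not be measurable. -/
lemma Exchangeable.lintegral_swap (hex : Exchangeable c μ) (B : Set ι)
    (f : (E → M) × (E → M) → ℝ≥0∞) :
    ∫⁻ p, f (swap c B p) ∂(μ.prod μ) = ∫⁻ p, f p ∂(μ.prod μ) := by
  have hinv : Function.Involutive (swap c B (M := M)) := swap_swap c B
  let e : (E → M) × (E → M) ≃ᵐ (E → M) × (E → M) :=
    { toEquiv := hinv.toPerm, measurable_toFun := measurable_swap,
      measurable_invFun := measurable_swap }
  have : MeasurePreserving e (μ.prod μ) (μ.prod μ) := hex B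
  exact this.lintegral_comp_emb e.measurableEmbedding f

/-- Symmetrization of an integral against a function that is odd under the exchange of a cell. -/
lemma Exchangeable.integral_mul_odd (hex : Exchangeable c μ) {F : (E → M) → ℝ} {j : ι}
    {a : (E → M) × (E → M) → ℝ} (ha : ∀ p, a (swap c {j} p) = -a p)
    (hi : Integrable (fun p => F p.1 * a p) (μ.prod μ)) :
    ∫ p, F p.1 * a p ∂(μ.prod μ) = 1 / 2 * ∫ p, diff c F j p * a p ∂(μ.prod μ) := by
  have h1 := hex.integral_swap {j} (fun p => F p.1 * a p)
  have h2 : Integrable (fun p => F (mix c {j} p.1 p.2) * a p) (μ.prod μ) := by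
    have := (hex {j}).integrable_comp_of_integrable hi
    refine this.neg.congr (Filter.Eventually.of_forall fun p => ?_)
    simp only [Function.comp_apply, Pi.neg_apply, ha]; simp [swap]
  have h3 : ∫ p, F (mix c {j} p.1 p.2) * a p ∂(μ.prod μ)
      = -∫ p, F p.1 * a p ∂(μ.prod μ) := by
    rw [← h1, ← integral_neg]
    refine integral_congr_ae (Filter.Eventually.of_forall fun p => ?_)
    simp only [ha]; simp [swap]
  simp only [diff, sub_mul]
  rw [integral_sub hi h2, h3]
  ring

variable [IsProbabilityMeasure μ]

@[fun_prop]
lemma measurable_diff {F : (E → M) → ℝ} (hF : Measurable F) (j : ι) : Measurable (diff c F j) := by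
  unfold diff; fun_prop

@[fun_prop]
lemma measurable_diff₂ {F : (E → M) → ℝ} (hF : Measurable F) (i j : ι) :
    Measurable (diff₂ c F i j) := by
  unfold diff₂; fun_prop

lemma memLp_fst {F : (E → M) → ℝ} {q : ℝ≥0∞} (h : MemLp F q μ) :
    MemLp (fun p : (E → M) × (E → M) => F p.1) q (μ.prod μ) :=
  h.comp_measurePreserving measurePreserving_fst

lemma Exchangeable.memLp_mix (hex : Exchangeable c μ) {F : (E → M) → ℝ} {q : ℝ≥0∞}
    (h : MemLp F q μ) (B : Set ι) :
    MemLp (fun p : (E → M) × (E → M) => F (mix c B p.1 p.2)) q (μ.prod μ) :=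
  h.comp_measurePreserving (hex.measurePreserving_mix B)

lemma Exchangeable.memLp_diff (hex : Exchangeable c μ) {F : (E → M) → ℝ} {q : ℝ≥0∞}
    (h : MemLp F q μ) (j : ι) : MemLp (diff c F j) q (μ.prod μ) :=
  (memLp_fst h).sub (hex.memLp_mix h {j})

lemma Exchangeable.memLp_diff_swap (hex : Exchangeable c μ) {F : (E → M) → ℝ} {q : ℝ≥0∞}
    (h : MemLp F q μ) (j : ι) (B : Set ι) :
    MemLp (fun p => diff c F j (swap c B p)) q (μ.prod μ) :=
  (hex.memLp_diff h j).comp_measurePreserving (hex B)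

/-- The covariance identity obtained by resampling the cells one after the other. -/
theorem integral_mul_sub_mix {c : E → ℕ} (hex : Exchangeable c μ) {F G : (E → M) → ℝ}
    (hF : MemLp F 2 μ) (hG : MemLp G 2 μ) (n : ℕ) :
    ∫ p, F p.1 * (G p.1 - G (mix c (Set.Iio n) p.1 p.2)) ∂(μ.prod μ)
      = 1 / 2 * ∑ j ∈ Finset.range n,
          ∫ p, diff c F j p * diff c G j (swap c (Set.Iio j) p) ∂(μ.prod μ) := by
  simp_rw [sub_mix_eq_sum, Finset.mul_sum]
  rw [integral_finsetSum]
  · refine Finset.sum_congr rfl fun j _ => ?_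
    exact hex.integral_mul_odd (fun p => diff_swap_swap_self c G _ j p)
      (integrable_fun_mul (memLp_fst hF) (hex.memLp_diff_swap hG j _))
  · intro j _
    exact (memLp_fst hF).integrable_mul (hex.memLp_diff_swap hG j _)

end Measure

end Resampling

/-! ### Triviality of the tail and the Efron–Stein inequality -/

namespace Resampling

open Filter Topology

variable {E M : Type*} [MeasurableSpace M] {c : E → ℕ} {μ : Measure (E → M)}

/-- The σ-algebra generated by the cells of index less than `n`. -/
def cellFiltration (c : E → ℕ) : Filtration ℕ (inferInstance : MeasurableSpace (E → M)) where
  seq n := MeasurableSpace.comap (fun x : E → M => (c ⁻¹' Set.Iio n).domRestrict x) inferInstance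
  mono' := by
    intro m n hmn
    have h : c ⁻¹' Set.Iio m ⊆ c ⁻¹' Set.Iio n := fun e he => lt_of_lt_of_le he hmn
    have : (fun x : E → M => (c ⁻¹' Set.Iio m).domRestrict x)
        = Set.domRestrict₂ (π := fun _ => M) h
          ∘ (fun x : E → M => (c ⁻¹' Set.Iio n).domRestrict x) := rfl
    simp only
    rw [this, ← MeasurableSpace.comap_comp]
    exact MeasurableSpace.comap_mono (Set.measurable_restrict₂ h).comap_le
  le' n := (Set.measurable_restrict _).comap_le

lemma iSup_cellFiltration (c : E → ℕ) :
    ⨆ n, cellFiltration (M := M) c n = (inferInstance : MeasurableSpace (E → M)) := by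
  refine le_antisymm (iSup_le fun n => (cellFiltration c).le n) ?_
  change (⨆ e, MeasurableSpace.comap (fun x : E → M => x e) _) ≤ _
  refine iSup_le fun e => ?_
  refine le_trans ?_ (le_iSup _ (c e + 1))
  change _ ≤ MeasurableSpace.comap _ (⨆ e, MeasurableSpace.comap _ _)
  rw [MeasurableSpace.comap_iSup]
  refine le_trans ?_ (le_iSup _ ⟨e, Nat.lt_succ_self (c e)⟩)
  rw [MeasurableSpace.comap_comp]
  exact le_rfl

lemma eq_of_measurable_cellFiltration {n : ℕ} {g : (E → M) → ℝ}
    (hg : StronglyMeasurable[cellFiltration (M := M) c n] g) {x y : E → M}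
    (h : ∀ e, c e < n → x e = y e) : g x = g y := by
  refine hg.factorsThrough (f := fun x : E → M => (c ⁻¹' Set.Iio n).domRestrict x) ?_
  ext e
  exact h e e.2

variable [IsProbabilityMeasure μ]

/-- Asymptotic independence of a field and the field with its first `n` cells resampled. -/
theorem Exchangeable.tendsto_integral_mul_mix (hex : Exchangeable c μ) {f g : (E → M) → ℝ}
    (hf : Measurable f) {K : ℝ} (hK : ∀ x, |f x| ≤ K) (hg : Integrable g μ) :
    Tendsto (fun n => ∫ p, f p.1 * g (mix c (Set.Iio n) p.1 p.2) ∂(μ.prod μ)) atTop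
      (𝓝 ((∫ x, f x ∂μ) * ∫ x, g x ∂μ)) := by
  set G : ℕ → (E → M) → ℝ := fun n => μ[g | cellFiltration c n] with hG
  have hGi : ∀ n, Integrable (G n) μ := fun n => integrable_condExp
  have hlim : Tendsto (fun n => eLpNorm (G n - g) 1 μ) atTop (𝓝 0) := by
    have := tendsto_eLpNorm_condExp (μ := μ) (ℱ := cellFiltration (M := M) c) g
    refine this.congr fun n => eLpNorm_congr_ae ?_
    have h2 : μ[g | ⨆ n, cellFiltration (M := M) c n] =ᵐ[μ] g := by
      rw [iSup_cellFiltration]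
      exact condExp_of_aestronglyMeasurable' le_rfl hg.1 hg
    filter_upwards [h2] with x hx
    simp [hG, hx]
  have hlim' : Tendsto (fun n => K * ∫ x, |G n x - g x| ∂μ) atTop (𝓝 (K * 0)) := by
    refine Tendsto.const_mul K ?_
    have h3 := (ENNReal.tendsto_toReal ENNReal.zero_ne_top).comp hlim
    refine h3.congr fun n => ?_
    simp only [Function.comp_apply]
    rw [eLpNorm_one_eq_lintegral_enorm, ← integral_norm_eq_lintegral_enorm
      ((hGi n).sub hg).aestronglyMeasurable]
    rfl
  rw [mul_zero] at hlim'
  have hfi : Integrable f μ := (integrable_const K).mono' hf.aestronglyMeasurable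
    (Eventually.of_forall hK)
  rw [tendsto_iff_norm_sub_tendsto_zero]
  refine squeeze_zero (fun _ => norm_nonneg _) (fun n => ?_) hlim'
  -- the conditional expectation given the first `n` cells only sees the copy
  have e1 : ∀ p : (E → M) × (E → M), G n (mix c (Set.Iio n) p.1 p.2) = G n p.2 := fun p =>
    eq_of_measurable_cellFiltration stronglyMeasurable_condExp
      fun e he => mix_of_mem (Set.mem_Iio.2 he)
  have i1 : ∀ F : (E → M) → ℝ, Integrable F μ →
      Integrable (fun p : (E → M) × (E → M) => f p.1 * F (mix c (Set.Iio n) p.1 p.2))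
        (μ.prod μ) := by
    intro F hF
    refine ((hex.measurePreserving_mix _).integrable_comp_of_integrable hF).bdd_mul (c := K)
      (hf.comp measurable_fst).aestronglyMeasurable (Eventually.of_forall fun p => hK p.1)
  have e2 : ∫ p, f p.1 * G n (mix c (Set.Iio n) p.1 p.2) ∂(μ.prod μ)
      = (∫ x, f x ∂μ) * ∫ x, g x ∂μ := by
    simp_rw [e1]
    rw [integral_prod_mul, integral_condExp ((cellFiltration c).le n)]
  rw [← e2, ← integral_sub (i1 g hg) (i1 _ (hGi n))]
  have e3 : ∫ x, |G n x - g x| ∂μ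
      = ∫ p, |G n (mix c (Set.Iio n) p.1 p.2) - g (mix c (Set.Iio n) p.1 p.2)| ∂(μ.prod μ) := by
    exact (integral_comp_measurePreserving (hex.measurePreserving_mix (Set.Iio n))
      ((hGi n).sub hg).abs.aestronglyMeasurable).symm
  rw [e3, ← integral_const_mul]
  refine norm_integral_le_of_norm_le ?_ (Eventually.of_forall fun p => ?_)
  · exact ((hex.measurePreserving_mix _).integrable_comp_of_integrable
      ((hGi n).sub hg).abs).const_mul K
  · rw [← mul_sub, norm_mul, Real.norm_eq_abs, Real.norm_eq_abs, abs_sub_comm (g _)]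
    exact mul_le_mul_of_nonneg_right (hK p.1) (abs_nonneg _)

/-- Truncation of a real number at level `K`. -/
def clamp (K x : ℝ) : ℝ := max (-K) (min K x)

@[fun_prop]
lemma continuous_clamp (K : ℝ) : Continuous (clamp K) := by
  unfold clamp; fun_prop

@[fun_prop]
lemma measurable_clamp (K : ℝ) : Measurable (clamp K) := (continuous_clamp K).measurable

lemma abs_clamp_le {K : ℝ} (hK : 0 ≤ K) (x : ℝ) : |clamp K x| ≤ K := by
  unfold clamp
  rw [abs_le]
  exact ⟨le_max_left _ _, max_le (by linarith) (min_le_left _ _)⟩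

lemma abs_clamp_sub_le (K x y : ℝ) : |clamp K x - clamp K y| ≤ |x - y| := by
  unfold clamp
  calc _ ≤ |min K x - min K y| := by
        simpa using abs_max_sub_max_le_max (-K) (min K x) (-K) (min K y)
    _ ≤ _ := by simpa using abs_min_sub_min_le_max K x K y

lemma clamp_of_abs_le {K x : ℝ} (h : |x| ≤ K) : clamp K x = x := by
  rw [abs_le] at h
  unfold clamp
  rw [min_eq_right h.2, max_eq_right h.1]

lemma abs_clamp_le_abs {K : ℝ} (hK : 0 ≤ K) (x : ℝ) : |clamp K x| ≤ |x| := by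
  have h := abs_clamp_sub_le K x 0
  rwa [clamp_of_abs_le (x := 0) (by simpa using hK), sub_zero, sub_zero] at h

lemma tendsto_clamp (x : ℝ) : Tendsto (fun n : ℕ => clamp n x) atTop (𝓝 x) := by
  refine tendsto_const_nhds.congr' ?_
  filter_upwards [eventually_ge_atTop ⌈|x|⌉₊] with n hn
  exact (clamp_of_abs_le ((Nat.le_ceil _).trans (by exact_mod_cast hn))).symm

/-- The case `f = g` for a square-integrable function, by truncation of one of the two factors. -/
lemma Exchangeable.tendsto_integral_mul_mix_self (hex : Exchangeable c μ) {W : (E → M) → ℝ}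
    (hW : Measurable W) (hW2 : MemLp W 2 μ) (hW0 : ∫ x, W x ∂μ = 0) :
    Tendsto (fun n => ∫ p, W p.1 * W (mix c (Set.Iio n) p.1 p.2) ∂(μ.prod μ)) atTop (𝓝 0) := by
  have hWi : Integrable W μ := hW2.integrable (by norm_num)
  set S := ∫ x, W x ^ 2 ∂μ with hS
  have hS0 : 0 ≤ S := integral_nonneg fun x => sq_nonneg _
  have htr : Tendsto (fun K : ℕ => ∫ x, (W x - clamp K (W x)) ^ 2 ∂μ) atTop (𝓝 0) := by
    have : Tendsto (fun K : ℕ => ∫ x, (W x - clamp K (W x)) ^ 2 ∂μ) atTop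
        (𝓝 (∫ x, (0 : ℝ) ∂μ)) := by
      refine tendsto_integral_of_dominated_convergence (fun x => 4 * W x ^ 2)
        (fun K => Measurable.aestronglyMeasurable (by fun_prop)) (hW2.integrable_sq.const_mul 4)
        (fun K => Eventually.of_forall fun x => ?_) (Eventually.of_forall fun x => ?_)
      · rw [Real.norm_eq_abs, abs_of_nonneg (sq_nonneg _)]
        have h1 : |W x - clamp K (W x)| ≤ 2 * |W x| :=
          (abs_sub _ _).trans (by linarith [abs_clamp_le_abs (Nat.cast_nonneg K) (W x)])
        have := pow_le_pow_left₀ (abs_nonneg _) h1 2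
        rw [mul_pow, sq_abs, sq_abs] at this
        linarith
      · have := ((tendsto_const_nhds (x := W x)).sub (tendsto_clamp (W x))).pow 2
        simpa using this
    simpa using this
  rw [Metric.tendsto_atTop]
  intro ε hε
  set δ := ε / (2 * (1 + S)) with hδ
  have hδ0 : 0 < δ := by positivity
  obtain ⟨K, hK⟩ := (htr.eventually (gt_mem_nhds (show 0 < δ ^ 2 by positivity))).exists
  have h1 := hex.tendsto_integral_mul_mix (f := fun x => clamp K (W x)) (g := W) (by fun_prop)
    (fun x => abs_clamp_le (Nat.cast_nonneg K) _) hWi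
  rw [hW0, mul_zero, Metric.tendsto_atTop] at h1
  obtain ⟨N, hN⟩ := h1 (ε / 2) (by positivity)
  refine ⟨N, fun n hn => ?_⟩
  have h2 := hN n hn
  rw [Real.dist_eq, sub_zero] at h2 ⊢
  have hR2 : MemLp (fun x => W x - clamp K (W x)) 2 μ := by
    refine hW2.sub (hW2.mono (by fun_prop) (Eventually.of_forall fun x => ?_))
    exact abs_clamp_le_abs (Nat.cast_nonneg K) _
  have hC2 : MemLp (fun x => clamp K (W x)) 2 μ := by
    refine hW2.mono (by fun_prop) (Eventually.of_forall fun x => ?_)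
    exact abs_clamp_le_abs (Nat.cast_nonneg K) _
  have hm2 := hex.memLp_mix hW2 (Set.Iio n)
  have e1 : ∫ p, W p.1 * W (mix c (Set.Iio n) p.1 p.2) ∂(μ.prod μ)
      = (∫ p, (W p.1 - clamp K (W p.1)) * W (mix c (Set.Iio n) p.1 p.2) ∂(μ.prod μ))
        + ∫ p, clamp K (W p.1) * W (mix c (Set.Iio n) p.1 p.2) ∂(μ.prod μ) := by
    rw [← integral_add (integrable_fun_mul (memLp_fst hR2) hm2)
      (integrable_fun_mul (memLp_fst hC2) hm2)]
    refine integral_congr_ae (Eventually.of_forall fun p => ?_)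
    ring
  have e2 : |∫ p, (W p.1 - clamp K (W p.1)) * W (mix c (Set.Iio n) p.1 p.2) ∂(μ.prod μ)|
      ≤ ∫ p, (1 / (2 * δ) * (W p.1 - clamp K (W p.1)) ^ 2
          + δ / 2 * W (mix c (Set.Iio n) p.1 p.2) ^ 2) ∂(μ.prod μ) := by
    refine norm_integral_le_of_norm_le
      (f := fun p => (W p.1 - clamp K (W p.1)) * W (mix c (Set.Iio n) p.1 p.2))
      (((memLp_fst hR2).integrable_sq.const_mul _).add (hm2.integrable_sq.const_mul _))
      (Eventually.of_forall fun p => ?_)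
    simp only [Pi.add_apply]
    rw [norm_mul, Real.norm_eq_abs, Real.norm_eq_abs]
    generalize W p.1 - clamp K (W p.1) = a
    generalize W (mix c (Set.Iio n) p.1 p.2) = b
    rw [← sq_abs a, ← sq_abs b]
    have : 1 / (2 * δ) * |a| ^ 2 + δ / 2 * |b| ^ 2 - |a| * |b|
        = 1 / (2 * δ) * (|a| - δ * |b|) ^ 2 := by field_simp; ring
    have h0 : 0 ≤ 1 / (2 * δ) * (|a| - δ * |b|) ^ 2 := by positivity
    linarith
  have e3 : ∫ p, (1 / (2 * δ) * (W p.1 - clamp K (W p.1)) ^ 2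
          + δ / 2 * W (mix c (Set.Iio n) p.1 p.2) ^ 2) ∂(μ.prod μ)
      = 1 / (2 * δ) * (∫ x, (W x - clamp K (W x)) ^ 2 ∂μ) + δ / 2 * S := by
    rw [integral_add ((memLp_fst hR2).integrable_sq.const_mul _) (hm2.integrable_sq.const_mul _),
      integral_const_mul, integral_const_mul]
    congr 2
    · exact integral_comp_measurePreserving measurePreserving_fst
        (g := fun x => (W x - clamp K (W x)) ^ 2) (Measurable.aestronglyMeasurable (by fun_prop))
    · exact integral_comp_measurePreserving (hex.measurePreserving_mix (Set.Iio n))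
        (g := fun x => W x ^ 2) (Measurable.aestronglyMeasurable (by fun_prop))
  have e4 : 1 / (2 * δ) * (∫ x, (W x - clamp K (W x)) ^ 2 ∂μ) + δ / 2 * S < ε / 2 := by
    have h5 : 1 / (2 * δ) * (∫ x, (W x - clamp K (W x)) ^ 2 ∂μ) < 1 / (2 * δ) * δ ^ 2 :=
      mul_lt_mul_of_pos_left hK (by positivity)
    have h6 : 1 / (2 * δ) * δ ^ 2 = δ / 2 := by field_simp
    have h7 : δ * (1 + S) = ε / 2 := by rw [hδ]; field_simp
    nlinarith
  rw [e1]
  refine (abs_add_le _ _).trans_lt ?_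
  rw [e3] at e2
  linarith

/-- The Efron–Stein inequality for a bounded function. -/
lemma Exchangeable.integral_sub_sq_le_of_bounded (hex : Exchangeable c μ) {G : (E → M) → ℝ}
    (hG : Measurable G) {K : ℝ} (hK : ∀ x, |G x| ≤ K) :
    ENNReal.ofReal (∫ x, (G x - ∫ y, G y ∂μ) ^ 2 ∂μ)
      ≤ ∑' j, ∫⁻ p, ‖diff c G j p‖ₑ ^ 2 ∂(μ.prod μ) := by
  have hG2 : MemLp G 2 μ := (memLp_top_of_bound hG.aestronglyMeasurable K
    (Eventually.of_forall hK)).mono_exponent le_top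
  have hGi : Integrable G μ := hG2.integrable (by norm_num)
  set m := ∫ y, G y ∂μ with hm
  have hvar : ∫ x, (G x - m) ^ 2 ∂μ = (∫ x, G x ^ 2 ∂μ) - m * m := by
    have h1 : ∀ x, (G x - m) ^ 2 = (G x ^ 2 - 2 * m * G x) + m ^ 2 := fun x => by ring
    have h2 : Integrable (fun x => G x ^ 2 - 2 * m * G x) μ :=
      hG2.integrable_sq.sub (hGi.const_mul _)
    simp_rw [h1]
    rw [integral_add h2 (integrable_const _),
      integral_sub hG2.integrable_sq (hGi.const_mul _), integral_const_mul, integral_const]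
    simp only [probReal_univ, one_smul]; ring
  have hlim : Tendsto (fun n => ∫ p, G p.1 * (G p.1 - G (mix c (Set.Iio n) p.1 p.2)) ∂(μ.prod μ))
      atTop (𝓝 (∫ x, (G x - m) ^ 2 ∂μ)) := by
    rw [hvar]
    refine ((tendsto_const_nhds (x := ∫ x, G x ^ 2 ∂μ)).sub
      (hex.tendsto_integral_mul_mix hG hK hGi)).congr fun n => ?_
    have h1 : ∫ x, G x ^ 2 ∂μ = ∫ p, G p.1 * G p.1 ∂(μ.prod μ) := by
      rw [← integral_comp_measurePreserving (measurePreserving_fst (μ := μ) (ν := μ))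
        (g := fun x => G x ^ 2) (Measurable.aestronglyMeasurable (by fun_prop))]
      simp_rw [pow_two]
    rw [h1, ← integral_sub (integrable_fun_mul (memLp_fst hG2) (memLp_fst hG2))
      (integrable_fun_mul (memLp_fst hG2) (hex.memLp_mix hG2 _))]
    simp_rw [mul_sub]
  refine le_of_tendsto (ENNReal.tendsto_ofReal hlim) (Eventually.of_forall fun n => ?_)
  rw [integral_mul_sub_mix hex hG2 hG2, Finset.mul_sum]
  have hb : ∀ j ∈ Finset.range n,
      1 / 2 * ∫ p, diff c G j p * diff c G j (swap c (Set.Iio j) p) ∂(μ.prod μ)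
        ≤ ∫ p, diff c G j p ^ 2 ∂(μ.prod μ) := by
    intro j _
    have d1 := hex.memLp_diff hG2 j
    have d2 := hex.memLp_diff_swap hG2 j (Set.Iio j)
    have h1 : ∫ p, diff c G j p * diff c G j (swap c (Set.Iio j) p) ∂(μ.prod μ)
        ≤ ∫ p, (1 / 2 * diff c G j p ^ 2 + 1 / 2 * diff c G j (swap c (Set.Iio j) p) ^ 2)
          ∂(μ.prod μ) := by
      refine integral_mono (integrable_fun_mul d1 d2)
        ((d1.integrable_sq.const_mul _).add (d2.integrable_sq.const_mul _)) fun p => ?_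
      simp only
      nlinarith [sq_nonneg (diff c G j p - diff c G j (swap c (Set.Iio j) p))]
    rw [integral_add (d1.integrable_sq.const_mul _) (d2.integrable_sq.const_mul _),
      integral_const_mul, integral_const_mul,
      hex.integral_swap (Set.Iio j) (fun p => diff c G j p ^ 2)] at h1
    have h0 : 0 ≤ ∫ p, diff c G j p ^ 2 ∂(μ.prod μ) := integral_nonneg fun _ => sq_nonneg _
    linarith
  refine (ENNReal.ofReal_le_ofReal (Finset.sum_le_sum hb)).trans ?_
  rw [ENNReal.ofReal_sum_of_nonneg fun j _ => integral_nonneg fun _ => sq_nonneg _]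
  refine le_trans (le_of_eq (Finset.sum_congr rfl fun j _ => ?_))
    (ENNReal.sum_le_tsum (Finset.range n))
  rw [ofReal_integral_eq_lintegral_ofReal (hex.memLp_diff hG2 j).integrable_sq
    (Eventually.of_forall fun _ => sq_nonneg _)]
  refine lintegral_congr fun p => ?_
  rw [Real.enorm_eq_ofReal_abs, ← ENNReal.ofReal_pow (abs_nonneg _), sq_abs]

/-- The Efron–Stein inequality, as a bound on the first absolute centered moment. In this form it
requires integrability only. -/
theorem Exchangeable.sq_lintegral_enorm_sub_le (hex : Exchangeable c μ) {G : (E → M) → ℝ}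
    (hG : Measurable G) (hGi : Integrable G μ) :
    (∫⁻ x, ‖G x - ∫ y, G y ∂μ‖ₑ ∂μ) ^ 2 ≤ ∑' j, ∫⁻ p, ‖diff c G j p‖ₑ ^ 2 ∂(μ.prod μ) := by
  have hdom : ∀ (K : ℕ) (x : E → M), ‖clamp K (G x)‖ ≤ ‖G x‖ := fun K x =>
    abs_clamp_le_abs (Nat.cast_nonneg K) _
  have hci : ∀ K : ℕ, Integrable (fun x => clamp K (G x)) μ := fun K =>
    hGi.mono (by fun_prop) (Eventually.of_forall (hdom K))
  have hm : Tendsto (fun K : ℕ => ∫ x, clamp K (G x) ∂μ) atTop (𝓝 (∫ x, G x ∂μ)) :=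
    tendsto_integral_of_dominated_convergence (fun x => ‖G x‖)
      (fun K => Measurable.aestronglyMeasurable (by fun_prop)) hGi.norm
      (fun K => Eventually.of_forall (hdom K)) (Eventually.of_forall fun x => tendsto_clamp (G x))
  have hlim : Tendsto (fun K : ℕ => ∫⁻ x, ‖clamp K (G x) - ∫ y, clamp K (G y) ∂μ‖ₑ ∂μ) atTop
      (𝓝 (∫⁻ x, ‖G x - ∫ y, G y ∂μ‖ₑ ∂μ)) := by
    refine tendsto_lintegral_of_dominated_convergence
      (fun x => ‖G x‖ₑ + ENNReal.ofReal (∫ x, ‖G x‖ ∂μ)) (fun K => by fun_prop) (fun K => ?_) ?_ ?_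
    · refine Eventually.of_forall fun x => ?_
      refine (enorm_sub_le).trans (add_le_add ?_ ?_)
      · rw [enorm_le_iff_norm_le]; exact hdom K x
      · rw [Real.enorm_eq_ofReal_abs]
        refine ENNReal.ofReal_le_ofReal ?_
        exact (norm_integral_le_integral_norm _).trans
          (integral_mono (hci K).norm hGi.norm (hdom K))
    · rw [lintegral_add_right _ measurable_const]
      exact ENNReal.add_ne_top.2 ⟨hGi.2.ne, by simp⟩
    · refine Eventually.of_forall fun x => ?_
      exact ((tendsto_clamp (G x)).sub hm).enorm
  refine le_of_tendsto ((ENNReal.continuous_pow 2).continuousAt.tendsto.comp hlim)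
    (Eventually.of_forall fun K => ?_)
  have hb := hex.integral_sub_sq_le_of_bounded (G := fun x => clamp K (G x)) (by fun_prop)
    (fun x => abs_clamp_le (Nat.cast_nonneg K) _)
  refine le_trans ?_ (hb.trans (ENNReal.tsum_le_tsum fun j => lintegral_mono fun p => ?_))
  · have hL2 : MemLp (fun x => clamp K (G x) - ∫ y, clamp K (G y) ∂μ) 2 μ :=
      ((memLp_top_of_bound (f := fun x => clamp K (G x)) (by fun_prop) K
        (Eventually.of_forall fun x => abs_clamp_le (Nat.cast_nonneg K) _)).mono_exponent
          le_top).sub (memLp_const _)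
    rw [ofReal_integral_eq_lintegral_ofReal hL2.integrable_sq
      (Eventually.of_forall fun _ => sq_nonneg _)]
    simp only [Function.comp_apply]
    have h := eLpNorm_le_eLpNorm_of_exponent_le (p := 1) (q := 2) (μ := μ) (by norm_num)
      hL2.aestronglyMeasurable
    rw [eLpNorm_one_eq_lintegral_enorm] at h
    refine (pow_le_pow_left' h 2).trans (le_of_eq ?_)
    rw [eLpNorm_eq_lintegral_rpow_enorm_toReal (by norm_num) (by norm_num), ← ENNReal.rpow_natCast,
      ← ENNReal.rpow_mul]
    simp only [ENNReal.toReal_ofNat, Nat.cast_ofNat]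
    rw [show (1 / 2 * 2 : ℝ) = 1 by norm_num, ENNReal.rpow_one]
    refine lintegral_congr fun x => ?_
    rw [Real.enorm_eq_ofReal_abs, ENNReal.rpow_ofNat, ← ENNReal.ofReal_pow (abs_nonneg _), sq_abs]
  · gcongr
    rw [enorm_le_iff_norm_le]
    exact abs_clamp_sub_le K _ _

end Resampling

/-! ### Normal approximation of functions of fields with independent cells -/

namespace Resampling

open Filter Topology

lemma sq_lintegral_le {α : Type*} [MeasurableSpace α] {μ : Measure α} [IsProbabilityMeasure μ]
    {f : α → ℝ≥0∞} (hf : AEMeasurable f μ) : (∫⁻ x, f x ∂μ) ^ 2 ≤ ∫⁻ x, f x ^ 2 ∂μ := by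
  have h := ENNReal.lintegral_mul_le_Lp_mul_Lq μ Real.HolderConjugate.two_two hf
    (aemeasurable_const (b := (1 : ℝ≥0∞)))
  simp only [Pi.mul_apply, mul_one, ENNReal.rpow_ofNat, one_pow, lintegral_const, measure_univ,
    ENNReal.one_rpow] at h
  refine (pow_le_pow_left' h 2).trans (le_of_eq ?_)
  rw [← ENNReal.rpow_natCast, ← ENNReal.rpow_mul]
  norm_num

variable {E M : Type*} [MeasurableSpace M] {c : E → ℕ} {μ : Measure (E → M)}

/-- The approximate Stein coefficient of `W`, as a function of the field and its copy, obtained by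
resampling the first `n` cells one after the other. The function `ψ` is the identity, or the
absolute value, which is used for the jump of the indicators of half-lines. -/
noncomputable def steinCoeff (c : E → ℕ) (ψ : ℝ → ℝ) (W : (E → M) → ℝ) (n : ℕ)
    (p : (E → M) × (E → M)) : ℝ :=
  1 / 2 * ∑ j ∈ Finset.range n, diff c W j p * ψ (diff c W j (swap c (Set.Iio j) p))

/-- The sum over all cells of the mean squared effect on the Stein coefficient of resampling the
first argument in that cell. A point `q` consists of the field `q.1.1`, of the copy `q.1.2` used
for this resampling and of the second argument `q.2` of the Stein coefficient. -/
noncomputable def fluctuation (c : E → ℕ) (μ : Measure (E → M)) (ψ : ℝ → ℝ) (W : (E → M) → ℝ)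
    (n : ℕ) : ℝ≥0∞ :=
  ∑' i, ∫⁻ q, ‖steinCoeff c ψ W n (q.1.1, q.2)
    - steinCoeff c ψ W n (mix c {i} q.1.1 q.1.2, q.2)‖ₑ ^ 2 ∂((μ.prod μ).prod μ)

lemma measurable_steinCoeff {ψ : ℝ → ℝ} (hψ : Measurable ψ) {W : (E → M) → ℝ}
    (hW : Measurable W) (n : ℕ) : Measurable (steinCoeff c ψ W n) := by
  unfold steinCoeff
  have := fun j => measurable_diff (c := c) hW j
  fun_prop

variable [IsProbabilityMeasure μ]

lemma Exchangeable.integrable_diff_mul (hex : Exchangeable c μ) {W : (E → M) → ℝ}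
    (hW2 : MemLp W 2 μ) {ψ : ℝ → ℝ} (hψm : Measurable ψ) (hψ : ∀ x, |ψ x| ≤ |x|) (j : ℕ) :
    Integrable (fun p => diff c W j p * ψ (diff c W j (swap c (Set.Iio j) p))) (μ.prod μ) := by
  have h1 := hex.memLp_diff_swap hW2 j (Set.Iio j)
  refine integrable_fun_mul (hex.memLp_diff hW2 j) (h1.mono ?_ (Eventually.of_forall fun p =>
    hψ _))
  exact (hψm.comp_aemeasurable h1.aestronglyMeasurable.aemeasurable).aestronglyMeasurable

lemma Exchangeable.integrable_steinCoeff (hex : Exchangeable c μ) {W : (E → M) → ℝ}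
    (hW2 : MemLp W 2 μ) {ψ : ℝ → ℝ} (hψm : Measurable ψ) (hψ : ∀ x, |ψ x| ≤ |x|) (n : ℕ) :
    Integrable (steinCoeff c ψ W n) (μ.prod μ) :=
  (integrable_finsetSum _ fun j _ => hex.integrable_diff_mul hW2 hψm hψ j).const_mul _

/-- The fluctuation controls the covariance of the Stein coefficient with a bounded function of
the field, by the Efron–Stein inequality for its conditional expectation given the field. -/
lemma Exchangeable.integral_mul_sub_integral_le (hex : Exchangeable c μ)
    {T : (E → M) × (E → M) → ℝ} (hT : Measurable T) (hTi : Integrable T (μ.prod μ))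
    {f : (E → M) → ℝ} (hf : Measurable f) {K : ℝ≥0} (hK : ∀ x, |f x| ≤ K) :
    ENNReal.ofReal |∫ p, f p.1 * (T p - ∫ p', T p' ∂(μ.prod μ)) ∂(μ.prod μ)|
      ≤ K * (∑' i, ∫⁻ q, ‖T (q.1.1, q.2) - T (mix c {i} q.1.1 q.1.2, q.2)‖ₑ ^ 2
          ∂((μ.prod μ).prod μ)) ^ (1 / 2 : ℝ) := by
  set τ := ∫ p', T p' ∂(μ.prod μ) with hτ
  set G : (E → M) → ℝ := fun x => ∫ x', T (x, x') ∂μ with hG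
  have hGm : Measurable G := hT.stronglyMeasurable.integral_prod_right'.measurable
  have hGi : Integrable G μ := hTi.integral_prod_left
  have hGτ : ∫ x, G x ∂μ = τ := (integral_prod _ hTi).symm
  have hes := hex.sq_lintegral_enorm_sub_le hGm hGi
  have hsec : ∀ᵐ x ∂μ, Integrable (fun x' => T (x, x')) μ := hTi.prod_right_ae
  have hdiff : ∀ i, ∫⁻ p, ‖diff c G i p‖ₑ ^ 2 ∂(μ.prod μ)
      ≤ ∫⁻ q, ‖T (q.1.1, q.2) - T (mix c {i} q.1.1 q.1.2, q.2)‖ₑ ^ 2 ∂((μ.prod μ).prod μ) := by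
    intro i
    rw [lintegral_prod (fun q : ((E → M) × (E → M)) × (E → M) =>
      ‖T (q.1.1, q.2) - T (mix c {i} q.1.1 q.1.2, q.2)‖ₑ ^ 2) (by fun_prop)]
    refine lintegral_mono_ae ?_
    have h1 := (measurePreserving_fst (μ := μ) (ν := μ)).quasiMeasurePreserving.ae hsec
    have h2 := (hex.measurePreserving_mix {i}).quasiMeasurePreserving.ae hsec
    filter_upwards [h1, h2] with p hp1 hp2
    rw [diff, hG]
    simp only
    rw [← integral_sub hp1 hp2]
    refine (pow_le_pow_left' (enorm_integral_le_lintegral_enorm _) 2).trans ?_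
    exact sq_lintegral_le (by fun_prop)
  have hsum := hes.trans (ENNReal.tsum_le_tsum hdiff)
  rw [hGτ] at hsum
  have hroot : ∫⁻ x, ‖G x - τ‖ₑ ∂μ ≤ (∑' i, ∫⁻ q, ‖T (q.1.1, q.2)
      - T (mix c {i} q.1.1 q.1.2, q.2)‖ₑ ^ 2 ∂((μ.prod μ).prod μ)) ^ (1 / 2 : ℝ) := by
    rw [one_div, ENNReal.le_rpow_inv_iff (by norm_num), ENNReal.rpow_ofNat]
    exact hsum
  have hprod : ∫ p, f p.1 * (T p - τ) ∂(μ.prod μ) = ∫ x, f x * (G x - τ) ∂μ := by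
    rw [integral_prod]
    · refine integral_congr_ae ?_
      filter_upwards [hsec] with x hx
      rw [integral_const_mul, integral_sub hx (integrable_const _)]
      simp [hG]
    · exact (hTi.sub (integrable_const _)).bdd_mul (c := K)
        (hf.comp measurable_fst).aestronglyMeasurable (Eventually.of_forall fun p => hK p.1)
  rw [hprod, ← Real.enorm_eq_ofReal_abs]
  refine (enorm_integral_le_lintegral_enorm _).trans ?_
  calc ∫⁻ x, ‖f x * (G x - τ)‖ₑ ∂μ ≤ ∫⁻ x, K * ‖G x - τ‖ₑ ∂μ := by
        refine lintegral_mono fun x => ?_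
        rw [enorm_mul]
        gcongr
        rw [Real.enorm_eq_ofReal_abs]
        exact ENNReal.ofReal_le_of_le_toReal (by simpa using hK x)
    _ = K * ∫⁻ x, ‖G x - τ‖ₑ ∂μ := by rw [lintegral_const_mul _ (by fun_prop)]
    _ ≤ _ := by gcongr

variable {W : (E → M) → ℝ}

/-- Integration by parts: the expectation of `g (W) - W φ (W)` in terms of the Stein coefficient
and of the Taylor remainders of `φ`. -/
lemma Exchangeable.integral_stein (hex : Exchangeable c μ) (hW : Measurable W)
    (hW2 : MemLp W 2 μ) {φ g : ℝ → ℝ} (hφm : Measurable φ) (hgm : Measurable g) {K : ℝ}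
    (hφ : ∀ w, |φ w| ≤ K) (hg : ∀ w, |g w| ≤ K) (n : ℕ) :
    ∫ x, (g (W x) - W x * φ (W x)) ∂μ
      = (∫ p, g (W p.1) * (1 - steinCoeff c id W n p) ∂(μ.prod μ))
        - 1 / 2 * (∑ j ∈ Finset.range n, ∫ p, (φ (W p.1) - φ (W (mix c {j} p.1 p.2))
            - g (W p.1) * diff c W j p) * diff c W j (swap c (Set.Iio j) p) ∂(μ.prod μ))
        - ∫ p, φ (W p.1) * W (mix c (Set.Iio n) p.1 p.2) ∂(μ.prod μ) := by
  have hWi : Integrable W μ := hW2.integrable (by norm_num)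
  have hφ2 : MemLp (fun x => φ (W x)) 2 μ :=
    (memLp_top_of_bound (Measurable.aestronglyMeasurable (by fun_prop)) K
      (Eventually.of_forall fun x => hφ _)).mono_exponent le_top
  have hg2 : MemLp (fun x => g (W x)) 2 μ :=
    (memLp_top_of_bound (Measurable.aestronglyMeasurable (by fun_prop)) K
      (Eventually.of_forall fun x => hg _)).mono_exponent le_top
  have hgi : Integrable (fun x => g (W x)) μ := hg2.integrable (by norm_num)
  have hgD : ∀ j, Integrable (fun p : (E → M) × (E → M) =>
      g (W p.1) * (diff c W j p * diff c W j (swap c (Set.Iio j) p))) (μ.prod μ) := fun j =>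
    (hex.integrable_diff_mul hW2 measurable_id (fun _ => le_rfl) j).bdd_mul (c := K)
      (Measurable.aestronglyMeasurable (by fun_prop)) (Eventually.of_forall fun p => hg _)
  have hφD : ∀ j, Integrable (fun p : (E → M) × (E → M) =>
      diff c (fun x => φ (W x)) j p * diff c W j (swap c (Set.Iio j) p)) (μ.prod μ) := fun j =>
    integrable_fun_mul (hex.memLp_diff hφ2 j) (hex.memLp_diff_swap hW2 j _)
  have hT : Integrable (fun p => g (W p.1) * steinCoeff c id W n p) (μ.prod μ) :=
    (hex.integrable_steinCoeff hW2 measurable_id (fun _ => le_rfl) n).bdd_mul (c := K)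
      (Measurable.aestronglyMeasurable (by fun_prop)) (Eventually.of_forall fun p => hg _)
  have e1 : ∫ x, (g (W x) - W x * φ (W x)) ∂μ
      = (∫ p, g (W p.1) ∂(μ.prod μ)) - ∫ p, φ (W p.1) * W p.1 ∂(μ.prod μ) := by
    rw [integral_sub hgi (integrable_fun_mul hW2 hφ2)]
    congr 1
    · exact (integral_comp_measurePreserving measurePreserving_fst
        (g := fun x => g (W x)) hgi.aestronglyMeasurable).symm
    · rw [← integral_comp_measurePreserving (measurePreserving_fst (μ := μ) (ν := μ))
        (g := fun x => W x * φ (W x)) (by fun_prop)]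
      simp_rw [mul_comm]
  have e2 : ∫ p, φ (W p.1) * W p.1 ∂(μ.prod μ)
      = (∫ p, φ (W p.1) * (W p.1 - W (mix c (Set.Iio n) p.1 p.2)) ∂(μ.prod μ))
        + ∫ p, φ (W p.1) * W (mix c (Set.Iio n) p.1 p.2) ∂(μ.prod μ) := by
    have hsub : MemLp (fun p : (E → M) × (E → M) => W p.1 - W (mix c (Set.Iio n) p.1 p.2)) 2
        (μ.prod μ) := (memLp_fst hW2).sub (hex.memLp_mix hW2 _)
    rw [← integral_add (integrable_fun_mul (memLp_fst hφ2) hsub)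
      (integrable_fun_mul (memLp_fst hφ2) (hex.memLp_mix hW2 _))]
    refine integral_congr_ae (Eventually.of_forall fun p => ?_)
    simp only; ring
  have e3 : ∫ p, g (W p.1) * (1 - steinCoeff c id W n p) ∂(μ.prod μ)
      = (∫ p, g (W p.1) ∂(μ.prod μ)) - ∫ p, g (W p.1) * steinCoeff c id W n p ∂(μ.prod μ) := by
    rw [← integral_sub ((memLp_fst hg2).integrable (by norm_num)) hT]
    simp_rw [mul_sub, mul_one]
  have e4 : ∫ p, g (W p.1) * steinCoeff c id W n p ∂(μ.prod μ)
      = 1 / 2 * ∑ j ∈ Finset.range n, ∫ p, g (W p.1) * (diff c W j p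
          * diff c W j (swap c (Set.Iio j) p)) ∂(μ.prod μ) := by
    rw [← integral_finsetSum _ fun j _ => hgD j, ← integral_const_mul]
    refine integral_congr_ae (Eventually.of_forall fun p => ?_)
    simp only [steinCoeff, id, ← Finset.mul_sum]
    ring
  have e5 := integral_mul_sub_mix hex hφ2 hW2 n
  have e6 : ∀ j, ∫ p, (φ (W p.1) - φ (W (mix c {j} p.1 p.2))
            - g (W p.1) * diff c W j p) * diff c W j (swap c (Set.Iio j) p) ∂(μ.prod μ)
      = (∫ p, diff c (fun x => φ (W x)) j p * diff c W j (swap c (Set.Iio j) p) ∂(μ.prod μ))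
        - ∫ p, g (W p.1) * (diff c W j p
          * diff c W j (swap c (Set.Iio j) p)) ∂(μ.prod μ) := by
    intro j
    rw [← integral_sub (hφD j) (hgD j)]
    refine integral_congr_ae (Eventually.of_forall fun p => ?_)
    simp only [diff]; ring
  rw [e1, e2, e3, e4, e5]
  simp_rw [e6]
  rw [Finset.sum_sub_distrib]
  ring

/-- Stein's method with general control of the Taylor remainders. -/
lemma Exchangeable.stein_bound (hex : Exchangeable c μ) (hW : Measurable W)
    (hW2 : MemLp W 2 μ) (hW0 : ∫ x, W x ∂μ = 0) (hW1 : ∫ x, W x ^ 2 ∂μ = 1)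
    {φ g : ℝ → ℝ} (hφm : Measurable φ) (hgm : Measurable g) {K : ℝ≥0}
    (hφ : ∀ w, |φ w| ≤ K) (hg : ∀ w, |g w| ≤ K) {V S : ℝ≥0∞}
    (hV : ∀ n, fluctuation c μ id W n ≤ V)
    (hS : ∀ n, ∑ j ∈ Finset.range n, ∫⁻ p, ‖φ (W p.1) - φ (W (mix c {j} p.1 p.2))
            - g (W p.1) * diff c W j p‖ₑ * ‖diff c W j (swap c (Set.Iio j) p)‖ₑ ∂(μ.prod μ) ≤ S) :
    ENNReal.ofReal |∫ x, (g (W x) - W x * φ (W x)) ∂μ| ≤ K * V ^ (1 / 2 : ℝ) + S := by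
  have hWi : Integrable W μ := hW2.integrable (by norm_num)
  set τ : ℕ → ℝ := fun n => ∫ p, steinCoeff c id W n p ∂(μ.prod μ) with hτ
  have hTi := fun n => hex.integrable_steinCoeff hW2 measurable_id (fun _ => le_rfl) n
  -- the mean of the Stein coefficient tends to the variance of `W`
  have hτlim : Tendsto τ atTop (𝓝 1) := by
    have h1 := (tendsto_const_nhds (x := (1 : ℝ))).sub
      (hex.tendsto_integral_mul_mix_self hW hW2 hW0)
    rw [sub_zero] at h1
    refine h1.congr fun n => ?_
    have h2 := integral_mul_sub_mix hex hW2 hW2 n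
    have h3 : τ n = 1 / 2 * ∑ j ∈ Finset.range n,
          ∫ p, diff c W j p * diff c W j (swap c (Set.Iio j) p) ∂(μ.prod μ) := by
      have h4 := integral_finsetSum (Finset.range n) fun j _ =>
        hex.integrable_diff_mul hW2 measurable_id (fun _ => le_rfl) j
      simp only [id] at h4
      rw [← h4, ← integral_const_mul]
      rfl
    rw [h3, ← h2]
    simp_rw [mul_sub]
    rw [integral_sub (integrable_fun_mul (memLp_fst hW2) (memLp_fst hW2))
      (integrable_fun_mul (memLp_fst hW2) (hex.memLp_mix hW2 _)), ← hW1]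
    congr 1
    rw [← integral_comp_measurePreserving (measurePreserving_fst (μ := μ) (ν := μ))
        (g := fun x => W x ^ 2) (Measurable.aestronglyMeasurable (by fun_prop))]
    simp_rw [pow_two]
  have hρlim := hex.tendsto_integral_mul_mix (f := fun x => φ (W x)) (g := W) (by fun_prop)
    (fun x => hφ _) hWi
  rw [hW0, mul_zero] at hρlim
  set ρ : ℕ → ℝ := fun n => ∫ p, φ (W p.1) * W (mix c (Set.Iio n) p.1 p.2) ∂(μ.prod μ) with hρ
  have herr : Tendsto (fun n => ENNReal.ofReal (K * |1 - τ n|) + (K * V ^ (1 / 2 : ℝ) + S)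
      + ENNReal.ofReal |ρ n|) atTop (𝓝 (ENNReal.ofReal (K * |1 - 1|) + (K * V ^ (1 / 2 : ℝ) + S)
      + ENNReal.ofReal |0|)) := by
    refine Tendsto.add (Tendsto.add ?_ tendsto_const_nhds) (ENNReal.tendsto_ofReal hρlim.abs)
    exact ENNReal.tendsto_ofReal ((tendsto_const_nhds.sub hτlim).abs.const_mul _)
  simp only [sub_self, abs_zero, mul_zero, ENNReal.ofReal_zero, zero_add, add_zero] at herr
  refine ge_of_tendsto herr (Eventually.of_forall fun n => ?_)
  rw [hex.integral_stein hW hW2 hφm hgm hφ hg n]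
  have hg2 : Integrable (fun x => g (W x)) μ := (integrable_const (K : ℝ)).mono'
    (Measurable.aestronglyMeasurable (by fun_prop))
    (Eventually.of_forall fun x => hg _)
  have hfst : Integrable (fun p : (E → M) × (E → M) => g (W p.1)) (μ.prod μ) :=
    (measurePreserving_fst (μ := μ) (ν := μ)).integrable_comp_of_integrable hg2
  have e1 : ∫ p, g (W p.1) * (1 - steinCoeff c id W n p) ∂(μ.prod μ)
      = (1 - τ n) * (∫ p, g (W p.1) ∂(μ.prod μ))
        - ∫ p, g (W p.1) * (steinCoeff c id W n p - τ n) ∂(μ.prod μ) := by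
    rw [← integral_const_mul, ← integral_sub (hfst.const_mul _)]
    · refine integral_congr_ae (Eventually.of_forall fun p => ?_)
      simp only; ring
    · exact ((hTi n).sub (integrable_const _)).bdd_mul (c := K)
        (Measurable.aestronglyMeasurable (by fun_prop)) (Eventually.of_forall fun p => hg _)
  have b1 : |(1 - τ n) * (∫ p, g (W p.1) ∂(μ.prod μ))| ≤ K * |1 - τ n| := by
    rw [abs_mul, mul_comm]
    refine mul_le_mul_of_nonneg_right ?_ (abs_nonneg _)
    have := norm_integral_le_of_norm_le_const (μ := μ.prod μ) (f := fun p => g (W p.1)) (C := K)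
      (Eventually.of_forall fun p => hg _)
    simpa using this
  have b2 := (hex.integral_mul_sub_integral_le (measurable_steinCoeff measurable_id hW n)
    (hTi n) (f := fun x => g (W x)) (by fun_prop) (fun x => hg _)).trans
    (mul_le_mul_right (ENNReal.rpow_le_rpow (hV n) (by norm_num)) (K : ℝ≥0∞))
  have b3 : ENNReal.ofReal |1 / 2 * (∑ j ∈ Finset.range n, ∫ p, (φ (W p.1)
      - φ (W (mix c {j} p.1 p.2)) - g (W p.1) * diff c W j p)
        * diff c W j (swap c (Set.Iio j) p) ∂(μ.prod μ))| ≤ S := by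
    rw [abs_mul]
    have h1 : |(1 : ℝ) / 2| ≤ 1 := by norm_num
    refine (ENNReal.ofReal_le_ofReal (mul_le_of_le_one_left (abs_nonneg _) h1)).trans ?_
    refine le_trans ?_ (hS n)
    refine (ENNReal.ofReal_le_ofReal (Finset.abs_sum_le_sum_abs _ _)).trans ?_
    rw [ENNReal.ofReal_sum_of_nonneg fun _ _ => abs_nonneg _]
    refine Finset.sum_le_sum fun j _ => ?_
    rw [← Real.enorm_eq_ofReal_abs]
    refine (enorm_integral_le_lintegral_enorm _).trans (le_of_eq ?_)
    simp_rw [enorm_mul]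
  rw [e1]
  have key : ∀ a b d r : ℝ, ENNReal.ofReal |a - b - d - r|
      ≤ ENNReal.ofReal |a| + (ENNReal.ofReal |b| + ENNReal.ofReal |d|) + ENNReal.ofReal |r| := by
    intro a b d r
    rw [← ENNReal.ofReal_add (abs_nonneg _) (abs_nonneg _),
      ← ENNReal.ofReal_add (abs_nonneg _) (by positivity),
      ← ENNReal.ofReal_add (by positivity) (abs_nonneg _)]
    refine ENNReal.ofReal_le_ofReal ?_
    have h1 := abs_sub (a - b - d) r
    have h2 := abs_sub (a - b) d
    have h3 := abs_sub a b
    linarith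
  refine (key _ _ _ _).trans ?_
  gcongr

/-- The sum over the cells of the mixed third absolute moments of the differences of `W`, with
weight `w` on the field. -/
noncomputable def thirdMoment (c : E → ℕ) (μ : Measure (E → M)) (w : (E → M) → ℝ≥0∞)
    (W : (E → M) → ℝ) : ℝ≥0∞ :=
  ∑' j, ∫⁻ p, w p.1 * (‖diff c W j p‖ₑ ^ 2 * ‖diff c W j (swap c (Set.Iio j) p)‖ₑ) ∂(μ.prod μ)

/-- Wasserstein bound for a single Lipschitz test function. -/
theorem Exchangeable.lipschitz_bound (hex : Exchangeable c μ) (hW : Measurable W)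
    (hW2 : MemLp W 2 μ) (hW0 : ∫ x, W x ∂μ = 0) (hW1 : ∫ x, W x ^ 2 ∂μ = 1) {V : ℝ≥0∞}
    (hV : ∀ n, fluctuation c μ id W n ≤ V) {h : ℝ → ℝ} (hL : LipschitzWith 1 h) :
    ENNReal.ofReal |(∫ x, h (W x) ∂μ) - ∫ x, h x ∂(gaussianReal 0 1)|
      ≤ 8 * (V ^ (1 / 2 : ℝ) + thirdMoment c μ 1 W) := by
  obtain ⟨φ, g, hφm, hgm, hφ, hg, heq, hrem⟩ := Stein.exists_sol_of_lipschitz hL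
  have hi : Integrable (fun x => h (W x)) μ := by
    have hm : AEMeasurable W μ := hW.aemeasurable
    have : IsProbabilityMeasure (μ.map W) := Measure.isProbabilityMeasure_map hm
    have := Stein.integrable_of_lipschitz hL (P := μ.map W)
      ((integrable_map_measure (by fun_prop) hm).2 (hW2.integrable (by norm_num)))
    exact (integrable_map_measure hL.continuous.aestronglyMeasurable hm).1 this
  have key := hex.stein_bound hW hW2 hW0 hW1 hφm hgm (K := 8)
    (fun w => (hφ w).trans (by norm_num)) (fun w => (hg w).trans (by norm_num)) hV
    (S := 8 * thirdMoment c μ 1 W) (fun n => by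
      rw [thirdMoment, ← ENNReal.tsum_mul_left]
      refine le_trans (Finset.sum_le_sum fun j _ => ?_) (ENNReal.sum_le_tsum (Finset.range n))
      rw [← lintegral_const_mul' _ _ (by norm_num)]
      refine lintegral_mono fun p => ?_
      rw [Pi.one_apply, one_mul, ← mul_assoc]
      gcongr
      have := hrem (W p.1) (W (mix c {j} p.1 p.2))
      rw [Real.enorm_eq_ofReal_abs, Real.enorm_eq_ofReal_abs, ← ENNReal.ofReal_pow (abs_nonneg _),
        sq_abs, show (8 : ℝ≥0∞) = ENNReal.ofReal 8 by norm_num,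
        ← ENNReal.ofReal_mul (by norm_num)]
      exact ENNReal.ofReal_le_ofReal this)
  simp_rw [heq] at key
  rw [integral_sub hi (integrable_const _)] at key
  rw [mul_add]
  simpa using key

/-- Kolmogorov bound at a single point. -/
theorem Exchangeable.indicator_bound (hex : Exchangeable c μ) (hW : Measurable W)
    (hW2 : MemLp W 2 μ) (hW0 : ∫ x, W x ∂μ = 0) (hW1 : ∫ x, W x ^ 2 ∂μ = 1) {V : ℝ≥0∞}
    (hV : ∀ n, fluctuation c μ id W n ≤ V) (hV' : ∀ n, fluctuation c μ abs W n ≤ V) (s : ℝ) :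
    ENNReal.ofReal |μ.real (W ⁻¹' Set.Iic s) - (gaussianReal 0 1).real (Set.Iic s)|
      ≤ 8 * (V ^ (1 / 2 : ℝ) + thirdMoment c μ 1 W + thirdMoment c μ (fun x => ‖W x‖ₑ) W) := by
  obtain ⟨φ, g, hφm, hgm, hφ, hg, heq, hrem⟩ := Stein.exists_sol_of_indicator s
  set i : ℝ → ℝ := (Set.Iic s).indicator 1 with hi
  have him : Measurable i := measurable_one.indicator measurableSet_Iic
  have hi0 : ∀ x, 0 ≤ i x := fun x => Set.indicator_nonneg (fun _ _ => zero_le_one) x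
  have hi1 : ∀ x, i x ≤ 1 := fun x => Set.indicator_le_self' (fun _ _ => zero_le_one) x
  have hib : ∀ x, |i x| ≤ ((1 : ℝ≥0) : ℝ) := fun x => by
    rw [abs_of_nonneg (hi0 x)]; simpa using hi1 x
  have hint : Integrable (fun x => i (W x)) μ := (integrable_const (1 : ℝ)).mono'
    (him.comp hW).aestronglyMeasurable (Eventually.of_forall fun x => by simpa using hib (W x))
  have hii : ∫ x, i (W x) ∂μ = μ.real (W ⁻¹' Set.Iic s) := by
    have : (fun x => i (W x)) = (W ⁻¹' Set.Iic s).indicator 1 := by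
      ext x
      by_cases hx : W x ∈ Set.Iic s
      · rw [hi, Set.indicator_of_mem hx, Set.indicator_of_mem (Set.mem_preimage.2 hx)]
        rfl
      · rw [hi, Set.indicator_of_notMem hx,
          Set.indicator_of_notMem (fun h => hx (Set.mem_preimage.1 h))]
    rw [this, integral_indicator_one (hW measurableSet_Iic)]
  set D' : ℕ → (E → M) × (E → M) → ℝ := fun j p => diff c W j (swap c (Set.Iio j) p) with hD'
  have hD'm : ∀ j, Measurable (D' j) := fun j => by
    have := measurable_diff (c := c) hW j
    simp only [hD']; fun_prop
  have hDm := fun j => measurable_diff (c := c) hW j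
  -- the monotone part of the remainder is a covariance with the second Stein coefficient
  set Bt : ℕ → (E → M) × (E → M) → ℝ := fun j p =>
    -(diff c (fun x => i (W x)) j p * (diff c W j p * |D' j p|)) with hB
  have hDD : ∀ j, Integrable (fun p => diff c W j p * |D' j p|) (μ.prod μ) := fun j =>
    hex.integrable_diff_mul hW2 measurable_abs (fun x => (abs_abs x).le) j
  have hiD : ∀ j, Integrable (fun p : (E → M) × (E → M) => i (W p.1) * (diff c W j p * |D' j p|))
      (μ.prod μ) := fun j =>
    (hDD j).bdd_mul (c := 1) (him.comp (hW.comp measurable_fst)).aestronglyMeasurable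
      (Eventually.of_forall fun p => by simpa using hib (W p.1))
  have hodd : ∀ j p, (fun p => diff c W j p * |D' j p|) (swap c {j} p)
      = -(fun p => diff c W j p * |D' j p|) p := by
    intro j p
    simp only [hD', diff_swap_swap_self, diff_swap_self, abs_neg]; ring
  have hanti : Antitone i := by
    intro x y hxy
    by_cases hy : y ∈ Set.Iic s
    · have hx : x ∈ Set.Iic s := Set.mem_Iic.2 (hxy.trans (Set.mem_Iic.1 hy))
      simp only [hi, Set.indicator_of_mem hx, Set.indicator_of_mem hy, le_refl, Pi.one_apply]
    · simp only [hi, Set.indicator_of_notMem hy]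
      exact hi0 x
  have hB0 : ∀ j p, 0 ≤ Bt j p := by
    intro j p
    have : 0 ≤ -(diff c (fun x => i (W x)) j p * diff c W j p) := by
      simp only [diff]
      rcases le_total (W p.1) (W (mix c {j} p.1 p.2)) with h | h
      · nlinarith [hanti h]
      · nlinarith [hanti h]
    simp only [hB]
    nlinarith [mul_nonneg this (abs_nonneg (D' j p))]
  have hBi : ∀ j, Integrable (Bt j) (μ.prod μ) := by
    intro j
    refine ((hDD j).bdd_mul (c := 1) (f := diff c (fun x => i (W x)) j) ?_ ?_).neg
    · exact (measurable_diff (by fun_prop) j).aestronglyMeasurable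
    · refine Eventually.of_forall fun p => ?_
      simp only [diff, Real.norm_eq_abs]
      rw [abs_le]
      exact ⟨by linarith [hi0 (W p.1), hi1 (W (mix c {j} p.1 p.2))],
        by linarith [hi1 (W p.1), hi0 (W (mix c {j} p.1 p.2))]⟩
  have hBsum : ∀ n, ∑ j ∈ Finset.range n, ∫⁻ p, ENNReal.ofReal (Bt j p) ∂(μ.prod μ)
      ≤ 4 * V ^ (1 / 2 : ℝ) := by
    intro n
    have hTi := hex.integrable_steinCoeff hW2 measurable_abs (fun x => (abs_abs x).le) n
    -- each term is odd under the exchange of its own cell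
    have h0 : ∫ p, steinCoeff c abs W n p ∂(μ.prod μ) = 0 := by
      simp only [steinCoeff]
      rw [integral_const_mul, integral_finsetSum _ fun j _ => hDD j]
      rw [Finset.sum_eq_zero, mul_zero]
      intro j _
      have := hex.integral_mul_odd (F := fun _ => (1 : ℝ)) (hodd j) (by simpa using hDD j)
      simpa [diff] using this
    have h1 := hex.integral_mul_sub_integral_le (measurable_steinCoeff measurable_abs hW n)
      hTi (f := fun x => i (W x)) (by fun_prop) (fun x => hib _)
    rw [h0] at h1
    simp only [sub_zero, ENNReal.coe_one, one_mul] at h1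
    have h2 : ∑ j ∈ Finset.range n, ∫ p, Bt j p ∂(μ.prod μ)
        = -4 * ∫ p, i (W p.1) * steinCoeff c abs W n p ∂(μ.prod μ) := by
      have h3 : ∫ p, i (W p.1) * steinCoeff c abs W n p ∂(μ.prod μ)
          = 1 / 2 * ∑ j ∈ Finset.range n,
            ∫ p, i (W p.1) * (diff c W j p * |D' j p|) ∂(μ.prod μ) := by
        rw [← integral_finsetSum _ fun j _ => hiD j, ← integral_const_mul]
        refine integral_congr_ae (Eventually.of_forall fun p => ?_)
        simp only [steinCoeff, hD', ← Finset.mul_sum]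
        ring
      rw [h3, Finset.mul_sum, Finset.mul_sum]
      refine Finset.sum_congr rfl fun j _ => ?_
      rw [hex.integral_mul_odd (F := fun x => i (W x)) (hodd j) (hiD j)]
      simp only [hB]
      rw [integral_neg]; ring
    calc ∑ j ∈ Finset.range n, ∫⁻ p, ENNReal.ofReal (Bt j p) ∂(μ.prod μ)
        = ENNReal.ofReal (∑ j ∈ Finset.range n, ∫ p, Bt j p ∂(μ.prod μ)) := by
          rw [ENNReal.ofReal_sum_of_nonneg fun j _ => integral_nonneg (hB0 j)]
          refine Finset.sum_congr rfl fun j _ => ?_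
          rw [ofReal_integral_eq_lintegral_ofReal (hBi j) (Eventually.of_forall (hB0 j))]
      _ ≤ ENNReal.ofReal (4 * |∫ p, i (W p.1) * steinCoeff c abs W n p ∂(μ.prod μ)|) := by
          refine ENNReal.ofReal_le_ofReal ?_
          rw [h2]
          have := neg_abs_le (∫ p, i (W p.1) * steinCoeff c abs W n p ∂(μ.prod μ))
          linarith
      _ ≤ 4 * V ^ (1 / 2 : ℝ) := by
          rw [ENNReal.ofReal_mul (by norm_num), ENNReal.ofReal_ofNat]
          gcongr
          exact h1.trans (ENNReal.rpow_le_rpow (hV' n) (by norm_num))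
  have hptw : ∀ j p, ‖φ (W p.1) - φ (W (mix c {j} p.1 p.2)) - g (W p.1) * diff c W j p‖ₑ
      * ‖D' j p‖ₑ ≤ 3 * (1 * (‖diff c W j p‖ₑ ^ 2 * ‖D' j p‖ₑ))
        + 2 * (‖W p.1‖ₑ * (‖diff c W j p‖ₑ ^ 2 * ‖D' j p‖ₑ)) + ENNReal.ofReal (Bt j p) := by
    intro j p
    have h1 := hrem (W p.1) (W (mix c {j} p.1 p.2))
    have h2 := mul_le_mul_of_nonneg_right h1 (abs_nonneg (D' j p))
    simp only [Real.enorm_eq_ofReal_abs]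
    rw [← ENNReal.ofReal_mul (abs_nonneg _), ← ENNReal.ofReal_pow (abs_nonneg _),
      ← ENNReal.ofReal_mul (by positivity), ← ENNReal.ofReal_mul (by positivity), one_mul,
      show (3 : ℝ≥0∞) = ENNReal.ofReal 3 by norm_num,
      show (2 : ℝ≥0∞) = ENNReal.ofReal 2 by norm_num,
      ← ENNReal.ofReal_mul (by positivity), ← ENNReal.ofReal_mul (by positivity),
      ← ENNReal.ofReal_add (by positivity) (by positivity),
      ← ENNReal.ofReal_add (by positivity) (hB0 j p)]
    refine ENNReal.ofReal_le_ofReal (h2.trans (le_of_eq ?_))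
    simp only [hB, diff, sq_abs]
    ring
  have key := hex.stein_bound hW hW2 hW0 hW1 hφm hgm (K := 3) (fun w => hφ w)
    (fun w => (hg w).trans (by norm_num)) hV
    (S := 3 * thirdMoment c μ 1 W + 2 * thirdMoment c μ (fun x => ‖W x‖ₑ) W
      + 4 * V ^ (1 / 2 : ℝ)) (fun n => by
      refine le_trans (Finset.sum_le_sum fun j _ => lintegral_mono (hptw j)) ?_
      have hm : ∀ j, Measurable fun p : (E → M) × (E → M) =>
          ‖diff c W j p‖ₑ ^ 2 * ‖D' j p‖ₑ := fun j => by
        have := hDm j; have := hD'm j; fun_prop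
      have hBm : ∀ j, Measurable (Bt j) := fun j => by
        have := hDm j; have := hD'm j
        have := measurable_diff (c := c) (F := fun x => i (W x)) (by fun_prop) j
        simp only [hB]; fun_prop
      have hsplit : ∀ j, ∫⁻ p, (3 * (1 * (‖diff c W j p‖ₑ ^ 2 * ‖D' j p‖ₑ))
            + 2 * (‖W p.1‖ₑ * (‖diff c W j p‖ₑ ^ 2 * ‖D' j p‖ₑ))
            + ENNReal.ofReal (Bt j p)) ∂(μ.prod μ)
          = 3 * (∫⁻ p, 1 * (‖diff c W j p‖ₑ ^ 2 * ‖D' j p‖ₑ) ∂(μ.prod μ))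
            + 2 * (∫⁻ p, ‖W p.1‖ₑ * (‖diff c W j p‖ₑ ^ 2 * ‖D' j p‖ₑ) ∂(μ.prod μ))
            + ∫⁻ p, ENNReal.ofReal (Bt j p) ∂(μ.prod μ) := by
        intro j
        have := hm j
        have := hBm j
        rw [lintegral_add_left (by fun_prop), lintegral_add_left (by fun_prop),
          lintegral_const_mul 3 (by fun_prop), lintegral_const_mul 2 (by fun_prop)]
      simp_rw [hsplit]
      rw [Finset.sum_add_distrib, Finset.sum_add_distrib, ← Finset.mul_sum, ← Finset.mul_sum]
      refine add_le_add (add_le_add ?_ ?_) (hBsum n)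
      · gcongr
        exact ENNReal.sum_le_tsum (f := fun j => ∫⁻ p, (1 : (E → M) → ℝ≥0∞) p.1
          * (‖diff c W j p‖ₑ ^ 2 * ‖D' j p‖ₑ) ∂(μ.prod μ)) (Finset.range n)
      · gcongr
        exact ENNReal.sum_le_tsum (f := fun j => ∫⁻ p, ‖W p.1‖ₑ
          * (‖diff c W j p‖ₑ ^ 2 * ‖D' j p‖ₑ) ∂(μ.prod μ)) (Finset.range n))
  simp_rw [heq] at key
  rw [integral_sub hint (integrable_const _), hii] at key
  simp only [integral_const, probReal_univ, one_smul] at key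
  refine key.trans ?_
  rw [mul_add, mul_add]
  set v := V ^ (1 / 2 : ℝ)
  have hk : ((3 : ℝ≥0) : ℝ≥0∞) = 3 := by norm_num
  rw [hk]
  calc 3 * v + (3 * thirdMoment c μ 1 W + 2 * thirdMoment c μ (fun x => ‖W x‖ₑ) W + 4 * v)
      = 7 * v + 3 * thirdMoment c μ 1 W + 2 * thirdMoment c μ (fun x => ‖W x‖ₑ) W := by ring
    _ ≤ _ := by gcongr <;> norm_num

end Resampling

/-! ### Fluctuations of the Stein coefficient in terms of second differences -/

namespace Resampling

open Filter Topology

lemma add_sq_le_two_mul (a b : ℝ≥0∞) : (a + b) ^ 2 ≤ 2 * (a ^ 2 + b ^ 2) := by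
  have h := ENNReal.rpow_add_le_mul_rpow_add_rpow a b (p := 2) (by norm_num)
  simp only [ENNReal.rpow_ofNat] at h
  norm_num at h
  exact h

lemma add_add_add_sq_le (a b d r : ℝ≥0∞) :
    (a + b + d + r) ^ 2 ≤ 8 * (a ^ 2 + b ^ 2 + d ^ 2 + r ^ 2) := by
  have h1 := add_sq_le_two_mul (a + b + d) r
  have h2 := add_sq_le_two_mul (a + b) d
  have h3 := add_sq_le_two_mul a b
  calc (a + b + d + r) ^ 2 ≤ 2 * (2 * (2 * (a ^ 2 + b ^ 2) + d ^ 2) + r ^ 2) := by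
        refine h1.trans ?_
        gcongr
        refine h2.trans ?_
        gcongr
    _ = 8 * a ^ 2 + 8 * b ^ 2 + 4 * d ^ 2 + 2 * r ^ 2 := by ring
    _ ≤ 8 * a ^ 2 + 8 * b ^ 2 + 8 * d ^ 2 + 8 * r ^ 2 := by gcongr <;> norm_num
    _ = _ := by ring

lemma tsum_eq_tsum_comp {ι : Type*} {e : ι → ℕ} (he : Function.Injective e) {F : ℕ → ℝ≥0∞}
    (hF : ∀ n, n ∉ Set.range e → F n = 0) : ∑' n, F n = ∑' z, F (e z) := by
  refine (he.tsum_eq fun n hn => ?_).symm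
  by_contra h
  exact hn (hF n h)

variable {ι E M : Type*}

/-- The indices enumerated before `z`. -/
def lower (e : ι → ℕ) (z : ι) : Set ι := {z' | e z' < e z}

lemma notMem_lower_self (e : ι → ℕ) (z : ι) : z ∉ lower e z := lt_irrefl (e z)

variable {cell : E → ι} {e : ι → ℕ}

lemma mix_comp (cell : E → ι) (e : ι → ℕ) (B : Set ℕ) (x y : E → M) :
    mix (e ∘ cell) B x y = mix cell (e ⁻¹' B) x y := rfl

lemma swap_comp (cell : E → ι) (e : ι → ℕ) (B : Set ℕ) (p : (E → M) × (E → M)) :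
    swap (e ∘ cell) B p = swap cell (e ⁻¹' B) p := rfl

lemma diff_comp (he : Function.Injective e) (W : (E → M) → ℝ) (z : ι) (p : (E → M) × (E → M)) :
    diff (e ∘ cell) W (e z) p = diff cell W z p := by
  have : e ⁻¹' {e z} = {z} := by ext z'; simp [he.eq_iff]
  rw [diff, diff, mix_comp, this]

lemma diff_comp_of_notMem (W : (E → M) → ℝ) {n : ℕ} (hn : n ∉ Set.range e)
    (p : (E → M) × (E → M)) : diff (e ∘ cell) W n p = 0 := by
  have : e ⁻¹' {n} = ∅ := by
    ext z'
    simp only [Set.mem_preimage, Set.mem_singleton_iff, Set.mem_empty_iff_false, iff_false]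
    exact fun h => hn ⟨z', h⟩
  rw [diff, mix_comp, this, mix_empty, sub_self]

/-- From a field, the copy used for a perturbation and the copy defining the Stein coefficient,
the field and the last copy. -/
def pair (q : ((E → M) × (E → M)) × (E → M)) : (E → M) × (E → M) := (q.1.1, q.2)

/-- The field and a copy that carries the perturbation in the cell `i`. -/
noncomputable def pairCopy (cell : E → ι) (i : ι) (q : ((E → M) × (E → M)) × (E → M)) :
    (E → M) × (E → M) := (q.1.1, mix cell {i} q.2 q.1.2)

/-- The field perturbed in the cell `i`, and the copy defining the Stein coefficient. -/
noncomputable def pairPert (cell : E → ι) (i : ι) (q : ((E → M) × (E → M)) × (E → M)) :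
    (E → M) × (E → M) := (mix cell {i} q.1.1 q.1.2, q.2)

/-- Perturbing the field in the cell `i` changes a difference in the cell `j` by a second
difference. -/
lemma diff_sub_diff_pert (W : (E → M) → ℝ) {i j : ι} (hij : i ≠ j) {B : Set ι} (hi : i ∉ B)
    (hj : j ∉ B) (q : ((E → M) × (E → M)) × (E → M)) :
    diff cell W j (swap cell B (pair q)) - diff cell W j (swap cell B (pairPert cell i q))
      = diff₂ cell W i j (swap cell B (pairCopy cell i q)) := by
  rw [diff_swap_of_notMem cell W hj, diff_swap_of_notMem cell W hj, diff₂,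
    mix_pair_swap_eq cell hi hj, mix_insert_eq cell hi, mix_insert_eq cell hj]
  simp only [swap, pair, pairPert, pairCopy]
  have h1 : mix cell B q.1.1 (mix cell {i} q.2 q.1.2) = mix cell B q.1.1 q.2 := by
    ext f
    simp only [mix]
    by_cases h : cell f = i
    · simp [h, hi]
    · simp [h]
  have h2 : mix cell (insert j B) q.1.1 (mix cell {i} q.2 q.1.2)
      = mix cell (insert j B) q.1.1 q.2 := by
    ext f
    simp only [mix]
    by_cases h : cell f = i
    · simp [h, hi, hij]
    · simp [h]
  have h3 : mix cell (insert i B) q.1.1 (mix cell {i} q.2 q.1.2)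
      = mix cell B (mix cell {i} q.1.1 q.1.2) q.2 := by
    ext f
    simp only [mix]
    by_cases h : cell f = i
    · simp [h, hi]
    · by_cases h' : cell f ∈ B <;> simp [h, h']
  have h4 : mix cell (insert i (insert j B)) q.1.1 (mix cell {i} q.2 q.1.2)
      = mix cell (insert j B) (mix cell {i} q.1.1 q.1.2) q.2 := by
    ext f
    simp only [mix]
    by_cases h : cell f = i
    · simp [h, hi, hij]
    · by_cases h' : cell f ∈ B <;> by_cases h'' : cell f = j <;> simp [h, h', h'', hij.symm]
  rw [h1, h2, h3, h4]
  ring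

/-- A perturbation in a cell that has already been resampled has no effect. -/
lemma diff_pert_of_mem (W : (E → M) → ℝ) {i j : ι} {B : Set ι} (hi : i ∈ B) (hj : j ∉ B)
    (q : ((E → M) × (E → M)) × (E → M)) :
    diff cell W j (swap cell B (pairPert cell i q)) = diff cell W j (swap cell B (pair q)) := by
  rw [diff_swap_of_notMem cell W hj, diff_swap_of_notMem cell W hj]
  simp only [pair, pairPert]
  have h : ∀ B' : Set ι, B ⊆ B' →
      mix cell B' (mix cell {i} q.1.1 q.1.2) q.2 = mix cell B' q.1.1 q.2 := by
    intro B' hB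
    ext f
    simp only [mix]
    by_cases h : cell f = i
    · simp [h, hB hi]
    · simp [h]
  rw [h B le_rfl, h _ (Set.subset_insert j B)]

section Measure

variable [MeasurableSpace M] {μ : Measure (E → M)}

lemma measurePreserving_pair [IsProbabilityMeasure μ] :
    MeasurePreserving (pair (E := E) (M := M)) ((μ.prod μ).prod μ) (μ.prod μ) :=
  measurePreserving_fst.prod (MeasurePreserving.id μ)

lemma Exchangeable.measurePreserving_pairPert [IsProbabilityMeasure μ]
    (hex : Exchangeable cell μ) (i : ι) :
    MeasurePreserving (pairPert cell i) ((μ.prod μ).prod μ) (μ.prod μ) :=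
  (hex.measurePreserving_mix {i}).prod (MeasurePreserving.id μ)

lemma Exchangeable.measurePreserving_pairCopy [IsProbabilityMeasure μ]
    (hex : Exchangeable cell μ) (i : ι) :
    MeasurePreserving (pairCopy cell i) ((μ.prod μ).prod μ) (μ.prod μ) := by
  have h := (MeasurePreserving.id μ).prod ((hex.measurePreserving_mix {i}).comp
    (Measure.measurePreserving_swap (μ := μ) (ν := μ)))
  exact h.comp (measurePreserving_prodAssoc μ μ μ)

lemma Exchangeable.comp (hex : Exchangeable cell μ) (e : ι → ℕ) : Exchangeable (e ∘ cell) μ :=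
  fun B => hex (e ⁻¹' B)

end Measure

variable (cell e)

/-- The part of the perturbation of the Stein coefficient coming from the first difference. -/
noncomputable def pertFst (W : (E → M) → ℝ) (i j : ι) (q : ((E → M) × (E → M)) × (E → M)) :
    ℝ≥0∞ :=
  ‖diff₂ cell W i j (pairCopy cell i q)‖ₑ * ‖diff cell W j (swap cell (lower e j) (pair q))‖ₑ

open Classical in
/-- The part of the perturbation of the Stein coefficient coming from the second difference. -/
noncomputable def pertSnd (W : (E → M) → ℝ) (i j : ι) (q : ((E → M) × (E → M)) × (E → M)) :
    ℝ≥0∞ :=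
  if i ∈ lower e j then 0 else
    ‖diff₂ cell W i j (swap cell (lower e j) (pairCopy cell i q))‖ₑ
      * ‖diff cell W j (pairPert cell i q)‖ₑ

variable {cell e}

/-- Effect on the Stein coefficient of a perturbation of the field in one cell, by the product rule
in each of the other cells. -/
lemma enorm_steinCoeff_sub_le (he : Function.Injective e) {ψ : ℝ → ℝ}
    (hψ0 : ∀ x, |ψ x| ≤ |x|) (hψ : ∀ x y, |ψ x - ψ y| ≤ |x - y|) (W : (E → M) → ℝ) (n : ℕ) (i : ι)
    (q : ((E → M) × (E → M)) × (E → M)) [DecidableEq ι] :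
    ‖steinCoeff (e ∘ cell) ψ W n (pair q) - steinCoeff (e ∘ cell) ψ W n (pairPert cell i q)‖ₑ
      ≤ ‖diff cell W i (pair q)‖ₑ * ‖diff cell W i (swap cell (lower e i) (pair q))‖ₑ
        + ‖diff cell W i (pairPert cell i q)‖ₑ
          * ‖diff cell W i (swap cell (lower e i) (pairPert cell i q))‖ₑ
        + (∑' j, if i = j then 0 else pertFst cell e W i j q)
        + ∑' j, if i = j then 0 else pertSnd cell e W i j q := by
  set t : ι → (E → M) × (E → M) → ℝ := fun j p =>
    diff cell W j p * ψ (diff cell W j (swap cell (lower e j) p)) with ht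
  have hψ0' : ∀ x, ‖ψ x‖ₑ ≤ ‖x‖ₑ := fun x => enorm_le_iff_norm_le.2 (hψ0 x)
  have h1 : ‖steinCoeff (e ∘ cell) ψ W n (pair q)
      - steinCoeff (e ∘ cell) ψ W n (pairPert cell i q)‖ₑ
      ≤ ∑' j, ‖t j (pair q) - t j (pairPert cell i q)‖ₑ := by
    rw [steinCoeff, steinCoeff, ← mul_sub, ← Finset.sum_sub_distrib, enorm_mul]
    have h12 : ‖(1 / 2 : ℝ)‖ₑ ≤ 1 := by
      rw [Real.enorm_eq_ofReal_abs]
      exact ENNReal.ofReal_le_one.2 (by norm_num)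
    refine (mul_le_of_le_one_left (zero_le) h12).trans ?_
    refine (enorm_sum_le _ _).trans ?_
    refine (ENNReal.sum_le_tsum _).trans (le_of_eq ?_)
    rw [tsum_eq_tsum_comp he]
    · refine tsum_congr fun j => ?_
      simp only [ht, diff_comp he, swap_comp]
      rfl
    · intro m hm
      simp [diff_comp_of_notMem W hm]
  refine h1.trans ?_
  have h2 : ∀ j, ‖t j (pair q) - t j (pairPert cell i q)‖ₑ
      ≤ (if i = j then ‖diff cell W i (pair q)‖ₑ
            * ‖diff cell W i (swap cell (lower e i) (pair q))‖ₑ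
          + ‖diff cell W i (pairPert cell i q)‖ₑ
            * ‖diff cell W i (swap cell (lower e i) (pairPert cell i q))‖ₑ else 0)
        + (if i = j then 0 else pertFst cell e W i j q)
        + if i = j then 0 else pertSnd cell e W i j q := by
    intro j
    by_cases hij : i = j
    · subst hij
      simp only [if_true, add_zero]
      refine (enorm_sub_le).trans ?_
      simp only [ht, enorm_mul]
      gcongr <;> exact hψ0' _
    · simp only [if_neg hij, zero_add]
      have e1 : t j (pair q) - t j (pairPert cell i q)
          = (diff cell W j (pair q) - diff cell W j (pairPert cell i q))
              * ψ (diff cell W j (swap cell (lower e j) (pair q)))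
            + (ψ (diff cell W j (swap cell (lower e j) (pair q)))
                - ψ (diff cell W j (swap cell (lower e j) (pairPert cell i q))))
              * diff cell W j (pairPert cell i q) := by
        simp only [ht]; ring
      have e2 : diff cell W j (pair q) - diff cell W j (pairPert cell i q)
          = diff₂ cell W i j (pairCopy cell i q) := by
        have h := diff_sub_diff_pert (cell := cell) W hij (B := ∅) (by simp) (by simp) q
        have hs : ∀ p : (E → M) × (E → M), swap cell ∅ p = p := fun p => by simp [swap]
        simpa [hs] using h
      rw [e1]
      refine (enorm_add_le _ _).trans (add_le_add ?_ ?_)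
      · rw [enorm_mul, e2, pertFst]
        gcongr
        exact hψ0' _
      · rw [enorm_mul, pertSnd]
        by_cases hl : i ∈ lower e j
        · rw [diff_pert_of_mem W hl (notMem_lower_self e j), sub_self]
          simp
        · rw [if_neg hl]
          gcongr
          rw [← diff_sub_diff_pert W hij hl (notMem_lower_self e j)]
          exact enorm_le_iff_norm_le.2 (hψ _ _)
  refine (ENNReal.tsum_le_tsum h2).trans (le_of_eq ?_)
  rw [ENNReal.tsum_add, ENNReal.tsum_add]
  congr 2
  exact tsum_ite_eq' i _

lemma tsum_sq_eq {α : Type*} (a : α → ℝ≥0∞) : (∑' j, a j) ^ 2 = ∑' j, ∑' k, a j * a k := by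
  rw [pow_two, ← ENNReal.tsum_mul_right]
  simp_rw [ENNReal.tsum_mul_left]

section Measure

variable [MeasurableSpace M] {μ : Measure (E → M)}

@[fun_prop]
lemma measurable_pair : Measurable (pair (E := E) (M := M)) := by unfold pair; fun_prop

@[fun_prop]
lemma measurable_pairCopy (i : ι) : Measurable (pairCopy (M := M) cell i) := by
  unfold pairCopy; fun_prop

@[fun_prop]
lemma measurable_pairPert (i : ι) : Measurable (pairPert (M := M) cell i) := by
  unfold pairPert; fun_prop

lemma measurable_pertFst {W : (E → M) → ℝ} (hW : Measurable W) (i j : ι) :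
    Measurable (pertFst cell e W i j) := by
  have := measurable_diff₂ (c := cell) hW i j
  have := measurable_diff (c := cell) hW j
  unfold pertFst; fun_prop

lemma measurable_pertSnd {W : (E → M) → ℝ} (hW : Measurable W) (i j : ι) :
    Measurable (pertSnd cell e W i j) := by
  have := measurable_diff₂ (c := cell) hW i j
  have := measurable_diff (c := cell) hW j
  unfold pertSnd
  by_cases h : i ∈ lower e j
  · simp only [h, if_true]; fun_prop
  · simp only [h, if_false]; fun_prop

lemma sq_mul_sq_le (a b : ℝ≥0∞) : (a * b) ^ 2 ≤ a ^ 4 + b ^ 4 := by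
  rcases le_total a b with h | h
  · calc (a * b) ^ 2 ≤ (b * b) ^ 2 := by gcongr
      _ = b ^ 4 := by ring
      _ ≤ _ := le_add_self
  · calc (a * b) ^ 2 ≤ (a * a) ^ 2 := by gcongr
      _ = a ^ 4 := by ring
      _ ≤ _ := le_self_add

/-- The contribution to the fluctuation of the term of the Stein coefficient that belongs to the
perturbed cell. -/
lemma Exchangeable.lintegral_diag_le (hex : Exchangeable cell μ) {W : (E → M) → ℝ}
    (hW : Measurable W) (i : ι) (B : Set ι) {T : ((E → M) × (E → M)) × (E → M) → (E → M) × (E → M)}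
    (hT : MeasurePreserving T ((μ.prod μ).prod μ) (μ.prod μ)) :
    ∫⁻ q, (‖diff cell W i (T q)‖ₑ * ‖diff cell W i (swap cell B (T q))‖ₑ) ^ 2
        ∂((μ.prod μ).prod μ) ≤ 2 * ∫⁻ p, ‖diff cell W i p‖ₑ ^ 4 ∂(μ.prod μ) := by
  have hm := measurable_diff (c := cell) hW i
  rw [hT.lintegral_comp (f := fun p => (‖diff cell W i p‖ₑ * ‖diff cell W i (swap cell B p)‖ₑ) ^ 2)
    (by fun_prop)]
  refine (lintegral_mono fun p => sq_mul_sq_le _ _).trans ?_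
  rw [lintegral_add_left (by fun_prop),
    hex.lintegral_swap B (fun p => ‖diff cell W i p‖ₑ ^ 4), two_mul]

/-- The fluctuation of the Stein coefficient is controlled by bounds on the integrals of products
of two of its perturbations, according to whether the two cells coincide. -/
theorem Exchangeable.fluctuation_le [IsProbabilityMeasure μ] [Countable ι]
    (hex : Exchangeable cell μ) (he : Function.Injective e) {W : (E → M) → ℝ} (hW : Measurable W)
    {ψ : ℝ → ℝ} (hψ0 : ∀ x, |ψ x| ≤ |x|) (hψ : ∀ x y, |ψ x - ψ y| ≤ |x - y|)
    {b₂ : ι → ι → ℝ≥0∞} {b₃ : ι → ι → ι → ℝ≥0∞}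
    (h2F : ∀ i j, i ≠ j → ∫⁻ q, pertFst cell e W i j q * pertFst cell e W i j q
      ∂((μ.prod μ).prod μ) ≤ b₂ i j)
    (h2S : ∀ i j, i ≠ j → ∫⁻ q, pertSnd cell e W i j q * pertSnd cell e W i j q
      ∂((μ.prod μ).prod μ) ≤ b₂ i j)
    (h3F : ∀ i j k, i ≠ j → i ≠ k → j ≠ k →
      ∫⁻ q, pertFst cell e W i j q * pertFst cell e W i k q ∂((μ.prod μ).prod μ) ≤ b₃ i j k)
    (h3S : ∀ i j k, i ≠ j → i ≠ k → j ≠ k →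
      ∫⁻ q, pertSnd cell e W i j q * pertSnd cell e W i k q ∂((μ.prod μ).prod μ) ≤ b₃ i j k)
    (n : ℕ) :
    fluctuation (e ∘ cell) μ ψ W n ≤ 32 * ((∑' i, ∫⁻ p, ‖diff cell W i p‖ₑ ^ 4 ∂(μ.prod μ))
      + (∑' i, ∑' j, b₂ i j) + ∑' i, ∑' j, ∑' k, b₃ i j k) := by
  classical
  have hdm := fun j => measurable_diff (c := cell) hW j
  rw [fluctuation, tsum_eq_tsum_comp he]
  swap
  · intro m hm
    have hz : e ⁻¹' {m} = ∅ := by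
      ext z'
      simp only [Set.mem_preimage, Set.mem_singleton_iff, Set.mem_empty_iff_false, iff_false]
      exact fun h => hm ⟨z', h⟩
    simp [mix_comp, hz]
  have hcell : ∀ i, ∫⁻ q, ‖steinCoeff (e ∘ cell) ψ W n (q.1.1, q.2)
      - steinCoeff (e ∘ cell) ψ W n (mix (e ∘ cell) {e i} q.1.1 q.1.2, q.2)‖ₑ ^ 2
        ∂((μ.prod μ).prod μ)
      ≤ 32 * ((∫⁻ p, ‖diff cell W i p‖ₑ ^ 4 ∂(μ.prod μ)) + (∑' j, b₂ i j)
          + ∑' j, ∑' k, b₃ i j k) := by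
    intro i
    have hpre : e ⁻¹' {e i} = {i} := by ext z'; simp [he.eq_iff]
    simp_rw [mix_comp, hpre]
    have hsq : ∀ (f : ι → ι → ((E → M) × (E → M)) × (E → M) → ℝ≥0∞), (∀ i j, Measurable (f i j)) →
        (∀ i j, i ≠ j → ∫⁻ q, f i j q * f i j q ∂((μ.prod μ).prod μ) ≤ b₂ i j) →
        (∀ i j k, i ≠ j → i ≠ k → j ≠ k →
          ∫⁻ q, f i j q * f i k q ∂((μ.prod μ).prod μ) ≤ b₃ i j k) →
        ∫⁻ q, (∑' j, if i = j then 0 else f i j q) ^ 2 ∂((μ.prod μ).prod μ)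
          ≤ (∑' j, b₂ i j) + ∑' j, ∑' k, b₃ i j k := by
      intro f hf h2 h3
      have hm : ∀ j, Measurable fun q => if i = j then 0 else f i j q := by
        intro j
        by_cases h : i = j
        · simp [h]
        · simp [h, hf i j]
      have hmk : ∀ j k, Measurable fun q =>
          (if i = j then 0 else f i j q) * (if i = k then 0 else f i k q) :=
        fun j k => (hm j).mul (hm k)
      simp_rw [tsum_sq_eq]
      rw [lintegral_tsum fun j => (Measurable.tsum fun k => hmk j k).aemeasurable]
      rw [← ENNReal.tsum_add]
      refine ENNReal.tsum_le_tsum fun j => ?_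
      rw [lintegral_tsum fun k => (hmk j k).aemeasurable]
      calc ∑' k, ∫⁻ q, (if i = j then 0 else f i j q) * (if i = k then 0 else f i k q)
            ∂((μ.prod μ).prod μ)
          ≤ ∑' k, ((if k = j then b₂ i j else 0) + b₃ i j k) := by
            refine ENNReal.tsum_le_tsum fun k => ?_
            by_cases hij : i = j
            · simp [hij]
            by_cases hik : i = k
            · simp [hik]
            by_cases hjk : k = j
            · subst hjk
              simp only [if_neg hij, if_true]
              exact (h2 i k hij).trans le_self_add
            · simp only [if_neg hij, if_neg hik, if_neg hjk, zero_add]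
              exact h3 i j k hij hik (Ne.symm hjk)
        _ = b₂ i j + ∑' k, b₃ i j k := by rw [ENNReal.tsum_add, tsum_ite_eq]
    have hF := hsq _ (fun i j => measurable_pertFst (e := e) hW i j) h2F h3F
    have hS := hsq _ (fun i j => measurable_pertSnd (e := e) hW i j) h2S h3S
    have hD1 := hex.lintegral_diag_le hW i (lower e i) measurePreserving_pair
    have hD2 := hex.lintegral_diag_le hW i (lower e i) (hex.measurePreserving_pairPert i)
    have hmF : Measurable fun q => ∑' j, if i = j then 0 else pertFst cell e W i j q := by
      refine Measurable.tsum fun j => ?_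
      by_cases h : i = j
      · simp [h]
      · simp [h, measurable_pertFst hW i j]
    have hmS : Measurable fun q => ∑' j, if i = j then 0 else pertSnd cell e W i j q := by
      refine Measurable.tsum fun j => ?_
      by_cases h : i = j
      · simp [h]
      · simp [h, measurable_pertSnd hW i j]
    have hpt : ∀ q : ((E → M) × (E → M)) × (E → M), _ := fun q =>
      (pow_le_pow_left' (enorm_steinCoeff_sub_le (cell := cell) he hψ0 hψ W n i q) 2).trans
        (add_add_add_sq_le _ _ _ _)
    refine (lintegral_mono hpt).trans ?_
    have := hdm i
    rw [lintegral_const_mul' _ _ (by norm_num), lintegral_add_left (by fun_prop),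
      lintegral_add_left (by fun_prop), lintegral_add_left (by fun_prop)]
    calc _ ≤ 8 * (2 * (∫⁻ p, ‖diff cell W i p‖ₑ ^ 4 ∂(μ.prod μ))
          + 2 * (∫⁻ p, ‖diff cell W i p‖ₑ ^ 4 ∂(μ.prod μ))
          + ((∑' j, b₂ i j) + ∑' j, ∑' k, b₃ i j k)
          + ((∑' j, b₂ i j) + ∑' j, ∑' k, b₃ i j k)) := by gcongr
      _ = 32 * (∫⁻ p, ‖diff cell W i p‖ₑ ^ 4 ∂(μ.prod μ)) + 16 * (∑' j, b₂ i j)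
          + 16 * ∑' j, ∑' k, b₃ i j k := by ring
      _ ≤ 32 * (∫⁻ p, ‖diff cell W i p‖ₑ ^ 4 ∂(μ.prod μ)) + 32 * (∑' j, b₂ i j)
          + 32 * ∑' j, ∑' k, b₃ i j k := by gcongr <;> norm_num
      _ = _ := by ring
  refine (ENNReal.tsum_le_tsum hcell).trans (le_of_eq ?_)
  rw [ENNReal.tsum_mul_left, ENNReal.tsum_add, ENNReal.tsum_add]

lemma thirdMoment_comp (he : Function.Injective e) (w : (E → M) → ℝ≥0∞) (W : (E → M) → ℝ) :
    thirdMoment (e ∘ cell) μ w W = ∑' z, ∫⁻ p, w p.1 * (‖diff cell W z p‖ₑ ^ 2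
      * ‖diff cell W z (swap cell (lower e z) p)‖ₑ) ∂(μ.prod μ) := by
  rw [thirdMoment, tsum_eq_tsum_comp he]
  · refine tsum_congr fun z => ?_
    simp only [diff_comp he, swap_comp]
    rfl
  · intro m hm
    simp [diff_comp_of_notMem W hm]

end Measure

end Resampling

/-! ### Hölder estimates over layers and independence of local events -/

namespace Resampling

/-- Hölder's inequality layer by layer: a product of `m` functions supported in a countable union of
sets `s k` is integrated over each of them with weight `ν (s k) ^ θ`. -/
theorem lintegral_prod_le_tsum {α κ : Type*} [MeasurableSpace α] {ν : Measure α} [Countable κ]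
    {m : ℕ} (hm : 0 < m) {F : Fin m → α → ℝ≥0∞} (hF : ∀ n, Measurable (F n)) {s : κ → Set α}
    (hs : ∀ k, MeasurableSet (s k)) (hcov : ∀ᵐ q ∂ν, (∀ n, F n q ≠ 0) → ∃ k, q ∈ s k)
    {θ : ℝ} (hθ : θ ∈ Set.Ioo (0 : ℝ) 1) {P : κ → ℝ≥0∞} (hP : ∀ k, ν (s k) ≤ P k)
    {K : Fin m → κ → ℝ≥0∞} (hK : ∀ n k, ∫⁻ q in s k, F n q ^ (m / (1 - θ)) ∂ν ≤ K n k) :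
    ∫⁻ q, ∏ n, F n q ∂ν ≤ ∑' k, P k ^ θ * ∏ n, K n k ^ ((1 - θ) / m) := by
  have hm' : (0 : ℝ) < m := by exact_mod_cast hm
  have h1θ : 0 < 1 - θ := sub_pos.2 hθ.2
  have hmp : Measurable fun q => ∏ n, F n q := Finset.measurable_fun_prod _ fun n _ => hF n
  calc ∫⁻ q, ∏ n, F n q ∂ν ≤ ∫⁻ q, ∑' k, (s k).indicator (fun q => ∏ n, F n q) q ∂ν := by
        refine lintegral_mono_ae (hcov.mono fun q hq => ?_)
        by_cases h : ∀ n, F n q ≠ 0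
        · obtain ⟨k, hk⟩ := hq h
          refine le_trans (le_of_eq ?_) (ENNReal.le_tsum k)
          rw [Set.indicator_of_mem hk]
        · push Not at h
          obtain ⟨n, hn⟩ := h
          rw [Finset.prod_eq_zero (Finset.mem_univ n) hn]
          exact zero_le
    _ = ∑' k, ∫⁻ q in s k, ∏ n, F n q ∂ν := by
        rw [lintegral_tsum fun k => (hmp.indicator (hs k)).aemeasurable]
        exact tsum_congr fun k => lintegral_indicator (hs k) _
    _ ≤ ∑' k, P k ^ θ * ∏ n, K n k ^ ((1 - θ) / m) := by
        refine ENNReal.tsum_le_tsum fun k => ?_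
        set f : Option (Fin m) → α → ℝ≥0∞ := fun o => o.elim (fun _ => 1)
          fun n q => F n q ^ ((m : ℝ) / (1 - θ)) with hf
        set p : Option (Fin m) → ℝ := fun o => o.elim θ fun _ => (1 - θ) / m with hp
        have h := ENNReal.lintegral_prod_norm_pow_le (μ := ν.restrict (s k)) Finset.univ (f := f)
          (p := p) ?_ ?_ ?_
        · simp only [Fintype.prod_option, hf, hp, Option.elim_none, Option.elim_some,
            ENNReal.one_rpow, one_mul, lintegral_const, Measure.restrict_apply_univ] at h
          have hpow : ∀ n q, (F n q ^ ((m : ℝ) / (1 - θ))) ^ ((1 - θ) / m) = F n q := by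
            intro n q
            rw [← ENNReal.rpow_mul, div_mul_div_cancel₀ h1θ.ne', div_self hm'.ne',
              ENNReal.rpow_one]
          simp only [hpow] at h
          refine h.trans ?_
          gcongr with n
          · exact hθ.1.le
          · exact hP k
          · exact hK n k
        · intro o _
          cases o with
          | none => exact aemeasurable_const
          | some n => exact ((hF n).pow_const _).aemeasurable
        · simp only [Fintype.sum_option, hp, Option.elim_none, Option.elim_some, Finset.sum_const,
            Finset.card_univ, Fintype.card_fin, nsmul_eq_mul]
          field_simp
          ring
        · intro o _
          cases o with
          | none => exact hθ.1.le
          | some n => exact div_nonneg h1θ.le hm'.le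

variable {ι E M : Type*}

/-- Agreement of two pairs of fields in the cells indexed by `B`. -/
def AgreeOn (cell : E → ι) (B : Set ι) (p p' : (E → M) × (E → M)) : Prop :=
  ∀ f, cell f ∈ B → p.1 f = p'.1 f ∧ p.2 f = p'.2 f

variable {cell : E → ι} [MeasurableSpace M] {μ : Measure (E → M)}

/-- The restrictions of a pair of fields to complementary sets of cells are independent. -/
theorem Exchangeable.measure_inter_eq_mul [IsProbabilityMeasure μ] (hex : Exchangeable cell μ)
    (B : Set ι) {U V : Set ((E → M) × (E → M))} (hU : MeasurableSet U) (hV : MeasurableSet V)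
    (hUl : ∀ p p', AgreeOn cell B p p' → (p ∈ U ↔ p' ∈ U))
    (hVl : ∀ p p', AgreeOn cell Bᶜ p p' → (p ∈ V ↔ p' ∈ V)) :
    (μ.prod μ) (U ∩ V) = (μ.prod μ) U * (μ.prod μ) V := by
  set Φ : ((E → M) × (E → M)) × ((E → M) × (E → M)) → (E → M) × (E → M) :=
    fun r => (mix cell B r.1.1 r.2.1, mix cell B r.1.2 r.2.2) with hΦ
  have hmp : MeasurePreserving Φ ((μ.prod μ).prod (μ.prod μ)) (μ.prod μ) :=
    ((hex.measurePreserving_mix B).prod (hex.measurePreserving_mix B)).comp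
      (measurePreserving_prodProdProdComm μ μ μ μ)
  have hpre : Φ ⁻¹' (U ∩ V) = V ×ˢ U := by
    ext r
    have h1 : Φ r ∈ U ↔ r.2 ∈ U := hUl _ _ fun f hf => by
      simp only [hΦ]; exact ⟨mix_of_mem hf, mix_of_mem hf⟩
    have h2 : Φ r ∈ V ↔ r.1 ∈ V := hVl _ _ fun f hf => by
      simp only [hΦ]; exact ⟨mix_of_notMem hf, mix_of_notMem hf⟩
    simp only [Set.mem_preimage, Set.mem_inter_iff, Set.mem_prod, h1, h2, and_comm]
  rw [← hmp.measure_preimage (hU.inter hV).nullMeasurableSet, hpre, Measure.prod_prod, mul_comm]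

end Resampling

/-! ### Systems of layers and products of differences -/

namespace Resampling

variable {ι E M : Type*}

/-- The layer of the cell `j` along a perturbation of the field in the cell `i`: the largest layer
over the three pairs of fields that enter the perturbation of the Stein coefficient. -/
noncomputable def layer (cell : E → ι) (L : ι → (E → M) × (E → M) → ℕ) (i j : ι)
    (q : ((E → M) × (E → M)) × (E → M)) : ℕ :=
  max (max (L j (pairCopy cell i q)) (L j (pair q))) (L j (pairPert cell i q))

/-- Each layer depends only on the restriction of the pair of fields to its cell. -/
def IsLocal (cell : E → ι) (L : ι → (E → M) × (E → M) → ℕ) : Prop :=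
  ∀ j p p', AgreeOn cell {j} p p' → L j p = L j p'

/-- The three pairs of fields agree in the cell `j`, so their local layers coincide. -/
lemma layer_eq_of_isLocal {cell : E → ι} {L : ι → (E → M) × (E → M) → ℕ}
    (hloc : IsLocal cell L) {i j : ι} (hij : i ≠ j)
    (q : ((E → M) × (E → M)) × (E → M)) : layer cell L i j q = L j (pairCopy cell i q) := by
  have h1 : L j (pair q) = L j (pairCopy cell i q) := hloc j _ _ fun f hf => by
    have : cell f ∉ ({i} : Set ι) := by rw [Set.mem_singleton_iff.1 hf]; simpa using hij.symm
    simp [pair, pairCopy, mix_of_notMem this]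
  have h2 : L j (pairPert cell i q) = L j (pairCopy cell i q) := hloc j _ _ fun f hf => by
    have : cell f ∉ ({i} : Set ι) := by rw [Set.mem_singleton_iff.1 hf]; simpa using hij.symm
    simp [pairPert, pairCopy, mix_of_notMem this]
  simp [layer, h1, h2]

variable [MeasurableSpace M]

/-- A system of layers for the differences of `F`: the value of `L j` is the scale at which the
field feels its resampling in the cell `j`, with the value `0` if there is no effect, and `π j ℓ`
bounds the probability of the scale `ℓ`. On the event that `L j` is at most `ℓ` the moments of the
differences, whatever the other cells that are resampled, are bounded by `M₁` and `M₂`. -/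
structure LayerBounds (cell : E → ι) (μ : Measure (E → M)) (F : (E → M) → ℝ)
    (L : ι → (E → M) × (E → M) → ℕ) (π : ι → ℕ+ → ℝ≥0∞) (M₁ : ℝ → ℕ+ → ι → ℝ≥0∞)
    (M₂ : ℝ → ℕ+ → ι → ℕ+ → ι → ℝ≥0∞) : Prop where
  measurable : ∀ j, Measurable (L j)
  diff_eq_zero : ∀ j B, j ∉ B → ∀ᵐ p ∂(μ.prod μ), L j p = 0 → diff cell F j (swap cell B p) = 0
  diff₂_eq_zero : ∀ i j B, i ≠ j → i ∉ B → j ∉ B →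
    ∀ᵐ p ∂(μ.prod μ), (L i p = 0 ∨ L j p = 0) → diff₂ cell F i j (swap cell B p) = 0
  lintegral_diff_le : ∀ r : ℝ, 0 < r → ∀ (ℓ : ℕ+) j B, j ∉ B →
    ∫⁻ p in {p | L j p ≤ ℓ}, ‖diff cell F j (swap cell B p)‖ₑ ^ r ∂(μ.prod μ) ≤ M₁ r ℓ j
  lintegral_diff₂_le : ∀ r : ℝ, 0 < r → ∀ (ℓ : ℕ+) i (ℓ' : ℕ+) j B, i ≠ j → i ∉ B → j ∉ B →
    ∫⁻ p in {p | L i p ≤ ℓ ∧ L j p ≤ ℓ'}, ‖diff₂ cell F i j (swap cell B p)‖ₑ ^ r ∂(μ.prod μ)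
      ≤ M₂ r ℓ i ℓ' j
  measure_le : ∀ j (ℓ : ℕ+), (μ.prod μ) {p | L j p = ℓ} ≤ π j ℓ

variable {cell : E → ι} {μ : Measure (E → M)} {F : (E → M) → ℝ}
  {L : ι → (E → M) × (E → M) → ℕ} {π : ι → ℕ+ → ℝ≥0∞} {M₁ : ℝ → ℕ+ → ι → ℝ≥0∞}
  {M₂ : ℝ → ℕ+ → ι → ℕ+ → ι → ℝ≥0∞}

namespace LayerBounds

@[fun_prop]
lemma measurable_layer (h : LayerBounds cell μ F L π M₁ M₂) (i j : ι) :
    Measurable (layer cell L i j) := by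
  have := h.measurable j
  unfold layer; fun_prop

/-- A product of `m` differences in the same cell, by Hölder's inequality on each level set of the
layer. -/
lemma lintegral_prod_diff_le (h : LayerBounds cell μ F L π M₁ M₂) (hF : Measurable F) {m : ℕ}
    (hm : 0 < m) (j : ι) {B : Fin m → Set ι} (hB : ∀ n, j ∉ B n) {θ : ℝ}
    (hθ : θ ∈ Set.Ioo (0 : ℝ) 1) :
    ∫⁻ p, ∏ n, ‖diff cell F j (swap cell (B n) p)‖ₑ ∂(μ.prod μ)
      ≤ ∑' ℓ : ℕ+, π j ℓ ^ θ * M₁ (m / (1 - θ)) ℓ j ^ (1 - θ) := by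
  have hm' : (0 : ℝ) < m := by exact_mod_cast hm
  have h1θ : 0 < 1 - θ := sub_pos.2 hθ.2
  have hdm := measurable_diff (c := cell) hF j
  have hLm := h.measurable j
  refine (lintegral_prod_le_tsum hm (F := fun n p => ‖diff cell F j (swap cell (B n) p)‖ₑ)
    (s := fun ℓ : ℕ+ => {p | L j p = ℓ}) (fun n => by fun_prop)
    (fun ℓ => hLm (measurableSet_singleton _)) ?_ hθ (h.measure_le j)
    (K := fun _ ℓ => M₁ (m / (1 - θ)) ℓ j) fun n ℓ => ?_).trans (le_of_eq ?_)
  · filter_upwards [h.diff_eq_zero j _ (hB ⟨0, hm⟩)] with p hp hne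
    have h0 : L j p ≠ 0 := fun h0 => hne ⟨0, hm⟩ (by simp [hp h0])
    exact ⟨⟨L j p, Nat.pos_of_ne_zero h0⟩, rfl⟩
  · refine (lintegral_mono_set ?_).trans
      (h.lintegral_diff_le (m / (1 - θ)) (div_pos hm' h1θ) ℓ j (B n) (hB n))
    exact fun p (hp : L j p = ℓ) => hp.le
  · refine tsum_congr fun ℓ => ?_
    rw [Finset.prod_const, Finset.card_univ, Fintype.card_fin, ← ENNReal.rpow_natCast,
      ← ENNReal.rpow_mul, div_mul_cancel₀ _ hm'.ne']

/-- First differences along any of the pairs of fields. -/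
lemma setLIntegral_diff_le (h : LayerBounds cell μ F L π M₁ M₂)
    (hF : Measurable F) {r : ℝ} (hr : 0 < r) {j : ι} {B : Set ι}
    (hj : j ∉ B) (ℓ : ℕ+) {T : ((E → M) × (E → M)) × (E → M) → (E → M) × (E → M)}
    (hT : MeasurePreserving T ((μ.prod μ).prod μ) (μ.prod μ))
    {s : Set (((E → M) × (E → M)) × (E → M))} (hs : ∀ q ∈ s, L j (T q) ≤ ℓ) :
    ∫⁻ q in s, ‖diff cell F j (swap cell B (T q))‖ₑ ^ r ∂((μ.prod μ).prod μ) ≤ M₁ r ℓ j := by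
  have hdm := measurable_diff (c := cell) hF j
  have hj' := h.measurable j
  refine (lintegral_mono_set (show s ⊆ T ⁻¹' {p | L j p ≤ ℓ} from hs)).trans ?_
  rw [hT.setLIntegral_comp_preimage (measurableSet_le hj' measurable_const)
    (f := fun p => ‖diff cell F j (swap cell B p)‖ₑ ^ r) (by fun_prop)]
  exact h.lintegral_diff_le r hr ℓ j B hj

lemma three_mul_rpow_le (w : ℝ≥0∞) {θ : ℝ} (hθ : θ ∈ Set.Ioo (0 : ℝ) 1) :
    (3 * w) ^ θ ≤ 3 * w ^ θ := by
  rw [ENNReal.mul_rpow_of_nonneg _ _ hθ.1.le]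
  gcongr
  calc (3 : ℝ≥0∞) ^ θ ≤ 3 ^ (1 : ℝ) := ENNReal.rpow_le_rpow_of_exponent_le (by norm_num) hθ.2.le
    _ = 3 := ENNReal.rpow_one _

variable [IsProbabilityMeasure μ]

/-- Second differences along the copy that carries the perturbation. -/
lemma setLIntegral_diff₂_le (h : LayerBounds cell μ F L π M₁ M₂) (hex : Exchangeable cell μ)
    (hF : Measurable F) {r : ℝ} (hr : 0 < r) {i j : ι} (hij : i ≠ j) {B : Set ι} (hi : i ∉ B)
    (hj : j ∉ B) (ℓ ℓ' : ℕ+) {s : Set (((E → M) × (E → M)) × (E → M))}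
    (hs : ∀ q ∈ s, L i (pairCopy cell i q) ≤ ℓ ∧ L j (pairCopy cell i q) ≤ ℓ') :
    ∫⁻ q in s, ‖diff₂ cell F i j (swap cell B (pairCopy cell i q))‖ₑ ^ r ∂((μ.prod μ).prod μ)
      ≤ M₂ r ℓ i ℓ' j := by
  have hdm := measurable_diff₂ (c := cell) hF i j
  have hset : MeasurableSet {p | L i p ≤ ℓ ∧ L j p ≤ ℓ'} :=
    (measurableSet_le (h.measurable i) measurable_const).inter
      (measurableSet_le (h.measurable j) measurable_const)
  refine (lintegral_mono_set (show s ⊆ pairCopy cell i ⁻¹' {p | L i p ≤ ℓ ∧ L j p ≤ ℓ'}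
    from hs)).trans ?_
  rw [(hex.measurePreserving_pairCopy i).setLIntegral_comp_preimage hset
    (f := fun p => ‖diff₂ cell F i j (swap cell B p)‖ₑ ^ r) (by fun_prop)]
  exact h.lintegral_diff₂_le r hr ℓ i ℓ' j B hij hi hj

/-- Products of two perturbations of the Stein coefficient in three distinct cells. -/
lemma lintegral_mul₃_le (h : LayerBounds cell μ F L π M₁ M₂) (hex : Exchangeable cell μ)
    (hF : Measurable F) {i j k : ι} (hij : i ≠ j) (hik : i ≠ k)
    {Bj Bj' Bk Bk' : Set ι} (hiBj : i ∉ Bj) (hiBk : i ∉ Bk) (hj : j ∉ Bj) (hj' : j ∉ Bj')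
    (hk : k ∉ Bk) (hk' : k ∉ Bk') {T : ((E → M) × (E → M)) × (E → M) → (E → M) × (E → M)}
    (hT : MeasurePreserving T ((μ.prod μ).prod μ) (μ.prod μ))
    (hTl : ∀ j q, L j (T q) ≤ layer cell L i j q) {w : ℕ+ → ℕ+ → ℕ+ → ℝ≥0∞}
    (hw : ∀ ℓ ℓ' ℓ'' : ℕ+, ((μ.prod μ).prod μ) {q | L i (pairCopy cell i q) = ℓ ∧
      layer cell L i j q = ℓ' ∧ layer cell L i k q = ℓ''} ≤ 3 * w ℓ ℓ' ℓ'') {θ : ℝ}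
    (hθ : θ ∈ Set.Ioo (0 : ℝ) 1) :
    ∫⁻ q, (‖diff₂ cell F i j (swap cell Bj (pairCopy cell i q))‖ₑ
        * ‖diff cell F j (swap cell Bj' (T q))‖ₑ)
      * (‖diff₂ cell F i k (swap cell Bk (pairCopy cell i q))‖ₑ
        * ‖diff cell F k (swap cell Bk' (T q))‖ₑ) ∂((μ.prod μ).prod μ)
      ≤ 3 * ∑' (ℓ : ℕ+) (ℓ' : ℕ+) (ℓ'' : ℕ+), w ℓ ℓ' ℓ'' ^ θ
          * M₂ (4 / (1 - θ)) ℓ i ℓ' j ^ ((1 - θ) / 4) * M₂ (4 / (1 - θ)) ℓ i ℓ'' k ^ ((1 - θ) / 4)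
          * M₁ (4 / (1 - θ)) ℓ' j ^ ((1 - θ) / 4) * M₁ (4 / (1 - θ)) ℓ'' k ^ ((1 - θ) / 4) := by
  have hr : 0 < 4 / (1 - θ) := div_pos four_pos (sub_pos.2 hθ.2)
  have hdm := fun j => measurable_diff (c := cell) hF j
  have hdm2 := fun j => measurable_diff₂ (c := cell) hF i j
  have hTm := hT.measurable
  have hLm := h.measurable
  have hC := hex.measurePreserving_pairCopy (μ := μ) i
  set G : Fin 4 → ((E → M) × (E → M)) × (E → M) → ℝ≥0∞ :=
    ![fun q => ‖diff₂ cell F i j (swap cell Bj (pairCopy cell i q))‖ₑ,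
      fun q => ‖diff₂ cell F i k (swap cell Bk (pairCopy cell i q))‖ₑ,
      fun q => ‖diff cell F j (swap cell Bj' (T q))‖ₑ,
      fun q => ‖diff cell F k (swap cell Bk' (T q))‖ₑ] with hG
  set s : ℕ+ × ℕ+ × ℕ+ → Set (((E → M) × (E → M)) × (E → M)) := fun κ =>
    {q | L i (pairCopy cell i q) = κ.1 ∧ layer cell L i j q = κ.2.1 ∧
      layer cell L i k q = κ.2.2} with hs
  have hmain := lintegral_prod_le_tsum (ν := (μ.prod μ).prod μ) (m := 4) (by norm_num) (F := G)
    (s := s) (P := fun κ => 3 * w κ.1 κ.2.1 κ.2.2)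
    (K := ![fun κ => M₂ (4 / (1 - θ)) κ.1 i κ.2.1 j, fun κ => M₂ (4 / (1 - θ)) κ.1 i κ.2.2 k,
      fun κ => M₁ (4 / (1 - θ)) κ.2.1 j, fun κ => M₁ (4 / (1 - θ)) κ.2.2 k]) ?_ ?_ ?_ hθ ?_ ?_
  · refine (le_of_eq (lintegral_congr fun q => ?_)).trans (hmain.trans ?_)
    · simp only [Fin.prod_univ_four, hG, Matrix.cons_val]
      ring
    · rw [ENNReal.tsum_prod', ← ENNReal.tsum_mul_left]
      refine ENNReal.tsum_le_tsum fun ℓ => ?_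
      rw [ENNReal.tsum_prod', ← ENNReal.tsum_mul_left]
      refine ENNReal.tsum_le_tsum fun ℓ' => ?_
      rw [← ENNReal.tsum_mul_left]
      refine ENNReal.tsum_le_tsum fun ℓ'' => ?_
      simp only [Fin.prod_univ_four, Matrix.cons_val, Nat.cast_ofNat]
      refine (mul_le_mul_left (three_mul_rpow_le _ hθ) _).trans (le_of_eq ?_)
      ring
  · intro n
    have h1 : ∀ j B, Measurable fun q => ‖diff₂ cell F i j (swap cell B (pairCopy cell i q))‖ₑ :=
      fun j B => by fun_prop
    have h2 : ∀ j B, Measurable fun q => ‖diff cell F j (swap cell B (T q))‖ₑ :=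
      fun j B => by fun_prop
    fin_cases n
    exacts [h1 _ _, h1 _ _, h2 _ _, h2 _ _]
  · intro κ
    exact ((hLm i).comp hC.measurable (measurableSet_singleton _)).inter
      ((h.measurable_layer i j (measurableSet_singleton _)).inter
        (h.measurable_layer i k (measurableSet_singleton _)))
  · filter_upwards [hC.quasiMeasurePreserving.ae (h.diff₂_eq_zero i j Bj hij hiBj hj),
      hC.quasiMeasurePreserving.ae (h.diff₂_eq_zero i k Bk hik hiBk hk)] with q h1 h2 hne
    have n1 : ¬(L i (pairCopy cell i q) = 0 ∨ L j (pairCopy cell i q) = 0) := fun h0 =>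
      hne 0 (by simp [hG, h1 h0])
    have n2 : ¬(L i (pairCopy cell i q) = 0 ∨ L k (pairCopy cell i q) = 0) := fun h0 =>
      hne 1 (by simp [hG, h2 h0])
    push Not at n1 n2
    have m1 : 0 < layer cell L i j q := (Nat.pos_of_ne_zero n1.2).trans_le
      ((le_max_left _ _).trans (le_max_left _ _))
    have m2 : 0 < layer cell L i k q := (Nat.pos_of_ne_zero n2.2).trans_le
      ((le_max_left _ _).trans (le_max_left _ _))
    exact ⟨(⟨_, Nat.pos_of_ne_zero n1.1⟩, ⟨_, m1⟩, ⟨_, m2⟩), rfl, rfl, rfl⟩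
  · exact fun κ => hw _ _ _
  · intro n κ
    have hl : ∀ j q, L j (pairCopy cell i q) ≤ layer cell L i j q := fun j q =>
      (le_max_left _ _).trans (le_max_left _ _)
    fin_cases n
    · exact h.setLIntegral_diff₂_le hex hF hr hij hiBj hj _ _
        fun q hq => ⟨hq.1.le, (hl _ _).trans hq.2.1.le⟩
    · exact h.setLIntegral_diff₂_le hex hF hr hik hiBk hk _ _
        fun q hq => ⟨hq.1.le, (hl _ _).trans hq.2.2.le⟩
    · exact h.setLIntegral_diff_le hF hr hj' _ hT fun q hq => (hTl _ _).trans hq.2.1.le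
    · exact h.setLIntegral_diff_le hF hr hk' _ hT fun q hq => (hTl _ _).trans hq.2.2.le

/-- Squares of perturbations of the Stein coefficient. -/
lemma lintegral_mul₂_le (h : LayerBounds cell μ F L π M₁ M₂) (hex : Exchangeable cell μ)
    (hF : Measurable F) {i j : ι} (hij : i ≠ j)
    {Bj Bj' : Set ι} (hiBj : i ∉ Bj) (hj : j ∉ Bj) (hj' : j ∉ Bj')
    {T : ((E → M) × (E → M)) × (E → M) → (E → M) × (E → M)}
    (hT : MeasurePreserving T ((μ.prod μ).prod μ) (μ.prod μ))
    (hTl : ∀ j q, L j (T q) ≤ layer cell L i j q) {w : ℕ+ → ℕ+ → ℝ≥0∞}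
    (hw : ∀ ℓ ℓ' : ℕ+, ((μ.prod μ).prod μ) {q | L i (pairCopy cell i q) = ℓ ∧
      layer cell L i j q = ℓ'} ≤ 3 * w ℓ ℓ') {θ : ℝ}
    (hθ : θ ∈ Set.Ioo (0 : ℝ) 1) :
    ∫⁻ q, (‖diff₂ cell F i j (swap cell Bj (pairCopy cell i q))‖ₑ
        * ‖diff cell F j (swap cell Bj' (T q))‖ₑ)
      * (‖diff₂ cell F i j (swap cell Bj (pairCopy cell i q))‖ₑ
        * ‖diff cell F j (swap cell Bj' (T q))‖ₑ) ∂((μ.prod μ).prod μ)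
      ≤ 3 * ∑' (ℓ : ℕ+) (ℓ' : ℕ+), w ℓ ℓ' ^ θ
          * M₂ (4 / (1 - θ)) ℓ i ℓ' j ^ ((1 - θ) / 2)
          * M₁ (4 / (1 - θ)) ℓ' j ^ ((1 - θ) / 2) := by
  have h1θ : 0 < 1 - θ := sub_pos.2 hθ.2
  have hr : 0 < 4 / (1 - θ) := div_pos four_pos h1θ
  have hdm := fun j => measurable_diff (c := cell) hF j
  have hdm2 := fun j => measurable_diff₂ (c := cell) hF i j
  have hTm := hT.measurable
  have hLm := h.measurable
  have hC := hex.measurePreserving_pairCopy (μ := μ) i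
  set G : Fin 4 → ((E → M) × (E → M)) × (E → M) → ℝ≥0∞ :=
    ![fun q => ‖diff₂ cell F i j (swap cell Bj (pairCopy cell i q))‖ₑ,
      fun q => ‖diff₂ cell F i j (swap cell Bj (pairCopy cell i q))‖ₑ,
      fun q => ‖diff cell F j (swap cell Bj' (T q))‖ₑ,
      fun q => ‖diff cell F j (swap cell Bj' (T q))‖ₑ] with hG
  set s : ℕ+ × ℕ+ → Set (((E → M) × (E → M)) × (E → M)) := fun κ =>
    {q | L i (pairCopy cell i q) = κ.1 ∧ layer cell L i j q = κ.2} with hs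
  have hmain := lintegral_prod_le_tsum (ν := (μ.prod μ).prod μ) (m := 4) (by norm_num) (F := G)
    (s := s) (P := fun κ => 3 * w κ.1 κ.2)
    (K := ![fun κ => M₂ (4 / (1 - θ)) κ.1 i κ.2 j, fun κ => M₂ (4 / (1 - θ)) κ.1 i κ.2 j,
      fun κ => M₁ (4 / (1 - θ)) κ.2 j, fun κ => M₁ (4 / (1 - θ)) κ.2 j]) ?_ ?_ ?_ hθ ?_ ?_
  · refine (le_of_eq (lintegral_congr fun q => ?_)).trans (hmain.trans ?_)
    · simp only [Fin.prod_univ_four, hG, Matrix.cons_val]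
      ring
    · rw [ENNReal.tsum_prod', ← ENNReal.tsum_mul_left]
      refine ENNReal.tsum_le_tsum fun ℓ => ?_
      rw [← ENNReal.tsum_mul_left]
      refine ENNReal.tsum_le_tsum fun ℓ' => ?_
      have hsplit : ∀ x : ℝ≥0∞, x ^ ((1 - θ) / 2) = x ^ ((1 - θ) / 4) * x ^ ((1 - θ) / 4) := by
        intro x
        rw [← ENNReal.rpow_add_of_nonneg _ _ (by positivity) (by positivity)]
        congr 1
        ring
      simp only [Fin.prod_univ_four, Matrix.cons_val, Nat.cast_ofNat, hsplit]
      refine (mul_le_mul_left (three_mul_rpow_le _ hθ) _).trans (le_of_eq ?_)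
      ring
  · intro n
    have h1 : ∀ j B, Measurable fun q => ‖diff₂ cell F i j (swap cell B (pairCopy cell i q))‖ₑ :=
      fun j B => by fun_prop
    have h2 : ∀ j B, Measurable fun q => ‖diff cell F j (swap cell B (T q))‖ₑ :=
      fun j B => by fun_prop
    fin_cases n
    exacts [h1 _ _, h1 _ _, h2 _ _, h2 _ _]
  · intro κ
    exact ((hLm i).comp hC.measurable (measurableSet_singleton _)).inter
      (h.measurable_layer i j (measurableSet_singleton _))
  · filter_upwards [hC.quasiMeasurePreserving.ae (h.diff₂_eq_zero i j Bj hij hiBj hj)]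
      with q h1 hne
    have n1 : ¬(L i (pairCopy cell i q) = 0 ∨ L j (pairCopy cell i q) = 0) := fun h0 =>
      hne 0 (by simp [hG, h1 h0])
    push Not at n1
    have m1 : 0 < layer cell L i j q := (Nat.pos_of_ne_zero n1.2).trans_le
      ((le_max_left _ _).trans (le_max_left _ _))
    exact ⟨(⟨_, Nat.pos_of_ne_zero n1.1⟩, ⟨_, m1⟩), rfl, rfl⟩
  · exact fun κ => hw _ _
  · intro n κ
    have hl : ∀ j q, L j (pairCopy cell i q) ≤ layer cell L i j q := fun j q =>
      (le_max_left _ _).trans (le_max_left _ _)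
    fin_cases n
    · exact h.setLIntegral_diff₂_le hex hF hr hij hiBj hj _ _
        fun q hq => ⟨hq.1.le, (hl _ _).trans hq.2.le⟩
    · exact h.setLIntegral_diff₂_le hex hF hr hij hiBj hj _ _
        fun q hq => ⟨hq.1.le, (hl _ _).trans hq.2.le⟩
    · exact h.setLIntegral_diff_le hF hr hj' _ hT fun q hq => (hTl _ _).trans hq.2.le
    · exact h.setLIntegral_diff_le hF hr hj' _ hT fun q hq => (hTl _ _).trans hq.2.le

end LayerBounds

end Resampling

/-! ### Normal approximation in terms of moments of differences -/

namespace Resampling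

variable {ι E M : Type*} {cell : E → ι} {e : ι → ℕ}

@[simp] lemma swap_empty (cell : E → ι) (p : (E → M) × (E → M)) : swap cell ∅ p = p := by
  simp [swap]

lemma diff_affine (F : (E → M) → ℝ) (s m : ℝ) (j : ι) (p : (E → M) × (E → M)) :
    diff cell (fun x => s * (F x - m)) j p = s * diff cell F j p := by
  simp only [diff]; ring

lemma diff₂_affine (F : (E → M) → ℝ) (s m : ℝ) (i j : ι) (p : (E → M) × (E → M)) :
    diff₂ cell (fun x => s * (F x - m)) i j p = s * diff₂ cell F i j p := by
  simp only [diff₂]; ring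

lemma pertFst_affine (F : (E → M) → ℝ) (s m : ℝ) (i j : ι)
    (q : ((E → M) × (E → M)) × (E → M)) :
    pertFst cell e (fun x => s * (F x - m)) i j q = ‖s‖ₑ ^ 2 * pertFst cell e F i j q := by
  simp only [pertFst, diff_affine, diff₂_affine, enorm_mul]; ring

lemma pertSnd_affine (F : (E → M) → ℝ) (s m : ℝ) (i j : ι)
    (q : ((E → M) × (E → M)) × (E → M)) :
    pertSnd cell e (fun x => s * (F x - m)) i j q = ‖s‖ₑ ^ 2 * pertSnd cell e F i j q := by
  simp only [pertSnd, diff_affine, diff₂_affine, enorm_mul]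
  split_ifs
  · simp
  · ring

lemma pertFst_eq_swap {F : (E → M) → ℝ} (i j : ι) (q : ((E → M) × (E → M)) × (E → M)) :
    pertFst cell e F i j q = ‖diff₂ cell F i j (swap cell ∅ (pairCopy cell i q))‖ₑ
      * ‖diff cell F j (swap cell (lower e j) (pair q))‖ₑ := by
  rw [swap_empty, pertFst]

lemma pertSnd_eq_swap {F : (E → M) → ℝ} {i j : ι} (hi : i ∉ lower e j)
    (q : ((E → M) × (E → M)) × (E → M)) :
    pertSnd cell e F i j q = ‖diff₂ cell F i j (swap cell (lower e j) (pairCopy cell i q))‖ₑ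
      * ‖diff cell F j (swap cell ∅ (pairPert cell i q))‖ₑ := by
  rw [swap_empty, pertSnd, if_neg hi]

variable [MeasurableSpace M]

/-- The sum over the cells of the fourth moments of the differences. -/
noncomputable def fourthMoment (cell : E → ι) (μ : Measure (E → M)) (F : (E → M) → ℝ) : ℝ≥0∞ :=
  ∑' i, ∫⁻ p, ‖diff cell F i p‖ₑ ^ 4 ∂(μ.prod μ)

open Classical in
/-- The sum over pairs of distinct cells of the second moments of the perturbations of the Stein
coefficient. -/
noncomputable def pertMoment₂ (cell : E → ι) (e : ι → ℕ) (μ : Measure (E → M))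
    (F : (E → M) → ℝ) : ℝ≥0∞ :=
  ∑' (i) (j), if i = j then 0 else
    max (∫⁻ q, pertFst cell e F i j q * pertFst cell e F i j q ∂((μ.prod μ).prod μ))
      (∫⁻ q, pertSnd cell e F i j q * pertSnd cell e F i j q ∂((μ.prod μ).prod μ))

open Classical in
/-- The sum over triples of distinct cells of the mixed moments of the perturbations of the Stein
coefficient. -/
noncomputable def pertMoment₃ (cell : E → ι) (e : ι → ℕ) (μ : Measure (E → M))
    (F : (E → M) → ℝ) : ℝ≥0∞ :=
  ∑' (i) (j) (k), if i = j ∨ i = k ∨ j = k then 0 else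
    max (∫⁻ q, pertFst cell e F i j q * pertFst cell e F i k q ∂((μ.prod μ).prod μ))
      (∫⁻ q, pertSnd cell e F i j q * pertSnd cell e F i k q ∂((μ.prod μ).prod μ))

/-- A mixed third moment of the differences in the cell `z`, with weight `w` on the field. -/
noncomputable def mixedMoment (cell : E → ι) (e : ι → ℕ) (μ : Measure (E → M))
    (w : (E → M) → ℝ≥0∞) (F : (E → M) → ℝ) (z : ι) : ℝ≥0∞ :=
  ∫⁻ p, w p.1 * (‖diff cell F z p‖ₑ ^ 2 * ‖diff cell F z (swap cell (lower e z) p)‖ₑ) ∂(μ.prod μ)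

variable {μ : Measure (E → M)}

lemma thirdMoment_affine (he : Function.Injective e) (w : (E → M) → ℝ≥0∞) (F : (E → M) → ℝ)
    (s m : ℝ) : thirdMoment (e ∘ cell) μ w (fun x => s * (F x - m))
      = ‖s‖ₑ ^ 3 * ∑' z, mixedMoment cell e μ w F z := by
  rw [thirdMoment_comp he, ← ENNReal.tsum_mul_left]
  refine tsum_congr fun z => ?_
  rw [mixedMoment, ← lintegral_const_mul' _ _ (by finiteness)]
  refine lintegral_congr fun p => ?_
  simp only [diff_affine, enorm_mul]
  ring

variable [IsProbabilityMeasure μ]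

/-- The three contributions to the fluctuation of the Stein coefficient of an affine function of
`F`. -/
lemma Exchangeable.fluctuation_affine_le [Countable ι] (hex : Exchangeable cell μ)
    (he : Function.Injective e) {F : (E → M) → ℝ} (hF : Measurable F) (s m : ℝ) {ψ : ℝ → ℝ}
    (hψ0 : ∀ x, |ψ x| ≤ |x|) (hψ : ∀ x y, |ψ x - ψ y| ≤ |x - y|) (n : ℕ) :
    fluctuation (e ∘ cell) μ ψ (fun x => s * (F x - m)) n ≤ 32 * ‖s‖ₑ ^ 4 *
      (fourthMoment cell μ F + pertMoment₂ cell e μ F + pertMoment₃ cell e μ F) := by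
  classical
  have hs : ‖s‖ₑ ^ 4 ≠ ∞ := by finiteness
  have hmul : ∀ f g f' g' : ((E → M) × (E → M)) × (E → M) → ℝ≥0∞,
      (∀ q, f' q = ‖s‖ₑ ^ 2 * f q) → (∀ q, g' q = ‖s‖ₑ ^ 2 * g q) →
      ∫⁻ q, f' q * g' q ∂((μ.prod μ).prod μ) = ‖s‖ₑ ^ 4 * ∫⁻ q, f q * g q ∂((μ.prod μ).prod μ) := by
    intro f g f' g' hf hg
    rw [← lintegral_const_mul' _ _ hs]
    refine lintegral_congr fun q => ?_
    rw [hf, hg]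
    ring
  have h := hex.fluctuation_le he (W := fun x => s * (F x - m)) (by fun_prop) hψ0 hψ
    (b₂ := fun i j => ‖s‖ₑ ^ 4 * if i = j then 0 else
      max (∫⁻ q, pertFst cell e F i j q * pertFst cell e F i j q ∂((μ.prod μ).prod μ))
        (∫⁻ q, pertSnd cell e F i j q * pertSnd cell e F i j q ∂((μ.prod μ).prod μ)))
    (b₃ := fun i j k => ‖s‖ₑ ^ 4 * if i = j ∨ i = k ∨ j = k then 0 else
      max (∫⁻ q, pertFst cell e F i j q * pertFst cell e F i k q ∂((μ.prod μ).prod μ))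
        (∫⁻ q, pertSnd cell e F i j q * pertSnd cell e F i k q ∂((μ.prod μ).prod μ)))
    (fun i j hij => by
      rw [if_neg hij, hmul _ _ _ _ (pertFst_affine F s m i j) (pertFst_affine F s m i j)]
      exact mul_le_mul_right (le_max_left _ _) _)
    (fun i j hij => by
      rw [if_neg hij, hmul _ _ _ _ (pertSnd_affine F s m i j) (pertSnd_affine F s m i j)]
      exact mul_le_mul_right (le_max_right _ _) _)
    (fun i j k hij hik hjk => by
      rw [if_neg (by tauto), hmul _ _ _ _ (pertFst_affine F s m i j) (pertFst_affine F s m i k)]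
      exact mul_le_mul_right (le_max_left _ _) _)
    (fun i j k hij hik hjk => by
      rw [if_neg (by tauto), hmul _ _ _ _ (pertSnd_affine F s m i j) (pertSnd_affine F s m i k)]
      exact mul_le_mul_right (le_max_right _ _) _) n
  refine h.trans (le_of_eq ?_)
  have h4 : ∀ i, ∫⁻ p, ‖diff cell (fun x => s * (F x - m)) i p‖ₑ ^ 4 ∂(μ.prod μ)
      = ‖s‖ₑ ^ 4 * ∫⁻ p, ‖diff cell F i p‖ₑ ^ 4 ∂(μ.prod μ) := by
    intro i
    rw [← lintegral_const_mul' _ _ hs]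
    simp only [diff_affine, enorm_mul, mul_pow]
  simp only [h4, ENNReal.tsum_mul_left, fourthMoment, pertMoment₂, pertMoment₃]
  ring

lemma rpow_half_fluctuation_le (s a b d : ℝ≥0∞) :
    (32 * s ^ 4 * (a + b + d)) ^ (1 / 2 : ℝ)
      ≤ 6 * s ^ 2 * (a ^ (1 / 2 : ℝ) + b ^ (1 / 2 : ℝ) + d ^ (1 / 2 : ℝ)) := by
  have h0 : (0 : ℝ) ≤ 1 / 2 := by norm_num
  have h1 : (1 / 2 : ℝ) ≤ 1 := by norm_num
  have hs : (32 * s ^ 4) ^ (1 / 2 : ℝ) ≤ 6 * s ^ 2 := by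
    calc (32 * s ^ 4) ^ (1 / 2 : ℝ) ≤ ((6 * s ^ 2) ^ (2 : ℝ)) ^ (1 / 2 : ℝ) := by
          refine ENNReal.rpow_le_rpow ?_ h0
          rw [ENNReal.rpow_ofNat]
          calc 32 * s ^ 4 ≤ 36 * s ^ 4 := by gcongr; norm_num
            _ = _ := by ring
      _ = 6 * s ^ 2 := by rw [← ENNReal.rpow_mul]; norm_num
  rw [ENNReal.mul_rpow_of_nonneg _ _ h0]
  refine mul_le_mul' hs ((ENNReal.rpow_add_le_add_rpow _ _ h0 h1).trans ?_)
  gcongr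
  exact ENNReal.rpow_add_le_add_rpow _ _ h0 h1

lemma eight_mul_le {V s X T T' : ℝ≥0∞} (h : V ≤ 6 * s * X) :
    8 * (V + T + T') ≤ 48 * (s * X + T + T') :=
  calc 8 * (V + T + T') ≤ 8 * (6 * s * X + T + T') := by gcongr
    _ = 48 * (s * X) + 8 * T + 8 * T' := by ring
    _ ≤ 48 * (s * X) + 48 * T + 48 * T' := by gcongr <;> norm_num
    _ = _ := by ring

/-- Wasserstein bound for a normalized function of the field. -/
theorem Exchangeable.lipschitz_bound_affine [Countable ι] (hex : Exchangeable cell μ)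
    (he : Function.Injective e) {F : (E → M) → ℝ} (hF : Measurable F) {s m : ℝ}
    (hF2 : MemLp (fun x => s * (F x - m)) 2 μ) (hF0 : ∫ x, s * (F x - m) ∂μ = 0)
    (hF1 : ∫ x, (s * (F x - m)) ^ 2 ∂μ = 1) {h : ℝ → ℝ} (hL : LipschitzWith 1 h) :
    ENNReal.ofReal |(∫ x, h (s * (F x - m)) ∂μ) - ∫ x, h x ∂(gaussianReal 0 1)|
      ≤ 48 * (‖s‖ₑ ^ 2 * (fourthMoment cell μ F ^ (1 / 2 : ℝ)
          + pertMoment₂ cell e μ F ^ (1 / 2 : ℝ) + pertMoment₃ cell e μ F ^ (1 / 2 : ℝ))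
        + ‖s‖ₑ ^ 3 * ∑' z, mixedMoment cell e μ 1 F z) := by
  refine ((hex.comp e).lipschitz_bound (W := fun x => s * (F x - m)) (by fun_prop) hF2 hF0 hF1
    (hex.fluctuation_affine_le he hF s m (fun x => le_rfl) fun x y => le_rfl) hL).trans ?_
  rw [thirdMoment_affine he]
  simpa using eight_mul_le (T' := 0) (rpow_half_fluctuation_le _ _ _ _)

/-- Kolmogorov bound for a normalized function of the field. -/
theorem Exchangeable.indicator_bound_affine [Countable ι] (hex : Exchangeable cell μ)
    (he : Function.Injective e) {F : (E → M) → ℝ} (hF : Measurable F) {s m : ℝ}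
    (hF2 : MemLp (fun x => s * (F x - m)) 2 μ) (hF0 : ∫ x, s * (F x - m) ∂μ = 0)
    (hF1 : ∫ x, (s * (F x - m)) ^ 2 ∂μ = 1) (t : ℝ) :
    ENNReal.ofReal |μ.real ((fun x => s * (F x - m)) ⁻¹' Set.Iic t)
        - (gaussianReal 0 1).real (Set.Iic t)|
      ≤ 48 * (‖s‖ₑ ^ 2 * (fourthMoment cell μ F ^ (1 / 2 : ℝ)
          + pertMoment₂ cell e μ F ^ (1 / 2 : ℝ) + pertMoment₃ cell e μ F ^ (1 / 2 : ℝ))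
        + ‖s‖ₑ ^ 3 * ∑' z, mixedMoment cell e μ 1 F z
        + ‖s‖ₑ ^ 3 * ∑' z, mixedMoment cell e μ (fun x => ‖s * (F x - m)‖ₑ) F z) := by
  refine ((hex.comp e).indicator_bound (W := fun x => s * (F x - m)) (by fun_prop) hF2 hF0 hF1
    (hex.fluctuation_affine_le he hF s m (fun x => le_rfl) fun x y => le_rfl)
    (hex.fluctuation_affine_le he hF s m (fun x => (abs_abs x).le)
      fun x y => abs_abs_sub_abs_le x y) t).trans ?_
  rw [thirdMoment_affine he, thirdMoment_affine he]
  exact eight_mul_le (rpow_half_fluctuation_le _ _ _ _)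

end Resampling

/-! ### Summed multiscale bounds -/

namespace Resampling

variable {ι E M : Type*} [MeasurableSpace M] {cell : E → ι} {e : ι → ℕ} {μ : Measure (E → M)}
  {F : (E → M) → ℝ} {L : ι → (E → M) × (E → M) → ℕ} {π : ι → ℕ+ → ℝ≥0∞}
  {M₁ : ℝ → ℕ+ → ι → ℝ≥0∞} {M₂ : ℝ → ℕ+ → ι → ℕ+ → ι → ℝ≥0∞}

lemma rpow_half_le_two_mul_iInf {X : ℝ≥0∞} {S : Set.Ioo (0 : ℝ) 1 → ℝ≥0∞}
    (h : ∀ θ, X ≤ 3 * S θ) : X ^ (1 / 2 : ℝ) ≤ 2 * ⨅ θ, S θ ^ (1 / 2 : ℝ) := by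
  rw [ENNReal.mul_iInf_of_ne (by norm_num) (by norm_num)]
  refine le_iInf fun θ => ?_
  refine (ENNReal.rpow_le_rpow (h θ) (by norm_num)).trans ?_
  rw [ENNReal.mul_rpow_of_nonneg _ _ (by norm_num)]
  gcongr
  calc (3 : ℝ≥0∞) ^ (1 / 2 : ℝ) ≤ (2 ^ (2 : ℝ)) ^ (1 / 2 : ℝ) := by
        refine ENNReal.rpow_le_rpow ?_ (by norm_num)
        rw [ENNReal.rpow_ofNat]
        norm_num
    _ = 2 := by rw [← ENNReal.rpow_mul]; norm_num

namespace LayerBounds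

lemma lintegral_diff_four_le (h : LayerBounds cell μ F L π M₁ M₂) (hF : Measurable F) (j : ι)
    {θ : ℝ} (hθ : θ ∈ Set.Ioo (0 : ℝ) 1) :
    ∫⁻ p, ‖diff cell F j p‖ₑ ^ 4 ∂(μ.prod μ)
      ≤ ∑' ℓ : ℕ+, π j ℓ ^ θ * M₁ (4 / (1 - θ)) ℓ j ^ (1 - θ) := by
  have := h.lintegral_prod_diff_le hF (m := 4) (by norm_num) j (B := fun _ => ∅) (by simp) hθ
  simpa using this

theorem fourthMoment_le (h : LayerBounds cell μ F L π M₁ M₂) (hF : Measurable F)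
    (θ : Set.Ioo (0 : ℝ) 1) :
    fourthMoment cell μ F
      ≤ ∑' (j : ι) (ℓ : ℕ+), π j ℓ ^ (θ : ℝ) * M₁ (4 / (1 - θ)) ℓ j ^ (1 - (θ : ℝ)) :=
  ENNReal.tsum_le_tsum fun j => h.lintegral_diff_four_le hF j θ.2

theorem mixedMoment_one_le (h : LayerBounds cell μ F L π M₁ M₂) (hF : Measurable F) (e : ι → ℕ)
    (θ : Set.Ioo (0 : ℝ) 1) (j : ι) :
    mixedMoment cell e μ 1 F j
      ≤ ∑' ℓ : ℕ+, π j ℓ ^ (θ : ℝ) * M₁ (3 / (1 - θ)) ℓ j ^ (1 - (θ : ℝ)) := by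
  have := h.lintegral_prod_diff_le hF (m := 3) (by norm_num) j (B := ![∅, ∅, lower e j])
    (by intro n; fin_cases n <;> simp [notMem_lower_self]) θ.2
  simpa [mixedMoment, Fin.prod_univ_three, pow_two] using this

/-- A sixth moment, of mixed differences. -/
theorem lintegral_diff_six_le (h : LayerBounds cell μ F L π M₁ M₂) (hF : Measurable F) (e : ι → ℕ)
    {θ : ℝ} (hθ : θ ∈ Set.Ioo (0 : ℝ) 1) (j : ι) :
    ∫⁻ p, (‖diff cell F j p‖ₑ ^ 2 * ‖diff cell F j (swap cell (lower e j) p)‖ₑ) ^ 2 ∂(μ.prod μ)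
      ≤ ∑' ℓ : ℕ+, π j ℓ ^ θ * M₁ (6 / (1 - θ)) ℓ j ^ (1 - θ) := by
  have := h.lintegral_prod_diff_le hF (m := 6) (by norm_num) j
    (B := ![∅, ∅, ∅, ∅, lower e j, lower e j])
    (by intro n; fin_cases n <;> simp [notMem_lower_self]) hθ
  refine le_trans (le_of_eq (lintegral_congr fun p => ?_)) (by simpa using this)
  simp only [Fin.prod_univ_six, Matrix.cons_val, swap_empty]
  ring

/-- Weighted third moments in terms of sixth moments, by the Cauchy-Schwarz inequality. -/
theorem mixedMoment_le (h : LayerBounds cell μ F L π M₁ M₂) (hF : Measurable F) (e : ι → ℕ)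
    [IsProbabilityMeasure μ] {w : (E → M) → ℝ≥0∞} (hw : Measurable w)
    (hw1 : ∫⁻ x, w x ^ 2 ∂μ ≤ 1) (θ : Set.Ioo (0 : ℝ) 1) (j : ι) :
    mixedMoment cell e μ w F j
      ≤ (∑' ℓ : ℕ+, π j ℓ ^ (θ : ℝ) * M₁ (6 / (1 - θ)) ℓ j ^ (1 - (θ : ℝ))) ^ (1 / 2 : ℝ) := by
  have hdm := measurable_diff (c := cell) hF j
  have hCS := ENNReal.lintegral_mul_le_Lp_mul_Lq (μ.prod μ) Real.HolderConjugate.two_two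
    (f := fun p => w p.1)
    (g := fun p => ‖diff cell F j p‖ₑ ^ 2 * ‖diff cell F j (swap cell (lower e j) p)‖ₑ)
    (by fun_prop) (by fun_prop)
  refine hCS.trans ?_
  simp only [ENNReal.rpow_ofNat]
  have h1 : ∫⁻ p : (E → M) × (E → M), w p.1 ^ 2 ∂(μ.prod μ) ≤ 1 := by
    rw [measurePreserving_fst.lintegral_comp (f := fun x => w x ^ 2) (by fun_prop)]
    exact hw1
  calc _ ≤ 1 ^ (1 / 2 : ℝ) * (∑' ℓ : ℕ+, π j ℓ ^ (θ : ℝ)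
        * M₁ (6 / (1 - θ)) ℓ j ^ (1 - (θ : ℝ))) ^ (1 / 2 : ℝ) := by
        gcongr
        exact h.lintegral_diff_six_le hF e θ.2 j
    _ = _ := by simp

variable [IsProbabilityMeasure μ]

theorem pertMoment₃_le (h : LayerBounds cell μ F L π M₁ M₂) (hex : Exchangeable cell μ)
    (hF : Measurable F) (e : ι → ℕ) {w : ι → ι → ι → ℕ+ → ℕ+ → ℕ+ → ℝ≥0∞}
    (hw : ∀ i j k, i ≠ j → i ≠ k → j ≠ k → ∀ ℓ ℓ' ℓ'' : ℕ+,
      ((μ.prod μ).prod μ) {q | L i (pairCopy cell i q) = ℓ ∧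
        layer cell L i j q = ℓ' ∧ layer cell L i k q = ℓ''} ≤ 3 * w i j k ℓ ℓ' ℓ'')
    (θ : Set.Ioo (0 : ℝ) 1) :
    pertMoment₃ cell e μ F ≤ 3 * ∑' (i : ι) (j : ι) (k : ι) (ℓ : ℕ+) (ℓ' : ℕ+) (ℓ'' : ℕ+),
        w i j k ℓ ℓ' ℓ'' ^ (θ : ℝ)
          * M₂ (4 / (1 - θ)) ℓ i ℓ' j ^ ((1 - (θ : ℝ)) / 4)
          * M₂ (4 / (1 - θ)) ℓ i ℓ'' k ^ ((1 - (θ : ℝ)) / 4)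
          * M₁ (4 / (1 - θ)) ℓ' j ^ ((1 - (θ : ℝ)) / 4)
          * M₁ (4 / (1 - θ)) ℓ'' k ^ ((1 - (θ : ℝ)) / 4) := by
  rw [← ENNReal.tsum_mul_left]
  refine ENNReal.tsum_le_tsum fun i => ?_
  rw [← ENNReal.tsum_mul_left]
  refine ENNReal.tsum_le_tsum fun j => ?_
  rw [← ENNReal.tsum_mul_left]
  refine ENNReal.tsum_le_tsum fun k => ?_
  split_ifs with hc
  · exact zero_le
  push Not at hc
  obtain ⟨hij, hik, hjk⟩ := hc
  refine max_le ?_ ?_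
  · simp_rw [pertFst_eq_swap]
    exact h.lintegral_mul₃_le hex hF hij hik (by simp) (by simp) (by simp) (notMem_lower_self e j)
      (by simp) (notMem_lower_self e k) measurePreserving_pair
      (fun j q => (le_max_right _ _).trans (le_max_left _ _)) (hw i j k hij hik hjk) θ.2
  · by_cases hj : i ∈ lower e j
    · simp [pertSnd, hj]
    by_cases hk : i ∈ lower e k
    · simp [pertSnd, hk]
    simp_rw [pertSnd_eq_swap hj, pertSnd_eq_swap hk]
    exact h.lintegral_mul₃_le hex hF hij hik hj hk (notMem_lower_self e j) (by simp)
      (notMem_lower_self e k) (by simp) (hex.measurePreserving_pairPert i)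
      (fun j q => le_max_right _ _) (hw i j k hij hik hjk) θ.2

theorem pertMoment₂_le (h : LayerBounds cell μ F L π M₁ M₂) (hex : Exchangeable cell μ)
    (hF : Measurable F) (e : ι → ℕ) {w : ι → ι → ℕ+ → ℕ+ → ℝ≥0∞}
    (hw : ∀ i j, i ≠ j → ∀ ℓ ℓ' : ℕ+,
      ((μ.prod μ).prod μ) {q | L i (pairCopy cell i q) = ℓ ∧
        layer cell L i j q = ℓ'} ≤ 3 * w i j ℓ ℓ')
    (θ : Set.Ioo (0 : ℝ) 1) :
    pertMoment₂ cell e μ F ≤ 3 * ∑' (i : ι) (j : ι) (ℓ : ℕ+) (ℓ' : ℕ+),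
        w i j ℓ ℓ' ^ (θ : ℝ)
          * M₂ (4 / (1 - θ)) ℓ i ℓ' j ^ ((1 - (θ : ℝ)) / 2)
          * M₁ (4 / (1 - θ)) ℓ' j ^ ((1 - (θ : ℝ)) / 2) := by
  rw [← ENNReal.tsum_mul_left]
  refine ENNReal.tsum_le_tsum fun i => ?_
  rw [← ENNReal.tsum_mul_left]
  refine ENNReal.tsum_le_tsum fun j => ?_
  split_ifs with hij
  · exact zero_le
  refine max_le ?_ ?_
  · simp_rw [pertFst_eq_swap]
    exact h.lintegral_mul₂_le hex hF hij (by simp) (by simp) (notMem_lower_self e j)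
      measurePreserving_pair
      (fun j q => (le_max_right _ _).trans (le_max_left _ _)) (hw i j hij) θ.2
  · by_cases hj : i ∈ lower e j
    · simp [pertSnd, hj]
    simp_rw [pertSnd_eq_swap hj]
    exact h.lintegral_mul₂_le hex hF hij hj (notMem_lower_self e j) (by simp)
      (hex.measurePreserving_pairPert i)
      (fun j q => le_max_right _ _) (hw i j hij) θ.2

/-! ### Joint laws of the layers -/

lemma measure_layer_le (h : LayerBounds cell μ F L π M₁ M₂) (hex : Exchangeable cell μ) (i j : ι)
    (ℓ : ℕ+) : ((μ.prod μ).prod μ) {q | layer cell L i j q = ℓ} ≤ 3 * π j ℓ := by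
  have hT : ∀ T : ((E → M) × (E → M)) × (E → M) → (E → M) × (E → M),
      MeasurePreserving T ((μ.prod μ).prod μ) (μ.prod μ) →
      ((μ.prod μ).prod μ) {q | L j (T q) = ℓ} ≤ π j ℓ := by
    intro T hT
    refine le_trans (le_of_eq ?_) (h.measure_le j ℓ)
    exact hT.measure_preimage (h.measurable j (measurableSet_singleton _)).nullMeasurableSet
  have hsub : {q | layer cell L i j q = ℓ} ⊆ ({q | L j (pairCopy cell i q) = ℓ}
      ∪ {q | L j (pair q) = ℓ}) ∪ {q | L j (pairPert cell i q) = ℓ} := by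
    intro q hq
    simp only [Set.mem_ofPred_eq, layer] at hq
    simp only [Set.mem_union, Set.mem_ofPred_eq]
    rcases max_choice (max (L j (pairCopy cell i q)) (L j (pair q))) (L j (pairPert cell i q))
      with h1 | h1 <;> rcases max_choice (L j (pairCopy cell i q)) (L j (pair q)) with h2 | h2 <;>
      omega
  calc _ ≤ (π j ℓ + π j ℓ) + π j ℓ := by
        refine (measure_mono hsub).trans ((measure_union_le _ _).trans (add_le_add
          ((measure_union_le _ _).trans (add_le_add ?_ ?_)) ?_))
        · exact hT _ (hex.measurePreserving_pairCopy i)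
        · exact hT _ measurePreserving_pair
        · exact hT _ (hex.measurePreserving_pairPert i)
    _ = 3 * π j ℓ := by ring

lemma measure_layer_self_le (h : LayerBounds cell μ F L π M₁ M₂) (hex : Exchangeable cell μ)
    (i : ι) (ℓ : ℕ+) : ((μ.prod μ).prod μ) {q | L i (pairCopy cell i q) = ℓ} ≤ π i ℓ :=
  ((hex.measurePreserving_pairCopy i).measure_preimage
    (h.measurable i (measurableSet_singleton _)).nullMeasurableSet).trans_le (h.measure_le i ℓ)

/-- Without any information on the dependence of the layers, their joint law is bounded by the
geometric mean of the marginal laws. -/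
lemma measure_layer₃_le (h : LayerBounds cell μ F L π M₁ M₂) (hex : Exchangeable cell μ)
    (i j k : ι) (ℓ ℓ' ℓ'' : ℕ+) :
    ((μ.prod μ).prod μ) {q | L i (pairCopy cell i q) = ℓ ∧
      layer cell L i j q = ℓ' ∧ layer cell L i k q = ℓ''}
      ≤ 3 * (π i ℓ ^ (1 / 3 : ℝ) * π j ℓ' ^ (1 / 3 : ℝ) * π k ℓ'' ^ (1 / 3 : ℝ)) := by
  set m := ((μ.prod μ).prod μ) {q | L i (pairCopy cell i q) = ℓ ∧
      layer cell L i j q = ℓ' ∧ layer cell L i k q = ℓ''} with hm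
  have h3 : (0 : ℝ) ≤ 1 / 3 := by norm_num
  have e1 : m = m ^ (1 / 3 : ℝ) * m ^ (1 / 3 : ℝ) * m ^ (1 / 3 : ℝ) := by
    rw [← ENNReal.rpow_add_of_nonneg _ _ h3 h3, ← ENNReal.rpow_add_of_nonneg _ _ (by norm_num) h3]
    norm_num
  have b1 : m ≤ π i ℓ := (measure_mono fun q hq => hq.1).trans (h.measure_layer_self_le hex i ℓ)
  have b2 : m ≤ 3 * π j ℓ' := (measure_mono fun q hq => hq.2.1).trans (h.measure_layer_le hex i j _)
  have b3 : m ≤ 3 * π k ℓ'' :=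
    (measure_mono fun q hq => hq.2.2).trans (h.measure_layer_le hex i k _)
  have e2 : (3 : ℝ≥0∞) ^ (1 / 3 : ℝ) * 3 ^ (1 / 3 : ℝ) ≤ 3 := by
    rw [← ENNReal.rpow_add_of_nonneg _ _ h3 h3]
    calc (3 : ℝ≥0∞) ^ (1 / 3 + 1 / 3 : ℝ) ≤ 3 ^ (1 : ℝ) :=
          ENNReal.rpow_le_rpow_of_exponent_le (by norm_num) (by norm_num)
      _ = 3 := ENNReal.rpow_one _
  calc m ≤ π i ℓ ^ (1 / 3 : ℝ) * (3 * π j ℓ') ^ (1 / 3 : ℝ) * (3 * π k ℓ'') ^ (1 / 3 : ℝ) := by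
        rw [e1]; gcongr
    _ = (3 ^ (1 / 3 : ℝ) * 3 ^ (1 / 3 : ℝ))
        * (π i ℓ ^ (1 / 3 : ℝ) * π j ℓ' ^ (1 / 3 : ℝ) * π k ℓ'' ^ (1 / 3 : ℝ)) := by
        rw [ENNReal.mul_rpow_of_nonneg _ _ h3, ENNReal.mul_rpow_of_nonneg _ _ h3]; ring
    _ ≤ _ := by gcongr

lemma measure_layer₂_le (h : LayerBounds cell μ F L π M₁ M₂) (hex : Exchangeable cell μ)
    (i j : ι) (ℓ ℓ' : ℕ+) :
    ((μ.prod μ).prod μ) {q | L i (pairCopy cell i q) = ℓ ∧ layer cell L i j q = ℓ'}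
      ≤ 3 * (π i ℓ ^ (1 / 2 : ℝ) * π j ℓ' ^ (1 / 2 : ℝ)) := by
  set m := ((μ.prod μ).prod μ) {q | L i (pairCopy cell i q) = ℓ ∧
      layer cell L i j q = ℓ'} with hm
  have h2 : (0 : ℝ) ≤ 1 / 2 := by norm_num
  have e1 : m = m ^ (1 / 2 : ℝ) * m ^ (1 / 2 : ℝ) := by
    rw [← ENNReal.rpow_add_of_nonneg _ _ h2 h2]
    norm_num
  have b1 : m ≤ π i ℓ := (measure_mono fun q hq => hq.1).trans (h.measure_layer_self_le hex i ℓ)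
  have b2 : m ≤ 3 * π j ℓ' := (measure_mono fun q hq => hq.2).trans (h.measure_layer_le hex i j _)
  calc m ≤ π i ℓ ^ (1 / 2 : ℝ) * (3 * π j ℓ') ^ (1 / 2 : ℝ) := by rw [e1]; gcongr
    _ ≤ π i ℓ ^ (1 / 2 : ℝ) * (3 * π j ℓ' ^ (1 / 2 : ℝ)) := by
        gcongr
        exact three_mul_rpow_le _ (by norm_num)
    _ = _ := by ring

/-! ### Local layers -/

/-- Local layers in distinct cells are independent. -/
lemma measure_layer₂_le_of_isLocal (h : LayerBounds cell μ F L π M₁ M₂)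
    (hex : Exchangeable cell μ) (hloc : IsLocal cell L) {i j : ι} (hij : i ≠ j) (ℓ ℓ' : ℕ+) :
    ((μ.prod μ).prod μ) {q | L i (pairCopy cell i q) = ℓ ∧ layer cell L i j q = ℓ'}
      ≤ π i ℓ * π j ℓ' := by
  have hi : MeasurableSet {p | L i p = ℓ} := h.measurable i (measurableSet_singleton _)
  have hj : MeasurableSet {p | L j p = ℓ'} := h.measurable j (measurableSet_singleton _)
  simp_rw [layer_eq_of_isLocal hloc hij]
  refine ((hex.measurePreserving_pairCopy i).measure_preimage
    (hi.inter hj).nullMeasurableSet).trans_le ?_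
  rw [hex.measure_inter_eq_mul {i} hi hj]
  · exact mul_le_mul' (h.measure_le i ℓ) (h.measure_le j ℓ')
  · intro p p' hp
    simp only [Set.mem_ofPred_eq, hloc i p p' hp]
  · intro p p' hp
    simp only [Set.mem_ofPred_eq, hloc j p p' fun f hf => hp f (by
      rw [Set.mem_singleton_iff.1 hf]; simpa using hij.symm)]

lemma measure_layer₃_le_of_isLocal (h : LayerBounds cell μ F L π M₁ M₂)
    (hex : Exchangeable cell μ) (hloc : IsLocal cell L) {i j k : ι} (hij : i ≠ j) (hik : i ≠ k)
    (hjk : j ≠ k) (ℓ ℓ' ℓ'' : ℕ+) :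
    ((μ.prod μ).prod μ) {q | L i (pairCopy cell i q) = ℓ ∧
      layer cell L i j q = ℓ' ∧ layer cell L i k q = ℓ''} ≤ π i ℓ * π j ℓ' * π k ℓ'' := by
  have hi : MeasurableSet {p | L i p = ℓ} := h.measurable i (measurableSet_singleton _)
  have hj : MeasurableSet {p | L j p = ℓ'} := h.measurable j (measurableSet_singleton _)
  have hk : MeasurableSet {p | L k p = ℓ''} := h.measurable k (measurableSet_singleton _)
  simp_rw [layer_eq_of_isLocal hloc hij, layer_eq_of_isLocal hloc hik]
  refine ((hex.measurePreserving_pairCopy i).measure_preimage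
    (hi.inter (hj.inter hk)).nullMeasurableSet).trans_le ?_
  rw [hex.measure_inter_eq_mul {i} hi (hj.inter hk), hex.measure_inter_eq_mul {j} hj hk, mul_assoc]
  · exact mul_le_mul' (h.measure_le i ℓ) (mul_le_mul' (h.measure_le j ℓ') (h.measure_le k ℓ''))
  · intro p p' hp
    simp only [Set.mem_ofPred_eq, hloc j p p' hp]
  · intro p p' hp
    simp only [Set.mem_ofPred_eq, hloc k p p' fun f hf => hp f (by
      rw [Set.mem_singleton_iff.1 hf]; simpa using hjk.symm)]
  · intro p p' hp
    simp only [Set.mem_ofPred_eq, hloc i p p' hp]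
  · intro p p' hp
    simp only [Set.mem_inter_iff, Set.mem_ofPred_eq, hloc j p p' fun f hf => hp f (by
      rw [Set.mem_singleton_iff.1 hf]; simpa using hij.symm), hloc k p p' fun f hf => hp f (by
      rw [Set.mem_singleton_iff.1 hf]; simpa using hik.symm)]

end LayerBounds

end Resampling

/-! ### Weighted third moments for local layers -/

namespace Resampling

variable {ι E M : Type*} [MeasurableSpace M] {cell : E → ι} {e : ι → ℕ} {μ : Measure (E → M)}
  {F : (E → M) → ℝ} {L : ι → (E → M) × (E → M) → ℕ} {π : ι → ℕ+ → ℝ≥0∞}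
  {M₁ : ℝ → ℕ+ → ι → ℝ≥0∞} {M₂ : ℝ → ℕ+ → ι → ℕ+ → ι → ℝ≥0∞}

lemma mul_sq_mul_le (a b d : ℝ≥0∞) : a * (b ^ 2 * d) ≤ a ^ 4 + (b ^ 4 + d ^ 4) := by
  set m := max a (max b d) with hm
  have ha : a ≤ m := le_max_left _ _
  have hb : b ≤ m := (le_max_left _ _).trans (le_max_right _ _)
  have hd : d ≤ m := (le_max_right _ _).trans (le_max_right _ _)
  calc a * (b ^ 2 * d) ≤ m * (m ^ 2 * m) := by gcongr
    _ = m ^ 4 := by ring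
    _ ≤ _ := by
      rcases max_choice a (max b d) with h | h
      · rw [hm, h]; exact le_self_add
      · rcases max_choice b d with h' | h'
        · rw [hm, h, h']; exact le_self_add.trans le_add_self
        · rw [hm, h, h']; exact le_add_self.trans le_add_self

namespace LayerBounds

/-- Sixth moment of mixed differences on a single layer. -/
lemma setLIntegral_diff_six_le (h : LayerBounds cell μ F L π M₁ M₂) (hF : Measurable F) (e : ι → ℕ)
    {θ : ℝ} (hθ : θ ∈ Set.Ioo (0 : ℝ) 1) (j : ι) (ℓ : ℕ+) :
    ∫⁻ p in {p | L j p = ℓ},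
        (‖diff cell F j p‖ₑ ^ 2 * ‖diff cell F j (swap cell (lower e j) p)‖ₑ) ^ 2 ∂(μ.prod μ)
      ≤ (μ.prod μ) {p | L j p = ℓ} ^ θ * M₁ (6 / (1 - θ)) ℓ j ^ (1 - θ) := by
  have h1θ : 0 < 1 - θ := sub_pos.2 hθ.2
  have hdm := measurable_diff (c := cell) hF j
  have hs : MeasurableSet {p | L j p = ℓ} := h.measurable j (measurableSet_singleton _)
  set B : Fin 6 → Set ι := ![∅, ∅, ∅, ∅, lower e j, lower e j] with hB
  have hjB : ∀ n, j ∉ B n := by intro n; fin_cases n <;> simp [hB, notMem_lower_self]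
  have key := lintegral_prod_le_tsum (ν := (μ.prod μ).restrict {p | L j p = ℓ}) (m := 6)
    (by norm_num) (F := fun n p => ‖diff cell F j (swap cell (B n) p)‖ₑ)
    (s := fun _ : Unit => {p | L j p = ℓ}) (fun n => by fun_prop)
    (fun _ => hs) ((ae_restrict_mem hs).mono fun p hp _ => ⟨(), hp⟩) hθ
    (P := fun _ => (μ.prod μ) {p | L j p = ℓ})
    (fun _ => by rw [Measure.restrict_apply hs, Set.inter_self])
    (K := fun _ _ => M₁ (6 / (1 - θ)) ℓ j) (fun n _ => by
      rw [Measure.restrict_restrict hs, Set.inter_self]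
      exact (lintegral_mono_set fun p (hp : L j p = ℓ) => hp.le).trans
        (h.lintegral_diff_le _ (div_pos (by norm_num) h1θ) ℓ j (B n) (hjB n)))
  refine le_trans (le_of_eq (lintegral_congr fun p => ?_)) (key.trans (le_of_eq ?_))
  · simp only [Fin.prod_univ_six, hB, Matrix.cons_val, swap_empty]
    ring
  · rw [tsum_fintype, Fintype.sum_unique, Finset.prod_const, Finset.card_univ, Fintype.card_fin,
      ← ENNReal.rpow_natCast, ← ENNReal.rpow_mul, div_mul_cancel₀ _ (by norm_num)]

variable [IsProbabilityMeasure μ]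

/-- A local layer is independent of the field in which its cell has been resampled. -/
lemma lintegral_mix_mul_indicator_le (h : LayerBounds cell μ F L π M₁ M₂)
    (hex : Exchangeable cell μ) (hloc : IsLocal cell L) {w : (E → M) → ℝ≥0∞} (hw : Measurable w)
    (hw1 : ∫⁻ x, w x ∂μ ≤ 1) (j : ι) (ℓ : ℕ+) :
    ∫⁻ q, w (mix cell {j} q.1.1 q.1.2) * {p | L j p = ℓ}.indicator 1 (pair q)
      ∂((μ.prod μ).prod μ) ≤ (μ.prod μ) {p | L j p = ℓ} := by
  have hs : MeasurableSet {p | L j p = ℓ} := h.measurable j (measurableSet_singleton _)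
  have hi : Measurable ({p | L j p = ℓ}.indicator (1 : (E → M) × (E → M) → ℝ≥0∞)) :=
    measurable_one.indicator hs
  -- exchanging the field and its first copy in the cell `j` decouples the two factors
  set H : ((E → M) × (E → M)) × (E → M) → ℝ≥0∞ := fun q =>
    w q.1.1 * {p | L j p = ℓ}.indicator 1 (q.1.2, q.2) with hH
  have hHm : Measurable H := by
    refine (hw.comp (by fun_prop)).mul (hi.comp (by fun_prop))
  have hmp : MeasurePreserving (fun q : ((E → M) × (E → M)) × (E → M) => (swap cell {j} q.1, q.2))
      ((μ.prod μ).prod μ) ((μ.prod μ).prod μ) := (hex {j}).prod (MeasurePreserving.id μ)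
  have e1 : ∀ q : ((E → M) × (E → M)) × (E → M),
      w (mix cell {j} q.1.1 q.1.2) * {p | L j p = ℓ}.indicator 1 (pair q)
        = H (swap cell {j} q.1, q.2) := by
    intro q
    have : L j (mix cell {j} q.1.2 q.1.1, q.2) = L j (pair q) := hloc j _ _ fun f hf =>
      ⟨mix_of_mem hf, rfl⟩
    simp only [hH, swap, Set.indicator, Set.mem_ofPred_eq, this, Pi.one_apply]
  simp_rw [e1]
  rw [hmp.lintegral_comp hHm]
  have hA := (measurePreserving_prodAssoc μ μ μ).symm.lintegral_comp hHm
  rw [← hA]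
  calc _ = ∫⁻ r : (E → M) × ((E → M) × (E → M)),
        w r.1 * {p | L j p = ℓ}.indicator 1 r.2 ∂(μ.prod (μ.prod μ)) := rfl
    _ = (∫⁻ x, w x ∂μ) * (μ.prod μ) {p | L j p = ℓ} := by
        rw [lintegral_prod_mul hw.aemeasurable hi.aemeasurable, lintegral_indicator_one hs]
    _ ≤ _ := mul_le_of_le_one_left zero_le hw1

/-- Weighted third moment on a single local layer. -/
lemma lintegral_layer_le (h : LayerBounds cell μ F L π M₁ M₂)
    (hex : Exchangeable cell μ) (hloc : IsLocal cell L) (hF : Measurable F) (e : ι → ℕ)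
    {W : (E → M) → ℝ} (hW : Measurable W) (hw1 : ∫⁻ x, ‖W x‖ₑ ^ 2 ∂μ ≤ 1) {θ : ℝ}
    (hθ : θ ∈ Set.Ioo (0 : ℝ) 1) (j : ι) (ℓ : ℕ+) :
    ∫⁻ q, (‖W (mix cell {j} q.1.1 q.1.2)‖ₑ * {p | L j p = ℓ}.indicator 1 (pair q))
      * {p | L j p = ℓ}.indicator (fun p =>
        ‖diff cell F j p‖ₑ ^ 2 * ‖diff cell F j (swap cell (lower e j) p)‖ₑ) (pair q)
        ∂((μ.prod μ).prod μ)
      ≤ π j ℓ ^ θ * M₁ (6 / (1 - θ)) ℓ j ^ ((1 - θ) / 2) := by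
  have hdm := measurable_diff (c := cell) hF j
  set G : (E → M) × (E → M) → ℝ≥0∞ := fun p =>
    ‖diff cell F j p‖ₑ ^ 2 * ‖diff cell F j (swap cell (lower e j) p)‖ₑ with hG
  have hGm : Measurable G := by fun_prop
  have hs : MeasurableSet {p | L j p = ℓ} := h.measurable j (measurableSet_singleton _)
  have hmp := measurePreserving_pair (μ := μ)
  have h1 : Measurable fun q : ((E → M) × (E → M)) × (E → M) =>
      {p | L j p = ℓ}.indicator (1 : (E → M) × (E → M) → ℝ≥0∞) (pair q) :=
    (measurable_one.indicator hs).comp measurable_pair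
  have h2 : Measurable fun q : ((E → M) × (E → M)) × (E → M) =>
      {p | L j p = ℓ}.indicator G (pair q) := (hGm.indicator hs).comp measurable_pair
  have h3 : Measurable fun q : ((E → M) × (E → M)) × (E → M) =>
      ‖W (mix cell {j} q.1.1 q.1.2)‖ₑ := by fun_prop
  refine (ENNReal.lintegral_mul_le_Lp_mul_Lq ((μ.prod μ).prod μ) Real.HolderConjugate.two_two
    (h3.mul h1).aemeasurable h2.aemeasurable).trans ?_
  simp only [ENNReal.rpow_ofNat]
  set P := (μ.prod μ) {p | L j p = ℓ} with hP
  have b1 : ∫⁻ q, (‖W (mix cell {j} q.1.1 q.1.2)‖ₑ * {p | L j p = ℓ}.indicator 1 (pair q)) ^ 2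
      ∂((μ.prod μ).prod μ) ≤ P := by
    refine le_trans (le_of_eq (lintegral_congr fun q => ?_))
      (h.lintegral_mix_mul_indicator_le hex hloc (w := fun x => ‖W x‖ₑ ^ 2) (by fun_prop) hw1 j ℓ)
    by_cases hq : L j (pair q) = ℓ <;> simp [hq]
  have b2 : ∫⁻ q, ({p | L j p = ℓ}.indicator G (pair q)) ^ 2 ∂((μ.prod μ).prod μ)
      ≤ P ^ θ * M₁ (6 / (1 - θ)) ℓ j ^ (1 - θ) := by
    rw [hmp.lintegral_comp (f := fun p => ({p | L j p = ℓ}.indicator G p) ^ 2)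
      ((hGm.indicator hs).pow_const 2)]
    refine le_trans (le_of_eq ?_) (h.setLIntegral_diff_six_le hF e hθ j ℓ)
    rw [← lintegral_indicator hs]
    refine lintegral_congr fun p => ?_
    by_cases hp : L j p = ℓ <;> simp [hp, hG]
  have hP1 : P ≤ 1 := prob_le_one
  have h12 : (0 : ℝ) ≤ 1 / 2 := by norm_num
  calc _ ≤ P ^ (1 / 2 : ℝ) * (P ^ θ * M₁ (6 / (1 - θ)) ℓ j ^ (1 - θ)) ^ (1 / 2 : ℝ) :=
        mul_le_mul' (ENNReal.rpow_le_rpow b1 h12) (ENNReal.rpow_le_rpow b2 h12)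
    _ = P ^ ((1 + θ) / 2) * M₁ (6 / (1 - θ)) ℓ j ^ ((1 - θ) / 2) := by
        rw [ENNReal.mul_rpow_of_nonneg _ _ h12, ← ENNReal.rpow_mul, ← ENNReal.rpow_mul,
          ← mul_assoc, ← ENNReal.rpow_add_of_nonneg _ _ h12 (mul_nonneg hθ.1.le h12)]
        congr 2 <;> ring
    _ ≤ P ^ θ * M₁ (6 / (1 - θ)) ℓ j ^ ((1 - θ) / 2) :=
        mul_le_mul_left (ENNReal.rpow_le_rpow_of_exponent_ge hP1 (by linarith [hθ.2])) _
    _ ≤ π j ℓ ^ θ * M₁ (6 / (1 - θ)) ℓ j ^ ((1 - θ) / 2) :=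
        mul_le_mul_left (ENNReal.rpow_le_rpow (h.measure_le j ℓ) hθ.1.le) _

/-- Weighted third moments when the layers are local. Replacing the weight by its value at the field
with the cell `j` resampled makes it independent of the layer, at the cost of a fourth moment. -/
theorem mixedMoment_le_of_isLocal (h : LayerBounds cell μ F L π M₁ M₂)
    (hex : Exchangeable cell μ) (hloc : IsLocal cell L) (hF : Measurable F) (e : ι → ℕ) {s m : ℝ}
    (hw1 : ∫⁻ x, ‖s * (F x - m)‖ₑ ^ 2 ∂μ ≤ 1) (θ : Set.Ioo (0 : ℝ) 1) (j : ι) :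
    mixedMoment cell e μ (fun x => ‖s * (F x - m)‖ₑ) F j
      ≤ (∑' ℓ : ℕ+, π j ℓ ^ (θ : ℝ) * M₁ (6 / (1 - θ)) ℓ j ^ ((1 - (θ : ℝ)) / 2))
        + 3 * ‖s‖ₑ * ∫⁻ p, ‖diff cell F j p‖ₑ ^ 4 ∂(μ.prod μ) := by
  have hdm := measurable_diff (c := cell) hF j
  have hθ := θ.2
  have h1θ : 0 < 1 - (θ : ℝ) := sub_pos.2 hθ.2
  set W : (E → M) → ℝ := fun x => s * (F x - m) with hW
  have hWm : Measurable W := by fun_prop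
  set G : (E → M) × (E → M) → ℝ≥0∞ := fun p =>
    ‖diff cell F j p‖ₑ ^ 2 * ‖diff cell F j (swap cell (lower e j) p)‖ₑ with hG
  have hGm : Measurable G := by fun_prop
  have hs : ∀ ℓ : ℕ+, MeasurableSet {p | L j p = ℓ} := fun ℓ =>
    h.measurable j (measurableSet_singleton _)
  have hmp := measurePreserving_pair (μ := μ)
  have hmpf : MeasurePreserving (fun q : ((E → M) × (E → M)) × (E → M) => q.1)
      ((μ.prod μ).prod μ) (μ.prod μ) := measurePreserving_fst
  have e0 : mixedMoment cell e μ (fun x => ‖W x‖ₑ) F j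
      = ∫⁻ q, ‖W q.1.1‖ₑ * G (pair q) ∂((μ.prod μ).prod μ) :=
    (hmp.lintegral_comp (f := fun p => ‖W p.1‖ₑ * G p) (by fun_prop)).symm
  have hpt : ∀ q : ((E → M) × (E → M)) × (E → M), ‖W q.1.1‖ₑ * G (pair q)
      ≤ ‖W (mix cell {j} q.1.1 q.1.2)‖ₑ * G (pair q)
        + ‖s‖ₑ * (‖diff cell F j q.1‖ₑ * G (pair q)) := by
    intro q
    have : W q.1.1 = W (mix cell {j} q.1.1 q.1.2) + s * diff cell F j q.1 := by
      simp only [hW, diff]; ring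
    calc ‖W q.1.1‖ₑ * G (pair q)
        ≤ (‖W (mix cell {j} q.1.1 q.1.2)‖ₑ + ‖s * diff cell F j q.1‖ₑ) * G (pair q) := by
          rw [this]
          exact mul_le_mul_left (enorm_add_le _ _) _
      _ = _ := by rw [add_mul, enorm_mul s (diff cell F j q.1), mul_assoc ‖s‖ₑ]
  rw [e0]
  refine (lintegral_mono hpt).trans ?_
  rw [lintegral_add_left (by fun_prop), lintegral_const_mul' _ _ (by finiteness)]
  refine add_le_add ?_ ?_
  · -- the first factor is independent of the layer
    have hcov : ∀ᵐ q ∂((μ.prod μ).prod μ), ‖W (mix cell {j} q.1.1 q.1.2)‖ₑ * G (pair q)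
        ≤ ∑' ℓ : ℕ+, (‖W (mix cell {j} q.1.1 q.1.2)‖ₑ * {p | L j p = ℓ}.indicator 1 (pair q))
          * {p | L j p = ℓ}.indicator G (pair q) := by
      filter_upwards [hmp.quasiMeasurePreserving.ae (h.diff_eq_zero j ∅ (by simp))] with q hq
      rw [swap_empty] at hq
      by_cases h0 : L j (pair q) = 0
      · simp [hG, hq h0]
      · refine le_trans (le_of_eq ?_) (ENNReal.le_tsum ⟨L j (pair q), Nat.pos_of_ne_zero h0⟩)
        simp [Set.indicator]
    refine (lintegral_mono_ae hcov).trans ?_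
    have h3 : Measurable fun q : ((E → M) × (E → M)) × (E → M) =>
        ‖W (mix cell {j} q.1.1 q.1.2)‖ₑ := by fun_prop
    have him : ∀ ℓ : ℕ+, Measurable fun q : ((E → M) × (E → M)) × (E → M) =>
        {p | L j p = ℓ}.indicator (1 : (E → M) × (E → M) → ℝ≥0∞) (pair q) := fun ℓ =>
      (measurable_one.indicator (hs ℓ)).comp measurable_pair
    have hiG : ∀ ℓ : ℕ+, Measurable fun q : ((E → M) × (E → M)) × (E → M) =>
        {p | L j p = ℓ}.indicator G (pair q) := fun ℓ =>
      (hGm.indicator (hs ℓ)).comp measurable_pair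
    rw [lintegral_tsum fun ℓ => by
      exact ((h3.mul (him ℓ)).mul (hiG ℓ)).aemeasurable]
    refine ENNReal.tsum_le_tsum fun ℓ => ?_
    exact h.lintegral_layer_le hex hloc hF e hWm hw1 θ.2 j ℓ
  · have h4 : ∫⁻ q, ‖diff cell F j q.1‖ₑ * G (pair q) ∂((μ.prod μ).prod μ)
        ≤ 3 * ∫⁻ p, ‖diff cell F j p‖ₑ ^ 4 ∂(μ.prod μ) := by
      refine (lintegral_mono fun q => mul_sq_mul_le _ _ _).trans ?_
      rw [lintegral_add_left (by fun_prop), lintegral_add_left (by fun_prop),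
        hmpf.lintegral_comp (f := fun p => ‖diff cell F j p‖ₑ ^ 4) (by fun_prop),
        hmp.lintegral_comp (f := fun p => ‖diff cell F j p‖ₑ ^ 4) (by fun_prop),
        hmp.lintegral_comp (f := fun p => ‖diff cell F j (swap cell (lower e j) p)‖ₑ ^ 4)
          (by fun_prop), hex.lintegral_swap (lower e j) (fun p => ‖diff cell F j p‖ₑ ^ 4)]
      exact le_of_eq (by ring)
    calc _ ≤ ‖s‖ₑ * (3 * ∫⁻ p, ‖diff cell F j p‖ₑ ^ 4 ∂(μ.prod μ)) := by gcongr
      _ = _ := by ring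

end LayerBounds

end Resampling

/-! ### Normal approximation from a system of layers -/

namespace Resampling

variable {ι E M : Type*} {cell : E → ι} {F : (E → M) → ℝ}
  {L : ι → (E → M) × (E → M) → ℕ} {π : ι → ℕ+ → ℝ≥0∞}
  {M₁ : ℝ → ℕ+ → ι → ℝ≥0∞} {M₂ : ℝ → ℕ+ → ι → ℕ+ → ι → ℝ≥0∞}

/-- The bound on the Wasserstein distance in terms of the moments `M₁`, `M₂` of the differences and
of the weights `π`, for a random variable multiplied by `s`. -/
noncomputable def multiscaleBound (s : ℝ) (π : ι → ℕ+ → ℝ≥0∞) (M₁ : ℝ → ℕ+ → ι → ℝ≥0∞)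
    (M₂ : ℝ → ℕ+ → ι → ℕ+ → ι → ℝ≥0∞) (a₃ a₂ : ℝ) : ℝ≥0∞ :=
  ‖s‖ₑ ^ 2 * (⨅ θ : Set.Ioo (0 : ℝ) 1,
      (∑' (i : ι) (j : ι) (k : ι) (ℓ : ℕ+) (ℓ' : ℕ+) (ℓ'' : ℕ+),
        (π i ℓ ^ a₃ * π j ℓ' ^ a₃ * π k ℓ'' ^ a₃) ^ (θ : ℝ)
          * M₂ (4 / (1 - (θ : ℝ))) ℓ i ℓ' j ^ ((1 - (θ : ℝ)) / 4)
          * M₂ (4 / (1 - (θ : ℝ))) ℓ i ℓ'' k ^ ((1 - (θ : ℝ)) / 4)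
          * M₁ (4 / (1 - (θ : ℝ))) ℓ' j ^ ((1 - (θ : ℝ)) / 4)
          * M₁ (4 / (1 - (θ : ℝ))) ℓ'' k ^ ((1 - (θ : ℝ)) / 4)) ^ (1 / 2 : ℝ))
  + ‖s‖ₑ ^ 2 * (⨅ θ : Set.Ioo (0 : ℝ) 1,
      (∑' (i : ι) (j : ι) (ℓ : ℕ+) (ℓ' : ℕ+), (π i ℓ ^ a₂ * π j ℓ' ^ a₂) ^ (θ : ℝ)
          * M₂ (4 / (1 - (θ : ℝ))) ℓ i ℓ' j ^ ((1 - (θ : ℝ)) / 2)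
          * M₁ (4 / (1 - (θ : ℝ))) ℓ' j ^ ((1 - (θ : ℝ)) / 2)) ^ (1 / 2 : ℝ))
  + ‖s‖ₑ ^ 2 * (⨅ θ : Set.Ioo (0 : ℝ) 1,
      (∑' (j : ι) (ℓ : ℕ+),
        π j ℓ ^ (θ : ℝ) * M₁ (4 / (1 - (θ : ℝ))) ℓ j ^ (1 - (θ : ℝ))) ^ (1 / 2 : ℝ))
  + ‖s‖ₑ ^ 3 * (⨅ θ : Set.Ioo (0 : ℝ) 1,
      ∑' (j : ι) (ℓ : ℕ+), π j ℓ ^ (θ : ℝ) * M₁ (3 / (1 - (θ : ℝ))) ℓ j ^ (1 - (θ : ℝ)))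

variable [MeasurableSpace M] {μ : Measure (E → M)} [IsProbabilityMeasure μ]

namespace LayerBounds

/-- The moments of the differences are controlled by the multiscale bound, once the joint laws of
the layers are controlled by powers of the weights. -/
lemma moments_le (h : LayerBounds cell μ F L π M₁ M₂) (hex : Exchangeable cell μ)
    (hF : Measurable F) (e : ι → ℕ) (s : ℝ) {a₃ a₂ : ℝ}
    (h₃ : ∀ i j k, i ≠ j → i ≠ k → j ≠ k → ∀ ℓ ℓ' ℓ'' : ℕ+,
      ((μ.prod μ).prod μ) {q | L i (pairCopy cell i q) = ℓ ∧
        layer cell L i j q = ℓ' ∧ layer cell L i k q = ℓ''}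
        ≤ 3 * (π i ℓ ^ a₃ * π j ℓ' ^ a₃ * π k ℓ'' ^ a₃))
    (h₂ : ∀ i j, i ≠ j → ∀ ℓ ℓ' : ℕ+,
      ((μ.prod μ).prod μ) {q | L i (pairCopy cell i q) = ℓ ∧
        layer cell L i j q = ℓ'} ≤ 3 * (π i ℓ ^ a₂ * π j ℓ' ^ a₂)) :
    ‖s‖ₑ ^ 2 * (fourthMoment cell μ F ^ (1 / 2 : ℝ)
          + pertMoment₂ cell e μ F ^ (1 / 2 : ℝ) + pertMoment₃ cell e μ F ^ (1 / 2 : ℝ))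
        + ‖s‖ₑ ^ 3 * ∑' z, mixedMoment cell e μ 1 F z
      ≤ 2 * multiscaleBound s π M₁ M₂ a₃ a₂ := by
  have b4 := rpow_half_le_two_mul_iInf (fun θ => (h.fourthMoment_le hF θ).trans
    (le_mul_of_one_le_left zero_le (by norm_num : (1 : ℝ≥0∞) ≤ 3)))
  have b2 := rpow_half_le_two_mul_iInf (h.pertMoment₂_le hex hF e
    (w := fun i j ℓ ℓ' => π i ℓ ^ a₂ * π j ℓ' ^ a₂) h₂)
  have b3 := rpow_half_le_two_mul_iInf (h.pertMoment₃_le hex hF e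
    (w := fun i j k ℓ ℓ' ℓ'' => π i ℓ ^ a₃ * π j ℓ' ^ a₃ * π k ℓ'' ^ a₃) h₃)
  have b1 : ∑' z, mixedMoment cell e μ 1 F z ≤ ⨅ θ : Set.Ioo (0 : ℝ) 1, _ :=
    le_iInf fun θ => ENNReal.tsum_le_tsum fun j => h.mixedMoment_one_le hF e θ j
  refine (add_le_add (mul_le_mul_right (add_le_add (add_le_add b4 b2) b3) _)
    (mul_le_mul_right b1 _)).trans ?_
  rw [multiscaleBound, mul_add 2, mul_add 2, mul_add 2]
  refine le_trans (le_of_eq ?_) (add_le_add_right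
    (le_mul_of_one_le_left zero_le (by norm_num : (1 : ℝ≥0∞) ≤ 2)) _)
  ring

variable [Countable ι]

/-- Wasserstein bound from a system of layers. -/
theorem lipschitz_bound (h : LayerBounds cell μ F L π M₁ M₂) (hex : Exchangeable cell μ)
    (hF : Measurable F) {s m a₃ a₂ : ℝ}
    (hF2 : MemLp (fun x => s * (F x - m)) 2 μ) (hF0 : ∫ x, s * (F x - m) ∂μ = 0)
    (hF1 : ∫ x, (s * (F x - m)) ^ 2 ∂μ = 1)
    (h₃ : ∀ i j k, i ≠ j → i ≠ k → j ≠ k → ∀ ℓ ℓ' ℓ'' : ℕ+,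
      ((μ.prod μ).prod μ) {q | L i (pairCopy cell i q) = ℓ ∧
        layer cell L i j q = ℓ' ∧ layer cell L i k q = ℓ''}
        ≤ 3 * (π i ℓ ^ a₃ * π j ℓ' ^ a₃ * π k ℓ'' ^ a₃))
    (h₂ : ∀ i j, i ≠ j → ∀ ℓ ℓ' : ℕ+,
      ((μ.prod μ).prod μ) {q | L i (pairCopy cell i q) = ℓ ∧
        layer cell L i j q = ℓ'} ≤ 3 * (π i ℓ ^ a₂ * π j ℓ' ^ a₂))
    {g : ℝ → ℝ} (hg : LipschitzWith 1 g) :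
    ENNReal.ofReal |(∫ x, g (s * (F x - m)) ∂μ) - ∫ x, g x ∂(gaussianReal 0 1)|
      ≤ 96 * multiscaleBound s π M₁ M₂ a₃ a₂ := by
  obtain ⟨e, he⟩ := exists_injective_nat ι
  refine (hex.lipschitz_bound_affine he hF hF2 hF0 hF1 hg).trans
    ((mul_le_mul_right (h.moments_le hex hF e s h₃ h₂) _).trans (le_of_eq ?_))
  rw [← mul_assoc]
  norm_num

/-- Kolmogorov bound from a system of layers. -/
theorem indicator_bound (h : LayerBounds cell μ F L π M₁ M₂) (hex : Exchangeable cell μ)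
    (hF : Measurable F) {s m a₃ a₂ : ℝ}
    (hF2 : MemLp (fun x => s * (F x - m)) 2 μ) (hF0 : ∫ x, s * (F x - m) ∂μ = 0)
    (hF1 : ∫ x, (s * (F x - m)) ^ 2 ∂μ = 1) (hW1 : ∫⁻ x, ‖s * (F x - m)‖ₑ ^ 2 ∂μ ≤ 1)
    (h₃ : ∀ i j k, i ≠ j → i ≠ k → j ≠ k → ∀ ℓ ℓ' ℓ'' : ℕ+,
      ((μ.prod μ).prod μ) {q | L i (pairCopy cell i q) = ℓ ∧
        layer cell L i j q = ℓ' ∧ layer cell L i k q = ℓ''}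
        ≤ 3 * (π i ℓ ^ a₃ * π j ℓ' ^ a₃ * π k ℓ'' ^ a₃))
    (h₂ : ∀ i j, i ≠ j → ∀ ℓ ℓ' : ℕ+,
      ((μ.prod μ).prod μ) {q | L i (pairCopy cell i q) = ℓ ∧
        layer cell L i j q = ℓ'} ≤ 3 * (π i ℓ ^ a₂ * π j ℓ' ^ a₂)) (t : ℝ) :
    ENNReal.ofReal |μ.real ((fun x => s * (F x - m)) ⁻¹' Set.Iic t)
        - (gaussianReal 0 1).real (Set.Iic t)|
      ≤ 96 * (multiscaleBound s π M₁ M₂ a₃ a₂ + ‖s‖ₑ ^ 3 * ⨅ θ : Set.Ioo (0 : ℝ) 1, ∑' j : ι,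
        (∑' ℓ : ℕ+, π j ℓ ^ (θ : ℝ) * M₁ (6 / (1 - (θ : ℝ))) ℓ j ^ (1 - (θ : ℝ)))
          ^ (1 / 2 : ℝ)) := by
  obtain ⟨e, he⟩ := exists_injective_nat ι
  refine (hex.indicator_bound_affine he hF hF2 hF0 hF1 t).trans ?_
  have b : ∑' z, mixedMoment cell e μ (fun x => ‖s * (F x - m)‖ₑ) F z
      ≤ ⨅ θ : Set.Ioo (0 : ℝ) 1, ∑' j : ι, (∑' ℓ : ℕ+, π j ℓ ^ (θ : ℝ)
        * M₁ (6 / (1 - (θ : ℝ))) ℓ j ^ (1 - (θ : ℝ))) ^ (1 / 2 : ℝ) :=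
    le_iInf fun θ => ENNReal.tsum_le_tsum fun j => h.mixedMoment_le hF e (by fun_prop) hW1 θ j
  refine (mul_le_mul_right (add_le_add (h.moments_le hex hF e s h₃ h₂)
    (mul_le_mul_right b _)) _).trans ?_
  rw [mul_add, mul_add]
  refine add_le_add (le_of_eq ?_) ?_
  · rw [← mul_assoc]
    norm_num
  · gcongr
    norm_num

/-- Kolmogorov bound from a system of local layers. The normalized fourth moment that comes with the
weighted third moments is, when less than one, smaller than its square root, which is part of the
multiscale bound. -/
theorem indicator_bound_of_isLocal (h : LayerBounds cell μ F L π M₁ M₂) (hex : Exchangeable cell μ)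
    (hloc : IsLocal cell L) (hF : Measurable F) {s m a₃ a₂ : ℝ}
    (hF2 : MemLp (fun x => s * (F x - m)) 2 μ) (hF0 : ∫ x, s * (F x - m) ∂μ = 0)
    (hF1 : ∫ x, (s * (F x - m)) ^ 2 ∂μ = 1) (hW1 : ∫⁻ x, ‖s * (F x - m)‖ₑ ^ 2 ∂μ ≤ 1)
    (h₃ : ∀ i j k, i ≠ j → i ≠ k → j ≠ k → ∀ ℓ ℓ' ℓ'' : ℕ+,
      ((μ.prod μ).prod μ) {q | L i (pairCopy cell i q) = ℓ ∧
        layer cell L i j q = ℓ' ∧ layer cell L i k q = ℓ''}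
        ≤ 3 * (π i ℓ ^ a₃ * π j ℓ' ^ a₃ * π k ℓ'' ^ a₃))
    (h₂ : ∀ i j, i ≠ j → ∀ ℓ ℓ' : ℕ+,
      ((μ.prod μ).prod μ) {q | L i (pairCopy cell i q) = ℓ ∧
        layer cell L i j q = ℓ'} ≤ 3 * (π i ℓ ^ a₂ * π j ℓ' ^ a₂)) (t : ℝ) :
    ENNReal.ofReal |μ.real ((fun x => s * (F x - m)) ⁻¹' Set.Iic t)
        - (gaussianReal 0 1).real (Set.Iic t)|
      ≤ 384 * (multiscaleBound s π M₁ M₂ a₃ a₂ + ‖s‖ₑ ^ 3 * ⨅ θ : Set.Ioo (0 : ℝ) 1,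
        ∑' (j : ι) (ℓ : ℕ+),
          π j ℓ ^ (θ : ℝ) * M₁ (6 / (1 - (θ : ℝ))) ℓ j ^ ((1 - (θ : ℝ)) / 2)) := by
  obtain ⟨e, he⟩ := exists_injective_nat ι
  set X := ENNReal.ofReal |μ.real ((fun x => s * (F x - m)) ⁻¹' Set.Iic t)
        - (gaussianReal 0 1).real (Set.Iic t)| with hX
  set G := ⨅ θ : Set.Ioo (0 : ℝ) 1, ∑' (j : ι) (ℓ : ℕ+),
    π j ℓ ^ (θ : ℝ) * M₁ (6 / (1 - (θ : ℝ))) ℓ j ^ ((1 - (θ : ℝ)) / 2) with hG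
  have hX1 : X ≤ 1 := by
    refine ENNReal.ofReal_le_one.2 (abs_le.2 ⟨?_, ?_⟩)
    · have h1 : (0 : ℝ) ≤ μ.real ((fun x => s * (F x - m)) ⁻¹' Set.Iic t) := measureReal_nonneg
      have h2 : (gaussianReal 0 1).real (Set.Iic t) ≤ 1 := measureReal_le_one
      linarith
    · have h1 : μ.real ((fun x => s * (F x - m)) ⁻¹' Set.Iic t) ≤ 1 := measureReal_le_one
      have h2 : 0 ≤ (gaussianReal 0 1).real (Set.Iic t) := measureReal_nonneg
      linarith
  have hmom := h.moments_le hex hF e s h₃ h₂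
  have hmain := hex.indicator_bound_affine he hF hF2 hF0 hF1 t
  set R := multiscaleBound s π M₁ M₂ a₃ a₂ with hR
  -- the square root of the fourth moment of the normalized differences
  set y := ‖s‖ₑ ^ 4 * fourthMoment cell μ F with hy
  have hys : y ^ (1 / 2 : ℝ) ≤ 2 * R := by
    refine le_trans ?_ hmom
    rw [hy, ENNReal.mul_rpow_of_nonneg _ _ (by norm_num)]
    have : (‖s‖ₑ ^ 4) ^ (1 / 2 : ℝ) = ‖s‖ₑ ^ 2 := by
      rw [← ENNReal.rpow_natCast, ← ENNReal.rpow_mul, ← ENNReal.rpow_natCast]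
      norm_num
    rw [this]
    refine le_trans ?_ le_self_add
    gcongr
    rw [add_assoc]
    exact le_self_add
  rcases le_total 1 y with h1 | h1
  · -- the Kolmogorov distance never exceeds one
    calc X ≤ 1 ^ (1 / 2 : ℝ) := by simpa using hX1
      _ ≤ y ^ (1 / 2 : ℝ) := ENNReal.rpow_le_rpow h1 (by norm_num)
      _ ≤ 2 * R := hys
      _ ≤ 384 * (R + ‖s‖ₑ ^ 3 * G) := by
        gcongr
        · norm_num
        · exact le_self_add
  have hy1 : y ≤ 2 * R := by
    refine le_trans ?_ hys
    calc y = y ^ (1 : ℝ) := (ENNReal.rpow_one y).symm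
      _ ≤ y ^ (1 / 2 : ℝ) := ENNReal.rpow_le_rpow_of_exponent_ge h1 (by norm_num)
  have b : ∑' z, mixedMoment cell e μ (fun x => ‖s * (F x - m)‖ₑ) F z
      ≤ G + 3 * ‖s‖ₑ * fourthMoment cell μ F := by
    rw [hG, ENNReal.iInf_add]
    refine le_iInf fun θ => ?_
    rw [fourthMoment, ← ENNReal.tsum_mul_left, ← ENNReal.tsum_add]
    exact ENNReal.tsum_le_tsum fun j => h.mixedMoment_le_of_isLocal hex hloc hF e hW1 θ j
  calc X ≤ 48 * (2 * R + ‖s‖ₑ ^ 3 * (G + 3 * ‖s‖ₑ * fourthMoment cell μ F)) :=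
        hmain.trans (mul_le_mul_right (add_le_add hmom (mul_le_mul_right b _)) _)
    _ = 48 * (2 * R + ‖s‖ₑ ^ 3 * G + 3 * y) := by rw [hy]; ring
    _ ≤ 48 * (2 * R + ‖s‖ₑ ^ 3 * G + 3 * (2 * R)) := by gcongr
    _ = 384 * R + 48 * (‖s‖ₑ ^ 3 * G) := by ring
    _ ≤ 384 * R + 384 * (‖s‖ₑ ^ 3 * G) := by gcongr; norm_num
    _ = _ := by ring

end LayerBounds

end Resampling

/-! ### Layers from action radii -/

namespace Multiscale

open Resampling

variable {d l : ℕ} {E M : Type*}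

lemma resample_eq_mix (cell : E → Site d l) (B : Set (Site d l)) (ω : (E → M) × (E → M)) :
    resample cell B ω = mix cell B ω.1 ω.2 := rfl

lemma diff_eq_resample {cell : E → Site d l} (F : (E → M) → ℝ) {z : Site d l}
    {B : Set (Site d l)} (hz : z ∉ B) (ω : (E → M) × (E → M)) :
    diff cell F z (swap cell B ω) = F (resample cell B ω) - F (resample cell (insert z B) ω) :=
  diff_swap_of_notMem cell F hz ω

lemma resample_empty_swap (cell : E → Site d l) (B : Set (Site d l)) (ω : (E → M) × (E → M)) :
    resample cell ∅ (swap cell B ω) = resample cell B ω := by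
  simp [resample_eq_mix, swap]

lemma resample_singleton_swap (cell : E → Site d l) {z : Site d l} {B : Set (Site d l)}
    (hz : z ∉ B) (ω : (E → M) × (E → M)) :
    resample cell {z} (swap cell B ω) = resample cell (insert z B) ω :=
  mix_insert_eq cell hz ω

lemma resample_pair_swap (cell : E → Site d l) {z z' : Site d l} {B : Set (Site d l)}
    (hz : z ∉ B) (hz' : z' ∉ B) (ω : (E → M) × (E → M)) :
    resample cell {z, z'} (swap cell B ω) = resample cell (insert z (insert z' B)) ω :=
  mix_pair_swap_eq cell hz hz' ω

lemma diff₂_eq_resample {cell : E → Site d l} (F : (E → M) → ℝ) {z z' : Site d l}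
    {B : Set (Site d l)} (hz : z ∉ B) (hz' : z' ∉ B) (ω : (E → M) × (E → M)) :
    diff₂ cell F z z' (swap cell B ω) = F (resample cell B ω) - F (resample cell (insert z B) ω)
      - F (resample cell (insert z' B) ω) + F (resample cell (insert z (insert z' B)) ω) := by
  rw [← resample_empty_swap cell B, ← resample_singleton_swap cell hz,
    ← resample_singleton_swap cell hz', ← resample_pair_swap cell hz hz']
  simp only [diff₂, resample_eq_mix, mix_empty]

/-- Resampling a cell in which the field and its copy agree has no effect. -/
lemma resample_insert_eq_of_eq {cell : E → Site d l} {z : Site d l} {ω : (E → M) × (E → M)}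
    (h : resample cell ∅ ω = resample cell {z} ω) (B : Set (Site d l)) :
    resample cell (insert z B) ω = resample cell B ω := by
  ext f
  by_cases hz : cell f = z
  · have hf : ω.1 f = ω.2 f := by
      have h1 : resample cell ∅ ω f = ω.1 f := mix_of_notMem (Set.notMem_empty _)
      have h2 : resample cell {z} ω f = ω.2 f := mix_of_mem hz
      rw [← h1, ← h2, h]
    have h3 : ∀ B', resample cell B' ω f = ω.1 f := fun B' => by
      by_cases hB : cell f ∈ B'
      · exact (mix_of_mem hB).trans hf.symm
      · exact mix_of_notMem hB
    rw [h3, h3]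
  · by_cases hB : cell f ∈ B
    · exact (mix_of_mem (Set.mem_insert_of_mem z hB)).trans (mix_of_mem hB).symm
    · exact (mix_of_notMem fun h' => h'.elim hz hB).trans (mix_of_notMem hB).symm

/-- An enlarged cube is contained in a larger cube. -/
lemma cube_one_add_closedBall_subset (x : EuclideanSpace ℝ (Fin d)) {ρ r : ℝ} (hρ : ρ ≤ r) :
    cube 1 x + Metric.closedBall 0 ρ ⊆ cube (2 * r + 1) x := by
  rintro _ ⟨u, hu, v, hv, rfl⟩ i
  have hv' : |v i| ≤ r := by
    have h1 : ‖v i‖ ≤ ‖v‖ := PiLp.norm_apply_le v i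
    rw [mem_closedBall_zero_iff] at hv
    rw [← Real.norm_eq_abs]
    linarith
  have hui := hu i
  rw [abs_le] at hv'
  simp only [PiLp.add_apply, Set.mem_Ico] at hui ⊢
  constructor <;> linarith [hui.1, hui.2, hv'.1, hv'.2]

/-- The simultaneous shift of the field and its copy. -/
def shiftPair [AddAction (Fin d → ℤ) E] (a : Fin d → ℤ) (ω : (E → M) × (E → M)) :
    (E → M) × (E → M) :=
  (shiftField a ω.1, shiftField a ω.2)

lemma resample_shiftPair [AddAction (Fin d → ℤ) E] {cell : E → Site d l}
    (hcell : ∀ (a : Fin d → ℤ) (e : E),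
    cell (a +ᵥ e) = ((cell e).1 + a, (cell e).2)) (a : Fin d → ℤ) (B : Set (Site d l))
    (ω : (E → M) × (E → M)) :
    resample cell {w | (w.1 + a, w.2) ∈ B} (shiftPair a ω) = shiftField a (resample cell B ω) := by
  ext e
  have h : cell e ∈ {w : Site d l | (w.1 + a, w.2) ∈ B} ↔ cell (a +ᵥ e) ∈ B := by
    rw [hcell]; rfl
  by_cases hB : cell (a +ᵥ e) ∈ B
  · exact (if_pos (h.2 hB)).trans (if_pos hB).symm
  · exact (if_neg (mt h.1 hB)).trans (if_neg hB).symm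

section

variable [MeasurableSpace M] {cell : E → Site d l} {μ : Measure (E → M)}
  {A : (E → M) → EuclideanSpace ℝ (Fin d) → ℝ} {Z : (EuclideanSpace ℝ (Fin d) → ℝ) → ℝ}
  {L : Site d l → (E → M) × (E → M) → ℕ} {π : (Fin l → ℤ) → ℕ+ → ℝ≥0∞}

/-- The layer `L z` is a scale of the effect of the resampling of the cell `z`, whatever the other
cells that are resampled. -/
structure IsScale (A : (E → M) → EuclideanSpace ℝ (Fin d) → ℝ) (cell : E → Site d l)
    (μ : Measure (E → M)) (z : Site d l) (L : (E → M) × (E → M) → ℕ) : Prop where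
  eq_of_zero : ∀ B, z ∉ B → ∀ᵐ ω ∂(μ.prod μ), L ω = 0 →
    A (resample cell (insert z B) ω) = A (resample cell B ω)
  eqOn_of_le : ∀ B, z ∉ B → ∀ᵐ ω ∂(μ.prod μ), ∀ ℓ : ℕ+, L ω ≤ ℓ →
    Set.EqOn (A (resample cell (insert z B) ω)) (A (resample cell B ω))
      (cube (2 * (ℓ : ℝ) + 1) (intVec z.1))ᶜ

/-- On the event that the scales are small, the differences are localized derivatives. These need
not be measurable, and their moments are lower integrals, which the exchange of cells preserves. -/
theorem layerBounds_of_isScale (hex : Exchangeable cell μ) (hLm : ∀ z, Measurable (L z))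
    (hL : ∀ z, IsScale A cell μ z (L z)) (hπ : ∀ z (ℓ : ℕ+), (μ.prod μ) {ω | L z ω = ℓ} ≤ π z.2 ℓ) :
    LayerBounds cell μ (fun x => Z (A x)) L (fun z => π z.2)
      (fun r ℓ z => moment₁ A cell μ Z r ℓ z)
      (fun r ℓ z ℓ' z' => moment₂ A cell μ Z r ℓ z ℓ' z') where
  measurable := hLm
  measure_le := hπ
  diff_eq_zero z B hz := by
    filter_upwards [(hL z).eq_of_zero B hz] with ω hω h0
    rw [diff_eq_resample _ hz, hω h0, sub_self]
  diff₂_eq_zero z z' B hzz hz hz' := by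
    filter_upwards [(hL z).eq_of_zero B hz, (hL z).eq_of_zero (insert z' B) (by simp [hzz, hz]),
      (hL z').eq_of_zero B hz', (hL z').eq_of_zero (insert z B) (by simp [hzz.symm, hz'])]
      with ω h1 h2 h3 h4 h0
    rw [diff₂_eq_resample _ hz hz']
    rcases h0 with h0 | h0
    · rw [h1 h0, h2 h0]; ring
    · rw [Set.insert_comm z z', h3 h0, h4 h0]; ring
  lintegral_diff_le r _ ℓ z B hz := by
    have hs : MeasurableSet {ω | L z ω ≤ ℓ} := measurableSet_le (hLm z) measurable_const
    rw [moment₁, ← hex.lintegral_swap B]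
    refine (lintegral_mono_ae ?_).trans (setLIntegral_le_lintegral _ _)
    filter_upwards [ae_restrict_of_ae ((hL z).eqOn_of_le B hz), ae_restrict_mem hs] with ω h1 h2
    have hag : AgreeOutside A cell ℓ z.1 {z} ∅ (swap cell B ω) := by
      rw [AgreeOutside, resample_empty_swap, resample_singleton_swap cell hz]
      exact h1 ℓ h2
    rw [discDeriv, if_pos hag, resample_empty_swap, resample_singleton_swap cell hz,
      diff_eq_resample _ hz]
  lintegral_diff₂_le r _ ℓ z ℓ' z' B hzz hz hz' := by
    have hs : MeasurableSet {ω | L z ω ≤ ℓ ∧ L z' ω ≤ ℓ'} :=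
      (measurableSet_le (hLm z) measurable_const).inter
        (measurableSet_le (hLm z') measurable_const)
    rw [moment₂, ← hex.lintegral_swap B]
    refine (lintegral_mono_ae ?_).trans (setLIntegral_le_lintegral _ _)
    filter_upwards [ae_restrict_of_ae ((hL z).eqOn_of_le B hz),
      ae_restrict_of_ae ((hL z).eqOn_of_le (insert z' B) (by simp [hzz, hz])),
      ae_restrict_of_ae ((hL z').eqOn_of_le B hz'),
      ae_restrict_of_ae ((hL z').eqOn_of_le (insert z B) (by simp [hzz.symm, hz'])),
      ae_restrict_mem hs] with ω h1 h2 h3 h4 h5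
    have hag : AgreeOutside A cell ℓ z.1 {z} ∅ (swap cell B ω)
        ∧ AgreeOutside A cell ℓ z.1 {z, z'} {z'} (swap cell B ω)
        ∧ AgreeOutside A cell ℓ' z'.1 {z'} ∅ (swap cell B ω)
        ∧ AgreeOutside A cell ℓ' z'.1 {z, z'} {z} (swap cell B ω) := by
      simp only [AgreeOutside]
      rw [resample_empty_swap, resample_singleton_swap cell hz, resample_singleton_swap cell hz',
        resample_pair_swap cell hz hz']
      refine ⟨h1 ℓ h5.1, h2 ℓ h5.1, h3 ℓ' h5.2, ?_⟩
      rw [Set.insert_comm z z']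
      exact h4 ℓ' h5.2
    rw [discDeriv₂, if_pos hag, resample_empty_swap, resample_singleton_swap cell hz,
      resample_singleton_swap cell hz', resample_pair_swap cell hz hz', diff₂_eq_resample _ hz hz']

/-! ### Transport of scales by the shifts -/

variable [AddAction (Fin d → ℤ) E]

lemma measurable_shiftField (a : Fin d → ℤ) : Measurable (shiftField (E := E) (M := M) a) :=
  measurable_pi_lambda _ fun e => measurable_pi_apply (a +ᵥ e)

lemma measurePreserving_shiftPair [IsProbabilityMeasure μ] (hstat : StationaryLaw d μ)
    (a : Fin d → ℤ) : MeasurePreserving (shiftPair a) (μ.prod μ) (μ.prod μ) :=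
  have h : MeasurePreserving (shiftField a) μ μ := ⟨measurable_shiftField a, hstat a⟩
  h.prod h

/-- A scale in the cell `(0, t)` is carried to a scale in the cell `(x, t)` by the shift. -/
theorem IsScale.comp_shiftPair [IsProbabilityMeasure μ] (hcell : ∀ (a : Fin d → ℤ) (e : E),
    cell (a +ᵥ e) = ((cell e).1 + a, (cell e).2)) (hex : Exchangeable cell μ)
    (hstat : StationaryLaw d μ) (hA : StationaryTransformation A μ) {t : Fin l → ℤ}
    {L₀ : (E → M) × (E → M) → ℕ} (h : IsScale A cell μ (0, t) L₀) (x : Fin d → ℤ) :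
    IsScale A cell μ (x, t) (fun ω => L₀ (shiftPair x ω)) := by
  have hins : ∀ B : Set (Site d l), insert ((0, t) : Site d l) {w : Site d l | (w.1 + x, w.2) ∈ B}
      = {w : Site d l | (w.1 + x, w.2) ∈ insert ((x, t) : Site d l) B} := by
    intro B
    ext w
    simp [Prod.ext_iff]
  have hAae : ∀ B : Set (Site d l), ∀ᵐ ω ∂(μ.prod μ), ∀ y,
      A (resample cell {w | (w.1 + x, w.2) ∈ B} (shiftPair x ω)) y
        = A (resample cell B ω) (y + intVec x) := by
    intro B
    filter_upwards [(hex.measurePreserving_mix B).quasiMeasurePreserving.ae (hA x)] with ω hω y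
    rw [resample_shiftPair hcell]
    exact hω y
  have hsh := (measurePreserving_shiftPair hstat x).quasiMeasurePreserving
  constructor
  · intro B hB
    filter_upwards [hsh.ae (h.eq_of_zero {w | (w.1 + x, w.2) ∈ B} (by simpa using hB)), hAae B,
      hAae (insert (x, t) B)] with ω h1 h2 h3 h0
    ext y
    have e1 := congrFun (h1 h0) (y - intVec x)
    rw [hins, h2, h3, sub_add_cancel] at e1
    exact e1
  · intro B hB
    filter_upwards [hsh.ae (h.eqOn_of_le {w | (w.1 + x, w.2) ∈ B} (by simpa using hB)), hAae B,
      hAae (insert (x, t) B)] with ω h1 h2 h3 ℓ h0 y hy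
    have hy' : y - intVec x ∈ (cube (2 * (ℓ : ℝ) + 1) (intVec ((0, t) : Site d l).1))ᶜ := by
      intro hmem
      refine hy fun i => ?_
      have := hmem i
      simpa [intVec] using this
    have e1 := h1 ℓ h0 hy'
    rw [hins, h2, h3, sub_add_cancel] at e1
    exact e1

end

end Multiscale

namespace Multiscale

open Resampling

/-! ### The smallest layer containing a point -/

section FirstIndex

variable {Ω : Type*} {T : ℕ+ → Set Ω}

/-- The smallest index `ℓ ≥ 1` with `ω ∈ T ℓ`, and `0` if there is none. -/
noncomputable def firstIndex (T : ℕ+ → Set Ω) (ω : Ω) : ℕ :=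
  sInf {n | ∃ ℓ : ℕ+, (ℓ : ℕ) = n ∧ ω ∈ T ℓ}

lemma notMem_of_firstIndex_eq_zero {ω : Ω} (h : firstIndex T ω = 0) (ℓ : ℕ+) : ω ∉ T ℓ := by
  intro hℓ
  have hmem := Nat.sInf_mem (s := {n | ∃ ℓ : ℕ+, (ℓ : ℕ) = n ∧ ω ∈ T ℓ}) ⟨ℓ, ℓ, rfl, hℓ⟩
  obtain ⟨k, hk, -⟩ := hmem
  exact k.ne_zero (hk.trans h)

lemma mem_of_firstIndex_eq {ω : Ω} {ℓ : ℕ+} (h : firstIndex T ω = ℓ) : ω ∈ T ℓ := by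
  have hne : {n | ∃ ℓ : ℕ+, (ℓ : ℕ) = n ∧ ω ∈ T ℓ}.Nonempty := by
    by_contra hemp
    rw [Set.not_nonempty_iff_eq_empty] at hemp
    rw [firstIndex, hemp, Nat.sInf_empty] at h
    exact ℓ.ne_zero h.symm
  obtain ⟨k, hk, hkT⟩ := Nat.sInf_mem hne
  rwa [PNat.coe_injective (hk.trans h)] at hkT

lemma firstIndex_le {ω : Ω} {ℓ : ℕ+} (h : ω ∈ T ℓ) : firstIndex T ω ≤ ℓ :=
  Nat.sInf_le ⟨ℓ, rfl, h⟩

lemma measurable_firstIndex [MeasurableSpace Ω] (hT : ∀ ℓ, MeasurableSet (T ℓ)) :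
    Measurable (firstIndex T) := by
  refine measurable_of_Iic fun n => ?_
  have : firstIndex T ⁻¹' Set.Iic n
      = (⋃ (ℓ : ℕ+) (_ : (ℓ : ℕ) ≤ n), T ℓ) ∪ ⋂ ℓ : ℕ+, (T ℓ)ᶜ := by
    ext ω
    simp only [Set.mem_preimage, Set.mem_Iic, Set.mem_union, Set.mem_iUnion, Set.mem_iInter,
      Set.mem_compl_iff, exists_prop]
    constructor
    · intro h
      rcases Nat.eq_zero_or_pos (firstIndex T ω) with h0 | h0
      · exact Or.inr (notMem_of_firstIndex_eq_zero h0)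
      · exact Or.inl ⟨⟨_, h0⟩, h, mem_of_firstIndex_eq (ℓ := ⟨_, h0⟩) rfl⟩
    · rintro (⟨ℓ, hℓ, h⟩ | h)
      · exact (firstIndex_le h).trans hℓ
      · by_contra hn
        push Not at hn
        exact h ⟨_, (Nat.zero_le n).trans_lt hn⟩ (mem_of_firstIndex_eq (ℓ := ⟨_, _⟩) rfl)
  rw [this]
  exact (MeasurableSet.iUnion fun ℓ => MeasurableSet.iUnion fun _ => hT ℓ).union
    (MeasurableSet.iInter fun ℓ => (hT ℓ).compl)

end FirstIndex

variable {d l : ℕ} {E M : Type*}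

section Shift

variable [AddAction (Fin d → ℤ) E] {T : (Fin l → ℤ) → ℕ+ → Set ((E → M) × (E → M))}

/-- The scale in the cell `(x, t)` defined by sets associated with the cell `(0, t)`. -/
noncomputable def shiftedScale (T : (Fin l → ℤ) → ℕ+ → Set ((E → M) × (E → M))) (z : Site d l)
    (ω : (E → M) × (E → M)) : ℕ :=
  firstIndex (T z.2) (shiftPair z.1 ω)

lemma isLocal_shiftedScale {cell : E → Site d l}
    (hcell : ∀ (a : Fin d → ℤ) (e : E),
    cell (a +ᵥ e) = ((cell e).1 + a, (cell e).2))
    (hT : ∀ t ℓ p p', AgreeOn cell {(0, t)} p p' → (p ∈ T t ℓ ↔ p' ∈ T t ℓ)) :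
    IsLocal cell (shiftedScale T) := by
  rintro ⟨x, t⟩ p p' hp
  have hag : AgreeOn cell {(0, t)} (shiftPair x p) (shiftPair x p') := by
    intro f hf
    rw [Set.mem_singleton_iff] at hf
    exact hp (x +ᵥ f) (by rw [hcell, hf]; simp)
  simp only [shiftedScale, firstIndex, hT t _ _ _ hag]

end Shift

variable [MeasurableSpace M] {cell : E → Site d l} {μ : Measure (E → M)}
  {A : (E → M) → EuclideanSpace ℝ (Fin d) → ℝ}

/-- The event, of probability `π(t, ℓ)`, that the radius lies between `ℓ - 1` and `ℓ` and the
resampling changes the field. -/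
def shell (cell : E → Site d l) (R : Site d l → (E → M) × (E → M) → ℝ≥0∞) (t : Fin l → ℤ)
    (ℓ : ℕ+) : Set ((E → M) × (E → M)) :=
  {ω | (ℓ : ℝ≥0∞) - 1 ≤ R (0, t) ω ∧ R (0, t) ω < (ℓ : ℝ≥0∞) ∧
    resample cell ∅ ω ≠ resample cell {(0, t)} ω}

/-- Measurable sets that contain the shells, and on which the action radii are still small, define
a scale. -/
theorem isScale_firstIndex {t : Fin l → ℤ} {R : Site d l → (E → M) × (E → M) → ℝ≥0∞}
    {ρ : Set (Site d l) → (E → M) × (E → M) → ℝ≥0}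
    (hρ : ∀ B, IsActionRadius A cell μ B (0, t) (ρ B))
    (hR : ∀ᵐ ω ∂(μ.prod μ), R (0, t) ω < ∞) {T : ℕ+ → Set ((E → M) × (E → M))}
    (hST : ∀ ℓ, shell cell R t ℓ ⊆ T ℓ)
    (hTρ : ∀ ℓ B, ∀ᵐ ω ∂(μ.prod μ), ω ∈ T ℓ → ρ B ω < (ℓ : ℕ)) :
    IsScale A cell μ (0, t) (firstIndex T) := by
  have hzero : ∀ᵐ ω ∂(μ.prod μ), firstIndex T ω = 0 → ∀ B,
      resample cell (insert (0, t) B) ω = resample cell B ω := by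
    filter_upwards [hR] with ω hω h0 B
    refine resample_insert_eq_of_eq ?_ B
    by_contra hne
    set r := (R (0, t) ω).toNNReal with hr
    have hrR : R (0, t) ω = r := (ENNReal.coe_toNNReal hω.ne).symm
    -- a field that changes upon resampling lies in the shell of its radius
    set ℓ : ℕ+ := ⟨⌊r⌋₊ + 1, Nat.succ_pos _⟩ with hℓ
    have hcast : ((ℓ : ℕ) : ℝ≥0∞) = ((⌊r⌋₊ : ℝ≥0) : ℝ≥0∞) + 1 := by
      have hn : (ℓ : ℕ) = ⌊r⌋₊ + 1 := rfl
      rw [hn]; push_cast; rfl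
    refine notMem_of_firstIndex_eq_zero h0 ℓ (hST ℓ ⟨?_, ?_, hne⟩)
    · rw [hcast, hrR, ENNReal.add_sub_cancel_right ENNReal.one_ne_top]
      exact_mod_cast Nat.floor_le (zero_le (a := r))
    · rw [hcast, hrR]
      exact_mod_cast Nat.lt_floor_add_one r
  constructor
  · intro B _
    filter_upwards [hzero] with ω hω h0
    rw [hω h0]
  · intro B _
    filter_upwards [hzero, (hρ B).2, ae_all_iff.2 fun ℓ => hTρ ℓ B] with ω h0 h1 h2 ℓ hle
    rcases Nat.eq_zero_or_pos (firstIndex T ω) with hz | hpos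
    · rw [h0 hz]
      exact fun _ _ => rfl
    · have hlt := h2 ⟨_, hpos⟩ (mem_of_firstIndex_eq (ℓ := ⟨_, hpos⟩) rfl)
      refine h1.mono (Set.compl_subset_compl.2 (cube_one_add_closedBall_subset _ ?_))
      have h3 : (ρ B ω : ℝ) < (firstIndex T ω : ℕ) := by exact_mod_cast hlt
      have h4 : ((firstIndex T ω : ℕ) : ℝ) ≤ ((ℓ : ℕ) : ℝ) := by exact_mod_cast hle
      exact h3.le.trans h4

/-- The measurable hull of `S` is almost surely contained in every measurable set that contains
`S`. -/
lemma ae_toMeasurable_imp {Ω : Type*} [MeasurableSpace Ω] {ν : Measure Ω} [IsFiniteMeasure ν]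
    {S U : Set Ω} (hU : MeasurableSet U) (hSU : S ⊆ U) : ∀ᵐ ω ∂ν, ω ∈ toMeasurable ν S → ω ∈ U := by
  rw [ae_iff]
  have h := Measure.measure_toMeasurable_inter (μ := ν) (t := S) hU.compl (measure_ne_top ν S)
  have he : S ∩ Uᶜ = ∅ := by
    rw [← Set.sdiff_eq, Set.sdiff_eq_empty.2 hSU]
  rw [he, measure_empty] at h
  convert h using 2
  ext ω
  simp

/-- A set that depends only on the pair of fields in one cell has a measurable hull with the same
property: the points at which the conditional probability of its hull equals one. -/
theorem exists_local_hull [IsProbabilityMeasure μ] (hex : Exchangeable cell μ) (z : Site d l)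
    {S : Set ((E → M) × (E → M))} (hS : ∀ p p', AgreeOn cell {z} p p' → p ∈ S → p' ∈ S) :
    ∃ T, MeasurableSet T ∧ S ⊆ T ∧ (μ.prod μ) T ≤ (μ.prod μ) S ∧
      ∀ p p', AgreeOn cell {z} p p' → (p ∈ T ↔ p' ∈ T) := by
  set ν := μ.prod μ with hν
  -- the pair equal to `r.1` in the cell `z` and to an independent copy `r.2` elsewhere
  set Φ : ((E → M) × (E → M)) × ((E → M) × (E → M)) → (E → M) × (E → M) :=
    fun r => (mix cell {z} r.2.1 r.1.1, mix cell {z} r.2.2 r.1.2) with hΦ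
  have hΦm : Measurable Φ := by fun_prop
  have hmp : MeasurePreserving Φ (ν.prod ν) ν :=
    (((hex.measurePreserving_mix {z}).prod (hex.measurePreserving_mix {z})).comp
      (measurePreserving_prodProdProdComm μ μ μ μ)).comp
      (Measure.measurePreserving_swap (μ := ν) (ν := ν))
  set H := toMeasurable ν S with hH
  have hHm : MeasurableSet H := measurableSet_toMeasurable ν S
  have hgm : Measurable fun p => ν (Prod.mk p ⁻¹' (Φ ⁻¹' H)) :=
    measurable_measure_prodMk_left (hΦm hHm)
  refine ⟨{p | 1 ≤ ν (Prod.mk p ⁻¹' (Φ ⁻¹' H))}, measurableSet_le measurable_const hgm, ?_, ?_, ?_⟩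
  · intro p hp
    have : Prod.mk p ⁻¹' (Φ ⁻¹' H) = Set.univ := by
      refine Set.eq_univ_of_forall fun p' => subset_toMeasurable ν S (hS p _ (fun f hf => ?_) hp)
      exact ⟨(mix_of_mem hf).symm, (mix_of_mem hf).symm⟩
    simp [this]
  · have h1 := mul_meas_ge_le_lintegral₀ (μ := ν) hgm.aemeasurable 1
    rw [one_mul] at h1
    refine h1.trans (le_of_eq ?_)
    rw [← Measure.prod_apply (hΦm hHm), hmp.measure_preimage hHm.nullMeasurableSet, hH,
      measure_toMeasurable]
  · intro p p' hp
    have : ∀ r, Φ (p, r) = Φ (p', r) := by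
      intro r
      have hmix : ∀ x y y' : E → M, (∀ f, cell f ∈ ({z} : Set (Site d l)) → y f = y' f) →
          mix cell {z} x y = mix cell {z} x y' := by
        intro x y y' hy
        ext f
        by_cases hf : cell f ∈ ({z} : Set (Site d l))
        · rw [mix_of_mem hf, mix_of_mem hf, hy f hf]
        · rw [mix_of_notMem hf, mix_of_notMem hf]
      exact Prod.ext (hmix _ _ _ fun f hf => (hp f hf).1) (hmix _ _ _ fun f hf => (hp f hf).2)
    have hpre : Prod.mk p ⁻¹' (Φ ⁻¹' H) = Prod.mk p' ⁻¹' (Φ ⁻¹' H) := by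
      ext r
      simp only [Set.mem_preimage, this r]
    simp only [Set.mem_ofPred_eq, hpre]

/-- A locally measurable radius depends only on the pair of fields in its cell. -/
lemma IsLocallyMeasurable.eq_of_agreeOn {z : Site d l} {ρ : (E → M) × (E → M) → ℝ≥0}
    (h : IsLocallyMeasurable cell z ρ) {p p' : (E → M) × (E → M)} (hp : AgreeOn cell {z} p p') :
    ρ p = ρ p' := by
  obtain ⟨s, -, hs⟩ := h (measurableSet_singleton (ρ p))
  have hr : ((cell ⁻¹' {z}).domRestrict p.1, (cell ⁻¹' {z}).domRestrict p.2)
      = ((cell ⁻¹' {z}).domRestrict p'.1, (cell ⁻¹' {z}).domRestrict p'.2) :=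
    Prod.ext (funext fun f => (hp f.1 f.2).1) (funext fun f => (hp f.1 f.2).2)
  have h1 : p' ∈ ρ ⁻¹' {ρ p} := by
    have h2 : p ∈ ρ ⁻¹' {ρ p} := rfl
    rw [← hs] at h2 ⊢
    rw [Set.mem_preimage] at h2 ⊢
    exact hr ▸ h2
  exact h1.symm

/-- A locally measurable action radius is an action radius for all the resampled fields. -/
theorem IsActionRadius.of_isLocallyMeasurable [IsProbabilityMeasure μ] (hex : Exchangeable cell μ)
    {z : Site d l} {ρ : (E → M) × (E → M) → ℝ≥0} (hρ : IsActionRadius A cell μ ∅ z ρ)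
    (hloc : IsLocallyMeasurable cell z ρ) (B : Set (Site d l)) : IsActionRadius A cell μ B z ρ := by
  refine ⟨hρ.1, ?_⟩
  by_cases hz : z ∈ B
  · refine Filter.Eventually.of_forall fun ω => ?_
    rw [Set.insert_eq_of_mem hz]
    exact fun _ _ => rfl
  · filter_upwards [(hex B).quasiMeasurePreserving.ae hρ.2] with ω hω
    have h1 : ρ (swap cell B ω) = ρ ω := hloc.eq_of_agreeOn fun f hf => by
      have : cell f ∉ B := by rw [Set.mem_singleton_iff.1 hf]; exact hz
      exact ⟨mix_of_notMem this, mix_of_notMem this⟩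
    rwa [insert_empty_eq, resample_empty_swap, resample_singleton_swap cell hz, h1] at hω

/-! ### The normalized variable -/

section Normalized

variable {Z : (EuclideanSpace ℝ (Fin d) → ℝ) → ℝ}

lemma normalized_moments [IsProbabilityMeasure μ] (hZ2 : MemLp (fun x => Z (A x)) 2 μ)
    (hvar : 0 < variance (fun x => Z (A x)) μ) :
    MemLp (fun x => (stdDev A μ Z)⁻¹ * (Z (A x) - ∫ x', Z (A x') ∂μ)) 2 μ ∧
    ∫ x, (stdDev A μ Z)⁻¹ * (Z (A x) - ∫ x', Z (A x') ∂μ) ∂μ = 0 ∧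
    ∫ x, ((stdDev A μ Z)⁻¹ * (Z (A x) - ∫ x', Z (A x') ∂μ)) ^ 2 ∂μ = 1 := by
  refine ⟨(hZ2.sub (memLp_const _)).const_mul _, ?_, ?_⟩
  · rw [integral_const_mul, integral_sub (hZ2.integrable (by norm_num)) (integrable_const _)]
    simp
  · simp_rw [mul_pow]
    rw [integral_const_mul, ← variance_eq_integral hZ2.aemeasurable, stdDev, inv_pow,
      Real.sq_sqrt hvar.le, inv_mul_cancel₀ hvar.ne']

lemma lintegral_enorm_sq_le_one {W : (E → M) → ℝ} (h2 : MemLp W 2 μ) (h1 : ∫ x, W x ^ 2 ∂μ = 1) :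
    ∫⁻ x, ‖W x‖ₑ ^ 2 ∂μ ≤ 1 := by
  have : ∀ x, ‖W x‖ₑ ^ 2 = ENNReal.ofReal (W x ^ 2) := fun x => by
    rw [Real.enorm_eq_ofReal_abs, ← ENNReal.ofReal_pow (abs_nonneg _), sq_abs]
  simp_rw [this]
  rw [← ofReal_integral_eq_lintegral_ofReal h2.integrable_sq
    (Filter.Eventually.of_forall fun x => sq_nonneg _), h1, ENNReal.ofReal_one]

lemma enorm_inv_stdDev_pow (n : ℕ) :
    ‖(stdDev A μ Z)⁻¹‖ₑ ^ n = ENNReal.ofReal ((stdDev A μ Z)⁻¹ ^ n) := by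
  have h : 0 ≤ (stdDev A μ Z)⁻¹ := inv_nonneg.2 (Real.sqrt_nonneg _)
  rw [Real.enorm_eq_ofReal h, ENNReal.ofReal_pow h]

lemma wassersteinBound_eq (π : (Fin l → ℤ) → ℕ+ → ℝ≥0∞) (a₃ a₂ : ℝ) :
    wassersteinBound A cell μ Z π a₃ a₂ = multiscaleBound (stdDev A μ Z)⁻¹ (fun z => π z.2)
      (fun r ℓ z => moment₁ A cell μ Z r ℓ z)
      (fun r ℓ z ℓ' z' => moment₂ A cell μ Z r ℓ z ℓ' z') a₃ a₂ := by
  rw [wassersteinBound, multiscaleBound, enorm_inv_stdDev_pow, enorm_inv_stdDev_pow]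

lemma wassersteinDist_normalizedLaw_le (hA : Measurable A) (hZ : Measurable Z) {K : ℝ≥0∞}
    (h : ∀ g : ℝ → ℝ, LipschitzWith 1 g →
      ENNReal.ofReal |(∫ x, g ((stdDev A μ Z)⁻¹ * (Z (A x) - ∫ x', Z (A x') ∂μ)) ∂μ)
        - ∫ x, g x ∂(gaussianReal 0 1)| ≤ K) :
    wassersteinDist (normalizedLaw A μ Z) (gaussianReal 0 1) ≤ K := by
  refine iSup_le fun g => ?_
  have hm : Measurable fun x => (stdDev A μ Z)⁻¹ * (Z (A x) - ∫ x', Z (A x') ∂μ) := by fun_prop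
  rw [normalizedLaw, integral_map hm.aemeasurable g.2.continuous.aestronglyMeasurable]
  exact h g.1 g.2

lemma kolmogorovDist_normalizedLaw_le (hA : Measurable A) (hZ : Measurable Z) {K : ℝ≥0∞}
    (h : ∀ t : ℝ, ENNReal.ofReal
      |μ.real ((fun x => (stdDev A μ Z)⁻¹ * (Z (A x) - ∫ x', Z (A x') ∂μ)) ⁻¹' Set.Iic t)
        - (gaussianReal 0 1).real (Set.Iic t)| ≤ K) :
    kolmogorovDist (normalizedLaw A μ Z) (gaussianReal 0 1) ≤ K := by
  refine iSup_le fun t => ?_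
  have hm : Measurable fun x => (stdDev A μ Z)⁻¹ * (Z (A x) - ∫ x', Z (A x') ∂μ) := by fun_prop
  rw [normalizedLaw, map_measureReal_apply hm measurableSet_Iic]
  exact h t

end Normalized

/-! ### Bounds from scales in the cells of the first column -/

section Assembly

variable [AddAction (Fin d → ℤ) E] [IsProbabilityMeasure μ]
  {π : (Fin l → ℤ) → ℕ+ → ℝ≥0∞} {T : (Fin l → ℤ) → ℕ+ → Set ((E → M) × (E → M))}

/-- Scales in the cells `(0, t)` define by the shifts a system of layers for `Z(A)`. -/
theorem layerBounds_shiftedScale (hcell : ∀ (a : Fin d → ℤ) (e : E),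
    cell (a +ᵥ e) = ((cell e).1 + a, (cell e).2)) (hex : Exchangeable cell μ)
    (hstat : StationaryLaw d μ) (hA : StationaryTransformation A μ)
    (Z : (EuclideanSpace ℝ (Fin d) → ℝ) → ℝ) (hT : ∀ t ℓ, MeasurableSet (T t ℓ))
    (hTs : ∀ t, IsScale A cell μ (0, t) (firstIndex (T t)))
    (hTπ : ∀ t ℓ, (μ.prod μ) (T t ℓ) ≤ π t ℓ) :
    LayerBounds cell μ (fun x => Z (A x)) (shiftedScale T) (fun z => π z.2)
      (fun r ℓ z => moment₁ A cell μ Z r ℓ z)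
      (fun r ℓ z ℓ' z' => moment₂ A cell μ Z r ℓ z ℓ' z') := by
  have hsh := fun x => measurePreserving_shiftPair (μ := μ) hstat x
  refine layerBounds_of_isScale hex
    (fun z => (measurable_firstIndex (hT z.2)).comp (hsh z.1).measurable)
    (fun z => (hTs z.2).comp_shiftPair hcell hex hstat hA z.1) fun z ℓ => ?_
  have hm : MeasurableSet {ω | firstIndex (T z.2) ω = ℓ} :=
    measurable_firstIndex (hT z.2) (measurableSet_singleton _)
  calc (μ.prod μ) {ω | shiftedScale T z ω = ℓ} = (μ.prod μ) {ω | firstIndex (T z.2) ω = ℓ} :=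
        (hsh z.1).measure_preimage hm.nullMeasurableSet
    _ ≤ (μ.prod μ) (T z.2 ℓ) := measure_mono fun ω hω => mem_of_firstIndex_eq hω
    _ ≤ π z.2 ℓ := hTπ z.2 ℓ

end Assembly

end Multiscale

/-! ### Normal approximation from action radii -/

namespace Multiscale

open Resampling

variable {d l : ℕ} {E M : Type*} [MeasurableSpace M] [AddAction (Fin d → ℤ) E]
  {cell : E → Site d l} {μ : Measure (E → M)} [IsProbabilityMeasure μ]
  {A : (E → M) → EuclideanSpace ℝ (Fin d) → ℝ} {Z : (EuclideanSpace ℝ (Fin d) → ℝ) → ℝ}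

/-- Normal approximation with strengthened action radii. The layers are defined by the measurable
hulls of the shells, which have the same outer probability. -/
theorem dist_le_of_supRadius (hcell : ∀ (a : Fin d → ℤ) (e : E),
    cell (a +ᵥ e) = ((cell e).1 + a, (cell e).2)) (hind : CompletelyIndependent cell μ)
    (hstat : StationaryLaw d μ) (hAm : Measurable A) (hA : StationaryTransformation A μ)
    {ρ : Site d l → Set (Site d l) → (E → M) × (E → M) → ℝ≥0}
    (hρ : ∀ z B, IsActionRadius A cell μ B z (ρ z B))
    (hfin : ∀ t : Fin l → ℤ, ∀ᵐ ω ∂(μ.prod μ), supRadius ρ (0, t) ω < ∞) (hZ : Measurable Z)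
    (hZ2 : MemLp (fun x => Z (A x)) 2 μ) (hvar : 0 < variance (fun x => Z (A x)) μ) :
    wassersteinDist (normalizedLaw A μ Z) (gaussianReal 0 1)
        ≤ 96 * wassersteinBound A cell μ Z (weight cell μ (supRadius ρ)) (1 / 3) (1 / 2) ∧
      kolmogorovDist (normalizedLaw A μ Z) (gaussianReal 0 1)
        ≤ 96 * (wassersteinBound A cell μ Z (weight cell μ (supRadius ρ)) (1 / 3) (1 / 2)
          + extraTerm₁ A cell μ Z (weight cell μ (supRadius ρ))) := by
  have hex : Exchangeable cell μ := fun B => measurePreserving_swap hind B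
  set T : (Fin l → ℤ) → ℕ+ → Set ((E → M) × (E → M)) := fun t ℓ =>
    toMeasurable (μ.prod μ) (shell cell (supRadius ρ) t ℓ) with hT
  have hTm : ∀ t ℓ, MeasurableSet (T t ℓ) := fun t ℓ => measurableSet_toMeasurable _ _
  have hTs : ∀ t, IsScale A cell μ (0, t) (firstIndex (T t)) := fun t =>
    isScale_firstIndex (hρ (0, t)) (hfin t) (fun ℓ => subset_toMeasurable _ _) fun ℓ B =>
      ae_toMeasurable_imp (U := {ω | ρ (0, t) B ω < (ℓ : ℕ)})
        (measurableSet_lt (hρ (0, t) B).1 measurable_const) fun ω hω => by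
        have h1 : (ρ (0, t) B ω : ℝ≥0∞) ≤ supRadius ρ (0, t) ω :=
          le_iSup (fun B => (ρ (0, t) B ω : ℝ≥0∞)) B
        have h2 := h1.trans_lt hω.2.1
        simp only [Set.mem_ofPred_eq]
        exact_mod_cast h2
  have h := layerBounds_shiftedScale (π := weight cell μ (supRadius ρ)) hcell hex hstat hA Z hTm hTs
    fun t ℓ => (measure_toMeasurable _).le
  have hFm : Measurable fun x => Z (A x) := hZ.comp hAm
  obtain ⟨h2, h0, h1⟩ := normalized_moments hZ2 hvar
  have h₃ := fun i j k (_ : i ≠ j) (_ : i ≠ k) (_ : j ≠ k) ℓ ℓ' ℓ'' =>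
    h.measure_layer₃_le hex i j k ℓ ℓ' ℓ''
  have h₂ := fun i j (_ : i ≠ j) ℓ ℓ' => h.measure_layer₂_le hex i j ℓ ℓ'
  rw [wassersteinBound_eq, extraTerm₁, ← enorm_inv_stdDev_pow]
  exact ⟨wassersteinDist_normalizedLaw_le hAm hZ fun g hg =>
      h.lipschitz_bound hex hFm h2 h0 h1 h₃ h₂ hg,
    kolmogorovDist_normalizedLaw_le hAm hZ fun t =>
      h.indicator_bound hex hFm h2 h0 h1 (lintegral_enorm_sq_le_one h2 h1) h₃ h₂ t⟩

/-- Normal approximation with locally measurable action radii. The layers are defined by hulls of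
the shells that depend on the cell only, and are therefore local. -/
theorem dist_le_of_isLocallyMeasurable (hcell : ∀ (a : Fin d → ℤ) (e : E),
    cell (a +ᵥ e) = ((cell e).1 + a, (cell e).2)) (hind : CompletelyIndependent cell μ)
    (hstat : StationaryLaw d μ) (hAm : Measurable A) (hA : StationaryTransformation A μ)
    {ρ : Site d l → (E → M) × (E → M) → ℝ≥0}
    (hρ : ∀ z, IsActionRadius A cell μ ∅ z (ρ z))
    (hloc : ∀ z, IsLocallyMeasurable cell z (ρ z)) (hZ : Measurable Z)
    (hZ2 : MemLp (fun x => Z (A x)) 2 μ) (hvar : 0 < variance (fun x => Z (A x)) μ) :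
    wassersteinDist (normalizedLaw A μ Z) (gaussianReal 0 1)
        ≤ 96 * wassersteinBound A cell μ Z (weight cell μ fun z ω => (ρ z ω : ℝ≥0∞)) 1 1 ∧
      kolmogorovDist (normalizedLaw A μ Z) (gaussianReal 0 1)
        ≤ 384 * (wassersteinBound A cell μ Z (weight cell μ fun z ω => (ρ z ω : ℝ≥0∞)) 1 1
          + extraTerm₂ A cell μ Z (weight cell μ fun z ω => (ρ z ω : ℝ≥0∞))) := by
  have hex : Exchangeable cell μ := fun B => measurePreserving_swap hind B
  set R : Site d l → (E → M) × (E → M) → ℝ≥0∞ := fun z ω => (ρ z ω : ℝ≥0∞) with hR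
  have hag : ∀ z (p p' : (E → M) × (E → M)), AgreeOn cell {z} p p' → ∀ B ⊆ {z},
      ∀ f, cell f = z → resample cell B p f = resample cell B p' f := by
    intro z p p' hp B _ f hf
    by_cases hB : cell f ∈ B
    · exact (mix_of_mem hB).trans ((hp f hf).2.trans (mix_of_mem hB).symm)
    · exact (mix_of_notMem hB).trans ((hp f hf).1.trans (mix_of_notMem hB).symm)
  have hSl : ∀ t ℓ (p p' : (E → M) × (E → M)), AgreeOn cell {(0, t)} p p' →
      p ∈ shell cell R t ℓ → p' ∈ shell cell R t ℓ := by
    rintro t ℓ p p' hp ⟨h1, h2, h3⟩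
    have hRp : R (0, t) p = R (0, t) p' := by
      simp only [hR, (hloc (0, t)).eq_of_agreeOn hp]
    refine ⟨hRp ▸ h1, hRp ▸ h2, fun heq => h3 ?_⟩
    ext f
    by_cases hf : cell f = (0, t)
    · rw [hag _ _ _ hp ∅ (Set.empty_subset _) f hf, hag _ _ _ hp _ le_rfl f hf, heq]
    · have h4 : resample cell ∅ p f = p.1 f := mix_of_notMem (Set.notMem_empty _)
      have h5 : resample cell {(0, t)} p f = p.1 f := mix_of_notMem hf
      rw [h4, h5]
  -- intersecting the hull with the sublevel set of the radius keeps the radius small on it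
  choose T₀ hT₀m hT₀S hT₀μ hT₀l using fun t ℓ =>
    exists_local_hull hex ((0, t) : Site d l) (hSl t ℓ)
  set T : (Fin l → ℤ) → ℕ+ → Set ((E → M) × (E → M)) := fun t ℓ =>
    T₀ t ℓ ∩ {ω | ρ (0, t) ω < (ℓ : ℕ)} with hT
  have hTm : ∀ t ℓ, MeasurableSet (T t ℓ) := fun t ℓ =>
    (hT₀m t ℓ).inter (measurableSet_lt (hρ (0, t)).1 measurable_const)
  have hTs : ∀ t, IsScale A cell μ (0, t) (firstIndex (T t)) := fun t =>
    isScale_firstIndex (R := R) (ρ := fun _ => ρ (0, t))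
      (fun B => (hρ (0, t)).of_isLocallyMeasurable hex (hloc (0, t)) B)
      (Filter.Eventually.of_forall fun ω => ENNReal.coe_lt_top)
      (fun ℓ ω hω => ⟨hT₀S t ℓ hω, by
        have h2 : (ρ (0, t) ω : ℝ≥0∞) < (ℓ : ℕ) := hω.2.1
        simp only [Set.mem_ofPred_eq]
        exact_mod_cast h2⟩)
      fun ℓ _ => Filter.Eventually.of_forall fun ω hω => hω.2
  have hTl : ∀ t ℓ (p p' : (E → M) × (E → M)), AgreeOn cell {(0, t)} p p' →
      (p ∈ T t ℓ ↔ p' ∈ T t ℓ) := by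
    intro t ℓ p p' hp
    simp only [hT, Set.mem_inter_iff, Set.mem_ofPred_eq, hT₀l t ℓ p p' hp,
      (hloc (0, t)).eq_of_agreeOn hp]
  have h := layerBounds_shiftedScale (π := weight cell μ R) hcell hex hstat hA Z hTm hTs
    fun t ℓ => (measure_mono Set.inter_subset_left).trans (hT₀μ t ℓ)
  have hL : IsLocal cell (shiftedScale T) := isLocal_shiftedScale hcell hTl
  have hFm : Measurable fun x => Z (A x) := hZ.comp hAm
  obtain ⟨h2, h0, h1⟩ := normalized_moments hZ2 hvar
  have h13 : (1 : ℝ≥0∞) ≤ 3 := by norm_num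
  have h₃ := fun i j k (hij : i ≠ j) (hik : i ≠ k) (hjk : j ≠ k) ℓ ℓ' ℓ'' =>
    (h.measure_layer₃_le_of_isLocal hex hL hij hik hjk ℓ ℓ' ℓ'').trans
      (le_mul_of_one_le_left zero_le h13)
  have h₂ := fun i j (hij : i ≠ j) ℓ ℓ' =>
    (h.measure_layer₂_le_of_isLocal hex hL hij ℓ ℓ').trans (le_mul_of_one_le_left zero_le h13)
  rw [wassersteinBound_eq, extraTerm₂, ← enorm_inv_stdDev_pow]
  exact ⟨wassersteinDist_normalizedLaw_le hAm hZ fun g hg =>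
      h.lipschitz_bound hex hFm h2 h0 h1 (by simpa only [ENNReal.rpow_one] using h₃)
        (by simpa only [ENNReal.rpow_one] using h₂) hg,
    kolmogorovDist_normalizedLaw_le hAm hZ fun t =>
      h.indicator_bound_of_isLocal hex hL hFm h2 h0 h1 (lintegral_enorm_sq_le_one h2 h1)
        (by simpa only [ENNReal.rpow_one] using h₃)
        (by simpa only [ENNReal.rpow_one] using h₂) t⟩

end Multiscale

theorem mainTheorem1 (d : ℕ) :
    ∃ C : ℝ≥0, ∀ (l : ℕ) (E : Type*) (M : Type*) [MeasurableSpace M] [AddAction (Fin d → ℤ) E]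
      (cell : E → Multiscale.Site d l)
      (_hcell : ∀ (a : Fin d → ℤ) (e : E), cell (a +ᵥ e) = ((cell e).1 + a, (cell e).2))
      (μ : Measure (E → M)) [IsProbabilityMeasure μ]
      (_hind : Multiscale.CompletelyIndependent cell μ)
      (_hstat : Multiscale.StationaryLaw d μ)
      (A : (E → M) → EuclideanSpace ℝ (Fin d) → ℝ) (_hA : Measurable A)
      (_hAstat : Multiscale.StationaryTransformation A μ),
      -- strengthened action radii
      (∀ ρ : Multiscale.Site d l → Set (Multiscale.Site d l) → (E → M) × (E → M) → ℝ≥0,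
        (∀ z B, Multiscale.IsActionRadius A cell μ B z (ρ z B)) →
        (∀ t : Fin l → ℤ, ∀ᵐ ω ∂(μ.prod μ), Multiscale.supRadius ρ (0, t) ω < ∞) →
        ∀ Z : (EuclideanSpace ℝ (Fin d) → ℝ) → ℝ, Measurable Z →
          MemLp (fun x => Z (A x)) 2 μ → 0 < variance (fun x => Z (A x)) μ →
          let π := Multiscale.weight cell μ (Multiscale.supRadius ρ)
          wassersteinDist (Multiscale.normalizedLaw A μ Z) (gaussianReal 0 1)
              ≤ C * Multiscale.wassersteinBound A cell μ Z π (1 / 3) (1 / 2) ∧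
          kolmogorovDist (Multiscale.normalizedLaw A μ Z) (gaussianReal 0 1)
              ≤ C * (Multiscale.wassersteinBound A cell μ Z π (1 / 3) (1 / 2)
                  + Multiscale.extraTerm₁ A cell μ Z π)) ∧
      -- locally measurable action radii
      (∀ ρ : Multiscale.Site d l → (E → M) × (E → M) → ℝ≥0,
        (∀ z, Multiscale.IsActionRadius A cell μ ∅ z (ρ z)) →
        (∀ z, Multiscale.IsLocallyMeasurable cell z (ρ z)) →
        (∀ z B, Multiscale.IsActionRadius A cell μ B z (ρ z)) ∧
        (∀ z ω, Multiscale.supRadius (fun z _ => ρ z) z ω = ρ z ω) ∧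
        ∀ Z : (EuclideanSpace ℝ (Fin d) → ℝ) → ℝ, Measurable Z →
          MemLp (fun x => Z (A x)) 2 μ → 0 < variance (fun x => Z (A x)) μ →
          let π := Multiscale.weight cell μ (fun z ω => (ρ z ω : ℝ≥0∞))
          wassersteinDist (Multiscale.normalizedLaw A μ Z) (gaussianReal 0 1)
              ≤ C * Multiscale.wassersteinBound A cell μ Z π 1 1 ∧
          kolmogorovDist (Multiscale.normalizedLaw A μ Z) (gaussianReal 0 1)
              ≤ C * (Multiscale.wassersteinBound A cell μ Z π 1 1
                  + Multiscale.extraTerm₂ A cell μ Z π)) := by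
  refine ⟨384, fun l E M _ _ cell hcell μ _ hind hstat A hA hAstat =>
    ⟨fun ρ hρ hfin Z hZ hZ2 hvar => ?_, fun ρ hρ hloc => ⟨fun z B => ?_, fun z ω => ?_,
      fun Z hZ hZ2 hvar => ?_⟩⟩⟩
  · obtain ⟨h1, h2⟩ := Multiscale.dist_le_of_supRadius hcell hind hstat hA hAstat hρ hfin hZ hZ2
      hvar
    exact ⟨h1.trans (mul_le_mul_left (by norm_num) _), h2.trans (mul_le_mul_left (by norm_num) _)⟩
  · exact (hρ z).of_isLocallyMeasurable
      (fun B => Resampling.measurePreserving_swap hind B) (hloc z) B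
  · exact iSup_const
  · obtain ⟨h1, h2⟩ := Multiscale.dist_le_of_isLocallyMeasurable hcell hind hstat hA hAstat hρ hloc
      hZ hZ2 hvar
    exact ⟨h1.trans (mul_le_mul_left (by norm_num) _), h2⟩
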